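/- Setting. Let $m\ge 2$, let $S_j(x)=\rho_jx+b_j$ ($0<\rho_j<1$, $1\le j\le m$) be maps of $\mathbb R$ with $S_j((0,1))\subset(0,1)$ for all $j$, $S_1(0)=0$ and $S_m(1)=1$, and let $K$ be the attractor, i.e. the non-empty compact set with $K=\bigcup_jS_j(K)$. Put $\alpha=\dim_HK$ and assume $\alpha<1$. For a word $\mathbf i=(i_1,\dots,i_n)$ over $\{1,\dots,m\}$ write $|\mathbf i|=n$ and $S_{\mathbf i}=S_{i_1}\circ\cdots\circ S_{i_n}$; $\mathbf i\preceq\mathbf j$ means that $\mathbf i$ is an initial segment of $\mathbf j$. $|E|$ also denotes the diameter of a set $E\subset\mathbb R$. Let $(\mathcal M_k)_{k\ge0}$ be a sequence of nested index sets, that is, of finite sets of words such that: $\mathcal M_0$ consists of the empty word only; $\min_{\mathbf i\in\mathcal M_k}|\mathbf i|$ and $\max_{\mathbf i\in\mathcal M_k}|\mathbf i|$ are non-decreasing in $k$ and tend to $\infty$; distinct words of $\mathcal M_k$ are incomparable under $\preceq$; every word longer than $\max_{\mathbf i\in\mathcal M_k}|\mathbf i|$ has an initial segment in $\mathcal M_k$;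 every word shorter than $\min_{\mathbf i\in\mathcal M_k}|\mathbf i|$ is an initial segment of a word of $\mathcal M_k$; there is a positive integer $L$ with $|\mathbf j|-|\mathbf i|\le L$ whenever $\mathbf i\in\mathcal M_k$, $\mathbf j\in\mathcal M_{k+1}$, $\mathbf i\preceq\mathbf j$, for all $k$; and the open sets $U_k=\bigcup_{\mathbf i\in\mathcal M_k}S_{\mathbf i}((0,1))$ satisfy $U_{k+1}\subset U_k$ for all $k$. The closures of the connected components of $U_k$ are the $k$-th generation islands; $\mathcal F_k^0$ is the set of these, and $\beta^{(k)}_{\max}$, $\beta^{(k)}_{\min}$ are the largest and the smallest of their lengths. Two different islands of the same generation may touch, i.e. have a common endpoint. Islands of different generations count as different islands even if they are equal as sets. For $I\in\mathcal F^0_k$ let $V(I)$ be the set of maps $S_{\mathbf i}$, $\mathbf i\in\mathcal M_k$, with $S_{\mathbf i}([0,1])\subset I$; these intervals are the constitutive intervals of $I$. Islands $I\in\mathcal F^0_k$ and $I'\in\mathcal F^0_{k'}$ are equivalent if there is an affine bijection $\tau$ of $\mathbb R$ with $\tau(I)=I'$, $V(I')=\{\tau\circ v:v\in V(I)\}$ and,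 for all $l\ge1$ and all sets $J$: $J\in\mathcal F^0_{k+l}$ and $J\subset I$ if and only if $\tau(J)\in\mathcal F^0_{k'+l}$ and $\tau(J)\subset I'$. The equivalence classes are the overlap types. Assume that there are only finitely many overlap types (generalized finite type condition), and let $k_0\ge0$ be the smallest integer such that every island in $\mathcal F^0_{k_0+1}$ is equivalent to an island of generation at most $k_0$. Assume that the weighted incidence matrix $A_\alpha$ is irreducible; it is indexed by the overlap types, and $A_\alpha(i,j)=\sum(|J|/|I|)^\alpha$, where $I$ is an island of type $i$, of generation $k$ say, and the sum is over the $J\in\mathcal F^0_{k+1}$ of type $j$ with $J\subset I$. Assume moreover: (A) no constitutive interval of an island contains another constitutive interval of that island; (B) $S_1([0,1])\cap K=S_1(K)$ and $S_m([0,1])\cap K=S_m(K)$. For an island $I=[c,d]$ let $v_0,v_1\in V(I)$ be the maps with $v_0(0)=c$ and $v_1(1)=d$ (unique by (A)), and let $\rho_{v_0},\rho_{v_1}$ be their contraction ratios. Let $p(I)=0$ if $V(I)=\{v_0\}$; otherwise let $p(I)$ be the smallest integer $n\ge1$ with $v_0S_1^n([0,1])\subset[c,c')$, where $c'=\min\{v(0):v\in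 V(I),\,v\ne v_0\}$. Let $q(I)$ be the smallest integer $n\ge0$ with $v_1S_m^n([0,1])\cap K=v_1S_m^n(K)$. Put $$\eta=\min_I\min\Big\{\frac{\rho_{v_0}}{|I|},\frac{\rho_{v_1}}{|I|}\Big\}\cdot\min_I\min\big\{\rho_1^{p(I)},\rho_m^{q(I)}\big\},$$ both minima being over all islands $I$ of all generations. Let $\lambda=\mathcal H^\alpha|_K/\mathcal H^\alpha(K)$, let $d(J)=\lambda(J)/|J|^\alpha$ for non-degenerate intervals $J\subset[0,1]$, and let $$d_{\max}=\sup_{J\subset[0,1]}d(J),\qquad \underline D_0=\inf_{0<x\le1}d([0,x]),\qquad \underline D_1=\inf_{0<x\le1}d([1-x,1]).$$ Theorem 4.9. Suppose that $\rho_1^{n_1}=\rho_m^{n_m}$ for some positive integers $n_1,n_m$. Then there is a least integer $k\ge0$ such that $$2\beta^{(k)}_{\max}\le\big(\eta\,\beta^{(k_0+1)}_{\min}\,\rho_1^{n_1}\min\{\underline D_0,\underline D_1\}\big)^{\frac1{1-\alpha}},$$ and for this $k$ the maximal density $d_{\max}$ is attained for an interval in $\mathcal F_k$, that is, there is a non-degenerate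 interval $J$ whose left endpoint is the left endpoint of a $k$-th generation island and whose right endpoint is the right endpoint of a $k$-th generation island, such that $d(J)=d_{\max}$. -/

import Mathlib

open Set Filter MeasureTheory

/-- A linear iterated function system of `m` orientation preserving contractions
`x ↦ ρ_j x + b_j` of the real line, with `0 < ρ_j < 1`. -/
structure LinearIFS (m : ℕ) where
  /-- the contraction ratios `ρ_j` -/
  ratio : Fin m → ℝ
  /-- the translations `b_j` -/
  shift : Fin m → ℝ
  ratio_pos : ∀ j, 0 < ratio j
  ratio_lt_one : ∀ j, ratio j < 1

namespace LinearIFS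

variable {m : ℕ}

/-- The map `S_j`. -/
def map (S : LinearIFS m) (j : Fin m) (x : ℝ) : ℝ := S.ratio j * x + S.shift j

/-- The map `S_𝐢 = S_{i_1} ∘ ⋯ ∘ S_{i_k}` of a word `𝐢 = (i_1, …, i_k)`. -/
def wordMap (S : LinearIFS m) : List (Fin m) → ℝ → ℝ
  | [] => id
  | i :: w => S.map i ∘ S.wordMap w

/-- `K` is the attractor (self-similar set) of the IFS. -/
def IsAttractor (S : LinearIFS m) (K : Set ℝ) : Prop :=
  IsCompact K ∧ K.Nonempty ∧ K = ⋃ j, S.map j '' K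

/-- The open interval `(0, 1)` is invariant under the IFS. -/
def UnitInvariant (S : LinearIFS m) : Prop := ⋃ j, S.map j '' Ioo 0 1 ⊆ Ioo 0 1

/-- The largest length of a word of an index set. -/
def maxLen (A : Finset (List (Fin m))) : ℕ := A.sup List.length

/-- The smallest length of a word of a (non-empty) index set. -/
noncomputable def minLen (A : Finset (List (Fin m))) : ℕ :=
  sInf (List.length '' (A : Set (List (Fin m))))

/-- The open set `⋃_{𝐢 ∈ M_k} S_𝐢 (0, 1)`. -/
def openUnion (S : LinearIFS m) (M : ℕ → Finset (List (Fin m))) (k : ℕ) : Set ℝ :=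
  ⋃ w ∈ M k, S.wordMap w '' Ioo 0 1

/-- Sequences of nested index sets. The last field records that the open sets
`⋃_{𝐢 ∈ M_k} S_𝐢 (0, 1)` are indeed nested. -/
structure IsNestedIndexSets (S : LinearIFS m) (M : ℕ → Finset (List (Fin m))) : Prop where
  zero : M 0 = {[]}
  min_mono : Monotone fun k => minLen (M k)
  min_tendsto : Tendsto (fun k => minLen (M k)) atTop atTop
  max_mono : Monotone fun k => maxLen (M k)
  max_tendsto : Tendsto (fun k => maxLen (M k)) atTop atTop
  incomparable : ∀ k, ∀ i ∈ M k, ∀ j ∈ M k, i ≠ j → ¬ i <+: j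
  exists_prefix : ∀ k, ∀ j : List (Fin m), maxLen (M k) < j.length → ∃ i ∈ M k, i <+: j
  exists_extension : ∀ k, ∀ j : List (Fin m), j.length < minLen (M k) → ∃ i ∈ M k, j <+: i
  bounded_step : ∃ L : ℕ, 0 < L ∧ ∀ k, ∀ i ∈ M k, ∀ j ∈ M (k + 1), i <+: j →
    j.length - i.length ≤ L
  nested : ∀ k, S.openUnion M (k + 1) ⊆ S.openUnion M k

/-- The set `𝓕⁰_k` of `k`-th generation islands: the closures of the connected components
of `⋃_{𝐢 ∈ M_k} S_𝐢 (0, 1)`. -/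
def islands (S : LinearIFS m) (M : ℕ → Finset (List (Fin m))) (k : ℕ) : Set (Set ℝ) :=
  {I | ∃ x ∈ S.openUnion M k, I = closure (connectedComponentIn (S.openUnion M k) x)}

/-- An island together with its generation. -/
structure Island (S : LinearIFS m) (M : ℕ → Finset (List (Fin m))) where
  gen : ℕ
  carrier : Set ℝ
  mem : carrier ∈ S.islands M gen

/-- The vertex set `V(I)` of an island `I` of generation `k`: the maps `S_𝐢`, `𝐢 ∈ M_k`, with
`S_𝐢 [0, 1] ⊆ I`. The intervals `S_𝐢 [0, 1]` are the constitutive intervals of `I`. -/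
def vertices (S : LinearIFS m) (M : ℕ → Finset (List (Fin m))) (k : ℕ) (I : Set ℝ) :
    Set (ℝ → ℝ) :=
  {v | (∃ w ∈ M k, v = S.wordMap w) ∧ v '' Icc 0 1 ⊆ I}

/-- Equivalence of islands: a linear function `τ` maps `I` onto `I'`, carries the vertices of `I`
to those of `I'`, and the islands inside `I`, `l ≥ 1` generations later, to those inside `I'`. -/
def islandRel (S : LinearIFS m) (M : ℕ → Finset (List (Fin m))) (I I' : Island S M) : Prop :=
  ∃ τ : ℝ ≃ᵃ[ℝ] ℝ, τ '' I.carrier = I'.carrier ∧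
    S.vertices M I'.gen I'.carrier = (fun v => τ ∘ v) '' S.vertices M I.gen I.carrier ∧
    ∀ l : ℕ, 1 ≤ l → ∀ J : Set ℝ,
      (J ∈ S.islands M (I.gen + l) ∧ J ⊆ I.carrier ↔
        τ '' J ∈ S.islands M (I'.gen + l) ∧ τ '' J ⊆ I'.carrier)

theorem islandRel_equivalence (S : LinearIFS m) (M : ℕ → Finset (List (Fin m))) :
    Equivalence (S.islandRel M) where
  refl I := by
    refine ⟨AffineEquiv.refl ℝ ℝ, by simp, ?_, by simp⟩
    ext v
    simp
  symm := by
    rintro I I' ⟨τ, h1, h2, h3⟩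
    have hs : ∀ A : Set ℝ, τ.symm '' (τ '' A) = A := fun A => by
      rw [← image_comp]; simp
    have hs' : ∀ A : Set ℝ, τ '' (τ.symm '' A) = A := fun A => by
      rw [← image_comp]; simp
    refine ⟨τ.symm, by rw [← h1, hs], ?_, ?_⟩
    · rw [h2, ← image_comp]
      ext v
      simp [Function.comp_def]
    · intro l hl J
      have := h3 l hl (τ.symm '' J)
      rw [hs'] at this
      exact this.symm
  trans := by
    rintro I I' I'' ⟨τ, h1, h2, h3⟩ ⟨σ, g1, g2, g3⟩
    have hc : ∀ A : Set ℝ, (τ.trans σ) '' A = σ '' (τ '' A) := fun A => by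
      rw [← image_comp]; simp
    refine ⟨τ.trans σ, by rw [hc, h1, g1], ?_, ?_⟩
    · rw [g2, h2, ← image_comp]
      ext v
      simp [Function.comp_def]
    · intro l hl J
      rw [hc]
      exact (h3 l hl J).trans (g3 l hl (τ '' J))

/-- The equivalence relation `∼` on islands. -/
def islandSetoid (S : LinearIFS m) (M : ℕ → Finset (List (Fin m))) : Setoid (Island S M) :=
  ⟨S.islandRel M, S.islandRel_equivalence M⟩

/-- Overlap types: equivalence classes of islands. -/
abbrev OverlapType (S : LinearIFS m) (M : ℕ → Finset (List (Fin m))) : Type :=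
  Quotient (S.islandSetoid M)

/-- The generalized finite type condition with respect to `(0, 1)`, for the given sequence of
nested index sets: there are finitely many overlap types. -/
def GFTC (S : LinearIFS m) (M : ℕ → Finset (List (Fin m))) : Prop :=
  S.UnitInvariant ∧ S.IsNestedIndexSets M ∧ Finite (S.OverlapType M)

/-- The dimension `α` of `K`. -/
noncomputable def dimension (K : Set ℝ) : ℝ := (dimH K).toReal

/-- The weighted incidence matrix `A_α`, indexed by overlap types: for an island `I` of type `i`,
the entry `(i, j)` is the sum of `(|J| / |I|) ^ α` over the offsprings `J` of `I` of type `j`. -/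
noncomputable def weightedIncidence (S : LinearIFS m) (M : ℕ → Finset (List (Fin m))) (α : ℝ) :
    Matrix (S.OverlapType M) (S.OverlapType M) ℝ := fun i j =>
  ∑ᶠ J ∈ {J : Island S M | J.gen = i.out.gen + 1 ∧ J.carrier ⊆ i.out.carrier ∧
      (Quotient.mk (S.islandSetoid M) J) = j},
    (Metric.diam J.carrier / Metric.diam i.out.carrier) ^ α

/-- No constitutive interval of an island contains another one. -/
def AssumptionA (S : LinearIFS m) (M : ℕ → Finset (List (Fin m))) : Prop :=
  ∀ I : Island S M, ∀ u ∈ S.vertices M I.gen I.carrier, ∀ v ∈ S.vertices M I.gen I.carrier,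
    u ≠ v → ¬ u '' Icc 0 1 ⊆ v '' Icc 0 1

/-- `S_1 [0, 1] ∩ K = S_1 K` and `S_m [0, 1] ∩ K = S_m K`; here the maps are numbered from `0`. -/
def AssumptionB (S : LinearIFS (m + 1)) (K : Set ℝ) : Prop :=
  S.map 0 '' Icc 0 1 ∩ K = S.map 0 '' K ∧
    S.map (Fin.last m) '' Icc 0 1 ∩ K = S.map (Fin.last m) '' K

/-- The normalized Hausdorff measure `λ = 𝓗^α|_K / 𝓗^α(K)`. -/
noncomputable def normalizedMeasure (K : Set ℝ) : Measure ℝ :=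
  (Measure.hausdorffMeasure (dimension K) K)⁻¹ •
    (Measure.hausdorffMeasure (dimension K)).restrict K

/-- The density `d(J) = λ(J) / |J| ^ α`. -/
noncomputable def density (K J : Set ℝ) : ℝ :=
  (normalizedMeasure K).real J / Metric.diam J ^ dimension K

/-- The densities of all (non-degenerate) intervals contained in `[0, 1]`; their supremum
is `d_max`. -/
def intervalDensities (K : Set ℝ) : Set ℝ :=
  {d | ∃ J : Set ℝ, J ⊆ Icc 0 1 ∧ J.OrdConnected ∧ 0 < Metric.diam J ∧ d = density K J}

/-- The constant `D̲_0`, the infimum of `d([0, x])` for `0 < x ≤ 1`. -/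
noncomputable def lowerDensityLeft (K : Set ℝ) : ℝ :=
  sInf ((fun x => density K (Icc 0 x)) '' Ioc 0 1)

/-- The constant `D̲_1`, the infimum of `d([1 - x, 1])` for `0 < x ≤ 1`. -/
noncomputable def lowerDensityRight (K : Set ℝ) : ℝ :=
  sInf ((fun x => density K (Icc (1 - x) 1)) '' Ioc 0 1)

/-- The largest length `β_max^(k)` of a `k`-th generation island. -/
noncomputable def betaMax (S : LinearIFS m) (M : ℕ → Finset (List (Fin m))) (k : ℕ) : ℝ :=
  sSup (Metric.diam '' S.islands M k)

/-- The smallest length `β_min^(k)` of a `k`-th generation island. -/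
noncomputable def betaMin (S : LinearIFS m) (M : ℕ → Finset (List (Fin m))) (k : ℕ) : ℝ :=
  sInf (Metric.diam '' S.islands M k)

/-- The smallest `k_0` such that no island of generation `k_0 + 1` is of a new overlap type. -/
noncomputable def k₀ (S : LinearIFS m) (M : ℕ → Finset (List (Fin m))) : ℕ :=
  sInf {k | ∀ I : Island S M, I.gen = k + 1 → ∃ I' : Island S M, I'.gen ≤ k ∧ S.islandRel M I I'}

/-- The interval `J` belongs to the `k`-th generation field: it runs from the left endpoint of a
`k`-th generation island to the right endpoint of a `k`-th generation island. -/
def IsFieldInterval (S : LinearIFS m) (M : ℕ → Finset (List (Fin m))) (k : ℕ) (J : Set ℝ) :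
    Prop :=
  ∃ I ∈ S.islands M k, ∃ I' ∈ S.islands M k, sInf I < sSup I' ∧ J = Icc (sInf I) (sSup I')

open Classical in
/-- The length of `𝐢_0(I) = (1, …, 1)`, where `v` is the vertex at the left endpoint `c` of `I`:
it is `0` if `v` is the only vertex of `I`, and otherwise the smallest `n ≥ 1` such that
`v (S_1^n [0, 1]) ⊆ [c, c')`, where `c'` is the smallest left endpoint of the other constitutive
intervals. -/
noncomputable def leftIndex (S : LinearIFS (m + 1)) (M : ℕ → Finset (List (Fin (m + 1))))
    (I : Island S M) (v : ℝ → ℝ) : ℕ :=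
  if S.vertices M I.gen I.carrier = {v} then 0
  else sInf {n | 1 ≤ n ∧ (v ∘ (S.map 0)^[n]) '' Icc 0 1 ⊆
    Ico (sInf I.carrier) (sInf ((fun u => u 0) '' (S.vertices M I.gen I.carrier \ {v})))}

/-- The length of `𝐢_1(I) = (m, …, m)`, where `v` is the vertex at the right endpoint of `I`:
the smallest `n ≥ 0` such that `v (S_m^n [0, 1]) ∩ K = v (S_m^n K)`. -/
noncomputable def rightIndex (S : LinearIFS (m + 1)) (K : Set ℝ) (v : ℝ → ℝ) : ℕ :=
  sInf {n | (v ∘ (S.map (Fin.last m))^[n]) '' Icc 0 1 ∩ K = (v ∘ (S.map (Fin.last m))^[n]) '' K}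

/-- `η_1`, the minimum over all islands `I` of `ρ_v / |I|` for the vertices `v` at the left and at
the right endpoint of `I`; note that `ρ_v = v 1 - v 0`. -/
noncomputable def eta₁ (S : LinearIFS m) (M : ℕ → Finset (List (Fin m))) : ℝ :=
  sInf {r | ∃ I : Island S M, ∃ v ∈ S.vertices M I.gen I.carrier,
    (v 0 = sInf I.carrier ∨ v 1 = sSup I.carrier) ∧ r = (v 1 - v 0) / Metric.diam I.carrier}

/-- `η_2`, the minimum over all islands `I` of the contraction ratios of `𝐢_0(I)` and `𝐢_1(I)`. -/
noncomputable def eta₂ (S : LinearIFS (m + 1)) (M : ℕ → Finset (List (Fin (m + 1))))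
    (K : Set ℝ) : ℝ :=
  sInf {r | ∃ I : Island S M, ∃ v ∈ S.vertices M I.gen I.carrier,
    (v 0 = sInf I.carrier ∧ r = S.ratio 0 ^ S.leftIndex M I v) ∨
    (v 1 = sSup I.carrier ∧ r = S.ratio (Fin.last m) ^ S.rightIndex K v)}

/-- `η = η_1 η_2`. -/
noncomputable def eta (S : LinearIFS (m + 1)) (M : ℕ → Finset (List (Fin (m + 1))))
    (K : Set ℝ) : ℝ :=
  S.eta₁ M * S.eta₂ M K

end LinearIFS

/-! Short intervals can be blown up without losing density, so a densest interval exists; and a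
densest interval cannot end inside a small constitutive interval, because extending it there would
pay. Both arguments need 0 < H^α(K) < ∞, so that λ is a non-atomic probability measure that scales
by s^α under any affine map of ratio s matching K on two intervals (`distFun_image_eq`). Finiteness:
disjoint copies of K inside K satisfy Σ ρ^α ≤ 1, so a maximal packing at scale r has at most a
constant times r^(-α) members (`exists_cover_of_scale`). Positivity uses that there are finitely
many overlap types: if the measure were 0, a cheap cover of K would turn, through islands, into a
covering of K by contracted images of itself whose ratios have α-th powers summing to less than 1,
and the dimension would drop (`hausdorffMeasure_ne_zero`).

Blow-up (`exists_long_interval`). Remove the massless ends of an interval and take the last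
generation with an island containing it. Inside that island it contains a child, or it straddles two
children with no mass between them (`exists_island_contains_or_straddles`). An affine map of islands
moves the picture, at unchanged density, to a generation at most k₀, whose children have length at
least β = β_min^(k₀+1). In the first case the interval has become long. In the second, (A) and (B)
make λ self-similar at the facing ends of the two children, with ratio ρ_m on the left child and ρ_1
on the right one, on stretches of length at least ηβ. Since ρ_1^n₁ = ρ_m^nₘ = r is a common ratio,
both overhangs can be magnified by the same r^(-n): the mass grows by r^(-nα), the length by at most
r^(-n), as the gap is not magnified (`exists_enlarged_interval`). The result has length at least δ =
ηβr, so the supremum is a maximum over the compact set of intervals of length at least δ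
(`exists_maximal_interval`).

Ends. Let [a, b] be such a maximal interval and suppose that a lies in S_w((0, 1)) with w ∈ M_k.
Extending to S_w(0) adds a length x ≤ β_max^(k) and a mass of at least D̲_0 x^α, while maximality
only allows a gain below x/(b - a) (`gain_lt_of_density_le`). As α < 1, this fails for small x, and
k is chosen so that it does (`false_of_small_extension`). The same holds at b. So neither end lies
in U_k; since a maximal interval has no massless ends, K accumulates at a and b from inside, which
makes them ends of islands (`exists_island_left_eq`, `exists_island_right_eq`). -/

open scoped ENNReal NNReal Topology Pointwise

/-! ### Hausdorff measure: scaling, finite covers, sets related to copies of themselves -/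

theorem hausdorffMeasure_image_affine {d a : ℝ} (b : ℝ) (hd : 0 ≤ d) (ha : 0 < a) (A : Set ℝ) :
    Measure.hausdorffMeasure d ((fun x => a * x + b) '' A) =
      ENNReal.ofReal (a ^ d) * Measure.hausdorffMeasure d A := by
  have h1 : (fun x => a * x + b) '' A =
      (IsometryEquiv.addRight b) '' ((fun x => a * x) '' A) := by
    rw [← image_comp]; rfl
  have h2 : (fun x => a * x) '' A = a • A := rfl
  rw [h1, IsometryEquiv.hausdorffMeasure_image, h2, Measure.hausdorffMeasure_smul₀ hd ha.ne']
  rw [ENNReal.smul_def, smul_eq_mul, ENNReal.coe_rpow_of_nonneg _ hd,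
    ← ENNReal.ofReal_rpow_of_pos ha]
  congr 2
  rw [ENNReal.ofReal]
  congr 1
  ext
  simp [abs_of_pos ha, ha.le]

/-- Compactness makes a cheap countable cover finite once its sets are fattened to open intervals.
As d ≤ 1, t ↦ t^d is subadditive, so adding δ_n^(1/d) to the radius costs at most δ_n. -/
theorem exists_finite_cover_of_hausdorffMeasure_eq_zero {d ε : ℝ} (hd : 0 < d) (hd1 : d ≤ 1)
    {K : Set ℝ} (hK : IsCompact K) (h0 : Measure.hausdorffMeasure d K = 0) (hε : 0 < ε) :
    ∃ (T : Finset ℕ) (x r : ℕ → ℝ), (∀ n ∈ T, 0 < r n) ∧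
      (K ⊆ ⋃ n ∈ T, Icc (x n - r n) (x n + r n)) ∧ ∑ n ∈ T, r n ^ d < ε := by
  rw [Measure.hausdorffMeasure_apply] at h0
  have h1 := (ENNReal.iSup_eq_zero.1 (ENNReal.iSup_eq_zero.1 h0 1)) one_pos
  have h2 : (⨅ (t : ℕ → Set ℝ) (_ : K ⊆ ⋃ n, t n) (_ : ∀ n, Metric.ediam (t n) ≤ 1),
      ∑' n, ⨆ _ : (t n).Nonempty, Metric.ediam (t n) ^ d) < ENNReal.ofReal (ε / 2) := by
    rw [h1]; simpa using hε
  simp only [iInf_lt_iff] at h2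
  obtain ⟨t, hKt, htd, hsum⟩ := h2
  obtain ⟨δ, hδ0, hδ⟩ := ENNReal.exists_pos_sum_of_countable
    (ε := ENNReal.ofReal (ε / 2)) (by simpa using hε) ℕ
  have hfin : ∀ n, Metric.ediam (t n) ≠ ∞ := fun n => ((htd n).trans_lt ENNReal.one_lt_top).ne
  set D : ℕ → ℝ := fun n => (Metric.ediam (t n)).toReal with hD
  set e : ℕ → ℝ := fun n => (δ n : ℝ) ^ (1 / d) with he
  have he0 : ∀ n, 0 < e n := fun n => Real.rpow_pos_of_pos (by exact_mod_cast hδ0 n) _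
  have hD0 : ∀ n, 0 ≤ D n := fun n => ENNReal.toReal_nonneg
  classical
  set x : ℕ → ℝ := fun n => if h : (t n).Nonempty then h.choose else 0 with hx
  have hxt : ∀ n, (t n).Nonempty → x n ∈ t n := fun n h => by
    simp only [hx, dif_pos h]; exact h.choose_spec
  have hsub : ∀ n, t n ⊆ Ioo (x n - (D n + e n)) (x n + (D n + e n)) := by
    intro n y hy
    have h3 : dist y (x n) ≤ D n := by
      have := Metric.edist_le_ediam_of_mem hy (hxt n ⟨y, hy⟩)
      rw [dist_edist]
      exact ENNReal.toReal_mono (hfin n) this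
    rw [Real.dist_eq, abs_le] at h3
    have := he0 n
    constructor <;> linarith
  have key : ∀ n, (t n).Nonempty →
      ENNReal.ofReal ((D n + e n) ^ d) ≤
        (⨆ _ : (t n).Nonempty, Metric.ediam (t n) ^ d) + δ n := by
    intro n hn
    rw [← ENNReal.ofReal_rpow_of_nonneg (by have := he0 n; have := hD0 n; linarith) hd.le,
      ENNReal.ofReal_add (hD0 n) (he0 n).le]
    refine (ENNReal.rpow_add_le_add_rpow _ _ hd.le hd1).trans ?_
    gcongr
    · rw [iSup_pos hn, hD, ENNReal.ofReal_toReal (hfin n)]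
    · rw [ENNReal.ofReal_rpow_of_nonneg (he0 n).le hd.le, he]
      simp only
      rw [← Real.rpow_mul (by positivity), one_div_mul_cancel hd.ne', Real.rpow_one]
      simp
  obtain ⟨T, hT⟩ := hK.elim_finite_subcover
    (fun n => {y | (t n).Nonempty ∧ y ∈ Ioo (x n - (D n + e n)) (x n + (D n + e n))})
    (fun n => by
      by_cases h : (t n).Nonempty
      · simpa [h] using! isOpen_Ioo
      · simp [h])
    (hKt.trans (iUnion_mono fun n y hy => ⟨⟨y, hy⟩, hsub n hy⟩))
  -- Empty sets of the cover are not charged in the original sum, so their fattened intervals must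
  -- be dropped.
  refine ⟨T.filter fun n => (t n).Nonempty, x, fun n => D n + e n,
    fun n _ => add_pos_of_nonneg_of_pos (hD0 n) (he0 n), ?_, ?_⟩
  · intro y hy
    obtain ⟨n, hn, hy1, hy2⟩ := mem_iUnion₂.1 (hT hy)
    exact mem_iUnion₂.2 ⟨n, Finset.mem_filter.2 ⟨hn, hy1⟩, Ioo_subset_Icc_self hy2⟩
  · rw [← ENNReal.ofReal_lt_ofReal_iff hε, ENNReal.ofReal_sum_of_nonneg]
    · calc ∑ n ∈ T.filter fun n => (t n).Nonempty, ENNReal.ofReal ((D n + e n) ^ d)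
          ≤ ∑ n ∈ T.filter fun n => (t n).Nonempty,
            ((⨆ _ : (t n).Nonempty, Metric.ediam (t n) ^ d) + δ n) :=
            Finset.sum_le_sum fun n hn => key n (Finset.mem_filter.1 hn).2
        _ ≤ ∑' n, ((⨆ _ : (t n).Nonempty, Metric.ediam (t n) ^ d) + (δ n : ℝ≥0∞)) :=
            ENNReal.sum_le_tsum _
        _ = (∑' n, ⨆ _ : (t n).Nonempty, Metric.ediam (t n) ^ d) + ∑' n, (δ n : ℝ≥0∞) :=
            ENNReal.tsum_add
        _ < ENNReal.ofReal (ε / 2) + ENNReal.ofReal (ε / 2) := ENNReal.add_lt_add hsum hδ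
        _ = ENNReal.ofReal ε := by
            rw [← ENNReal.ofReal_add (by positivity) (by positivity), add_halves]
    · intro n _
      exact Real.rpow_nonneg (add_nonneg (hD0 n) (he0 n).le) _

/-- A bounded set covered by finitely many contracted copies of itself, with contraction ratios
whose `t`-th powers sum to at most `1`, has finite `t`-dimensional Hausdorff measure. -/
theorem hausdorffMeasure_lt_top_of_subset_iUnion_image {K : Set ℝ} (hK : Bornology.IsBounded K)
    {N : ℕ} (g : Fin N → ℝ → ℝ) (r : Fin N → ℝ≥0) (hg : ∀ j, LipschitzWith (r j) (g j))
    (hr : ∀ j, r j < 1) (hKg : K ⊆ ⋃ j, g j '' K) {t : ℝ} (ht : 0 ≤ t)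
    (hsum : ∑ j, r j ^ t ≤ 1) : Measure.hausdorffMeasure t K < ∞ := by
  obtain ⟨q, hq1, hq⟩ : ∃ q : ℝ≥0, q < 1 ∧ ∀ j, r j ≤ q := by
    rcases isEmpty_or_nonempty (Fin N) with h | h
    · exact ⟨0, one_pos, fun j => (IsEmpty.false j).elim⟩
    · obtain ⟨j, hj⟩ := Finite.exists_max r
      exact ⟨r j, hr j, hj⟩
  have hD : Metric.ediam K ≠ ∞ := hK.ediam_ne_top
  -- Substituting the covering into itself shrinks the pieces by q each time, while the sum of the
  -- t-th powers of the diameters never grows.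
  have step : ∀ n : ℕ, ∃ (k : ℕ) (A : Fin k → Set ℝ), K ⊆ ⋃ i, A i ∧
      (∀ i, Metric.ediam (A i) ≤ (q : ℝ≥0∞) ^ n * Metric.ediam K) ∧
      ∑ i, Metric.ediam (A i) ^ t ≤ Metric.ediam K ^ t := by
    intro n
    induction n with
    | zero => exact ⟨1, fun _ => K, fun x hx => mem_iUnion.2 ⟨0, hx⟩, by simp, by simp⟩
    | succ n ih =>
      obtain ⟨k, A, hA1, hA2, hA3⟩ := ih
      let e := (Fintype.equivFin (Fin N × Fin k)).symm
      have hle : ∀ p : Fin N × Fin k, Metric.ediam (g p.1 '' A p.2) ≤ r p.1 * Metric.ediam (A p.2) :=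
        fun p => (hg p.1).ediam_image_le _
      refine ⟨_, fun i => g (e i).1 '' A (e i).2, ?_, ?_, ?_⟩
      · intro x hx
        obtain ⟨j, y, hy, rfl⟩ := mem_iUnion.1 (hKg hx)
        obtain ⟨i, hi⟩ := mem_iUnion.1 (hA1 hy)
        refine mem_iUnion.2 ⟨e.symm (j, i), ?_⟩
        simp only [Equiv.apply_symm_apply]
        exact mem_image_of_mem _ hi
      · intro i
        refine (hle (e i)).trans ?_
        rw [pow_succ', mul_assoc]
        gcongr
        · exact_mod_cast hq _
        · exact hA2 _
      · rw [e.sum_comp (fun p => Metric.ediam (g p.1 '' A p.2) ^ t), Fintype.sum_prod_type]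
        calc ∑ j, ∑ i, Metric.ediam (g j '' A i) ^ t
            ≤ ∑ j, ∑ i, (r j : ℝ≥0∞) ^ t * Metric.ediam (A i) ^ t := by
              refine Finset.sum_le_sum fun j _ => Finset.sum_le_sum fun i _ => ?_
              rw [← ENNReal.mul_rpow_of_nonneg _ _ ht]
              exact ENNReal.rpow_le_rpow (hle (j, i)) ht
          _ = (∑ j, (r j : ℝ≥0∞) ^ t) * ∑ i, Metric.ediam (A i) ^ t := by
              rw [Finset.sum_mul_sum]
          _ ≤ 1 * Metric.ediam K ^ t := by
              gcongr
              simp_rw [← ENNReal.coe_rpow_of_nonneg _ ht]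
              exact_mod_cast hsum
          _ = _ := one_mul _
  choose k A h1 h2 h3 using step
  have hlim : Tendsto (fun n : ℕ => (q : ℝ≥0∞) ^ n * Metric.ediam K) atTop (𝓝 0) := by
    have := ENNReal.Tendsto.mul_const (b := Metric.ediam K)
      (ENNReal.tendsto_pow_atTop_nhds_zero_of_lt_one (r := (q : ℝ≥0∞)) (by exact_mod_cast hq1))
      (Or.inr hD)
    simpa using this
  refine (Measure.hausdorffMeasure_le_liminf_sum t K _ hlim A (Eventually.of_forall h2)
    (Eventually.of_forall h1)).trans_lt ?_
  refine lt_of_le_of_lt (liminf_le_liminf (Eventually.of_forall h3)) ?_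
  rw [liminf_const]
  exact ENNReal.rpow_lt_top_of_nonneg ht hD

/-- If `K` contains at least two separated affine copies of itself with ratios whose `s`-th powers
sum to at least `1`, then the `s`-dimensional content of `K` is bounded below. -/
theorem rpow_le_sum_of_separated_copies {K : Set ℝ} (hne : K.Nonempty) {ι : Type*} [Fintype ι]
    [Nontrivial ι] (ρ b : ι → ℝ) (hρ : ∀ i, 0 < ρ i)
    (hK : ∀ i, ∀ x ∈ K, ρ i * x + b i ∈ K) {δ s : ℝ} (hδ : 0 < δ) (hs : 0 ≤ s)
    (hsep : ∀ i j, i ≠ j → ∀ x ∈ K, ∀ y ∈ K, 2 * δ < |(ρ i * x + b i) - (ρ j * y + b j)|)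
    (hsum : 1 ≤ ∑ i, ρ i ^ s) (T : Finset ℕ) (x r : ℕ → ℝ) (hr : ∀ n ∈ T, 0 < r n)
    (hT : K ⊆ ⋃ n ∈ T, Icc (x n - r n) (x n + r n)) : δ ^ s ≤ ∑ n ∈ T, r n ^ s := by
  classical
  induction T using Finset.strongInduction generalizing x r with
  | H T ih =>
  -- Either one interval alone is large enough, or each is too short to meet two copies. Then the
  -- cover splits into disjoint proper subfamilies, one per copy, and each of them, rescaled to K,
  -- falls under the induction hypothesis.
  by_cases hbig : ∃ n ∈ T, δ ≤ r n
  · obtain ⟨n, hn, hle⟩ := hbig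
    calc δ ^ s ≤ r n ^ s := Real.rpow_le_rpow hδ.le hle hs
      _ ≤ _ := Finset.single_le_sum (f := fun n => r n ^ s)
        (fun i hi => Real.rpow_nonneg (hr i hi).le _) hn
  push Not at hbig
  let U : ι → Finset ℕ := fun i =>
    T.filter fun n => ∃ y ∈ K, ρ i * y + b i ∈ Icc (x n - r n) (x n + r n)
  have hUT : ∀ i, U i ⊆ T := fun i => Finset.filter_subset _ _
  have hUne : ∀ i, (U i).Nonempty := fun i => by
    obtain ⟨y, hy⟩ := hne
    obtain ⟨n, hn, hm⟩ := mem_iUnion₂.1 (hT (hK i y hy))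
    exact ⟨n, Finset.mem_filter.2 ⟨hn, y, hy, hm⟩⟩
  have hdisj : ∀ i j, i ≠ j → Disjoint (U i) (U j) := by
    intro i j hij
    rw [Finset.disjoint_left]
    intro n hi hj
    obtain ⟨hn, y, hy, hy1⟩ := Finset.mem_filter.1 hi
    obtain ⟨-, z, hz, hz1⟩ := Finset.mem_filter.1 hj
    have h1 := hsep i j hij y hy z hz
    have h2 := hbig n hn
    rw [mem_Icc] at hy1 hz1
    have : |(ρ i * y + b i) - (ρ j * z + b j)| ≤ 2 * r n := by rw [abs_le]; constructor <;> linarith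
    linarith
  have hss : ∀ i, U i ⊂ T := by
    intro i
    refine (hUT i).ssubset_of_ne fun h => ?_
    obtain ⟨j, hj⟩ := exists_ne i
    obtain ⟨n, hn⟩ := hUne j
    exact Finset.disjoint_left.1 (hdisj j i hj) hn (h ▸ hUT j hn)
  have hpiece : ∀ i, ρ i ^ s * δ ^ s ≤ ∑ n ∈ U i, r n ^ s := by
    intro i
    have := ih (U i) (hss i) (fun n => (x n - b i) / ρ i) (fun n => r n / ρ i)
      (fun n hn => div_pos (hr n (hUT i hn)) (hρ i)) ?_
    · calc ρ i ^ s * δ ^ s ≤ ρ i ^ s * ∑ n ∈ U i, (r n / ρ i) ^ s := by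
            gcongr; exact Real.rpow_nonneg (hρ i).le _
        _ = _ := by
            rw [Finset.mul_sum]
            refine Finset.sum_congr rfl fun n hn => ?_
            rw [Real.div_rpow (hr n (hUT i hn)).le (hρ i).le, mul_div_cancel₀]
            exact (Real.rpow_pos_of_pos (hρ i) _).ne'
    · intro y hy
      obtain ⟨n, hn, hm⟩ := mem_iUnion₂.1 (hT (hK i y hy))
      refine mem_iUnion₂.2 ⟨n, Finset.mem_filter.2 ⟨hn, y, hy, hm⟩, ?_⟩
      have hp := hρ i
      rw [mem_Icc] at hm ⊢
      rw [← sub_div, ← add_div, div_le_iff₀ hp, le_div_iff₀ hp]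
      constructor <;> nlinarith
  calc δ ^ s ≤ (∑ i, ρ i ^ s) * δ ^ s :=
        le_mul_of_one_le_left (Real.rpow_nonneg hδ.le _) hsum
    _ = ∑ i, ρ i ^ s * δ ^ s := Finset.sum_mul ..
    _ ≤ ∑ i, ∑ n ∈ U i, r n ^ s := Finset.sum_le_sum fun i _ => hpiece i
    _ = ∑ n ∈ Finset.univ.biUnion U, r n ^ s :=
        (Finset.sum_biUnion fun i _ j _ hij => hdisj i j hij).symm
    _ ≤ _ := Finset.sum_le_sum_of_subset_of_nonneg
        (Finset.biUnion_subset.2 fun i _ => hUT i)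
        fun n hn _ => Real.rpow_nonneg (hr n hn).le _

/-- A compact set containing at least two disjoint affine copies of itself with ratios whose
`s`-th powers sum to at least `1` has positive `s`-dimensional Hausdorff measure. -/
theorem hausdorffMeasure_ne_zero_of_disjoint_copies {K : Set ℝ} (hKc : IsCompact K)
    (hne : K.Nonempty) {ι : Type*} [Fintype ι] [Nontrivial ι] (ρ b : ι → ℝ) (hρ : ∀ i, 0 < ρ i)
    (hK : ∀ i, ∀ x ∈ K, ρ i * x + b i ∈ K) {s : ℝ} (hs : 0 < s) (hs1 : s ≤ 1)
    (hdisj : ∀ i j, i ≠ j → Disjoint ((fun x => ρ i * x + b i) '' K) ((fun x => ρ j * x + b j) '' K))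
    (hsum : 1 ≤ ∑ i, ρ i ^ s) : Measure.hausdorffMeasure s K ≠ 0 := by
  have hcomp : ∀ i, IsCompact ((fun x => ρ i * x + b i) '' K) := fun i =>
    hKc.image (by fun_prop)
  have hpair : ∀ i j, ∃ δ > 0, i ≠ j → ∀ x ∈ K, ∀ y ∈ K,
      2 * δ < |(ρ i * x + b i) - (ρ j * y + b j)| := by
    intro i j
    by_cases hij : i = j
    · exact ⟨1, one_pos, fun h => (h hij).elim⟩
    obtain ⟨r, hr, h⟩ := Metric.exists_pos_forall_lt_edist (hcomp i) (hcomp j).isClosed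
      (hdisj i j hij)
    refine ⟨r / 2, by have : (0 : ℝ) < r := hr; linarith, fun _ x hx y hy => ?_⟩
    have := h _ (mem_image_of_mem _ hx) _ (mem_image_of_mem _ hy)
    rw [edist_dist, ← ENNReal.ofReal_coe_nnreal, ENNReal.ofReal_lt_ofReal_iff', Real.dist_eq] at this
    linarith [this.1]
  choose δ hδ h using hpair
  obtain ⟨p, hp⟩ := Finite.exists_min fun p : ι × ι => δ p.1 p.2
  intro h0
  obtain ⟨T, x, r, hr, hT, hlt⟩ := exists_finite_cover_of_hausdorffMeasure_eq_zero hs hs1 hKc h0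
    (Real.rpow_pos_of_pos (hδ p.1 p.2) s)
  refine hlt.not_ge (rpow_le_sum_of_separated_copies hne ρ b hρ hK (hδ p.1 p.2) hs.le ?_ hsum T x r
    hr hT)
  intro i j hij y hy z hz
  exact lt_of_le_of_lt (by have := hp (i, j); simp only at this; linarith) (h i j hij y hy z hz)

theorem hausdorffMeasure_eq_zero_of_dimension_lt {K : Set ℝ} {t : ℝ}
    (h : LinearIFS.dimension K < t) : Measure.hausdorffMeasure t K = 0 := by
  have h0 : 0 ≤ LinearIFS.dimension K := ENNReal.toReal_nonneg
  lift t to ℝ≥0 using h0.trans h.le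
  apply hausdorffMeasure_of_dimH_lt
  rw [LinearIFS.dimension] at h
  have := (ENNReal.ofReal_lt_ofReal_iff (h0.trans_lt h)).2 h
  rwa [ENNReal.ofReal_toReal (Real.dimH_ne_top K), ENNReal.ofReal_coe_nnreal] at this

theorem hausdorffMeasure_eq_top_of_lt_dimension {K : Set ℝ} {t : ℝ} (ht : 0 ≤ t)
    (h : t < LinearIFS.dimension K) : Measure.hausdorffMeasure t K = ∞ := by
  lift t to ℝ≥0 using ht
  apply hausdorffMeasure_of_lt_dimH
  rw [LinearIFS.dimension] at h
  have := (ENNReal.ofReal_lt_ofReal_iff (lt_of_le_of_lt t.2 h)).2 h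
  rwa [ENNReal.ofReal_toReal (Real.dimH_ne_top K), ENNReal.ofReal_coe_nnreal] at this

/-! ### Maps of words and their contraction ratios -/

namespace LinearIFS

variable {m : ℕ}

/-- The contraction ratio of the map of a word. -/
noncomputable def wordRatio (S : LinearIFS m) (w : List (Fin m)) : ℝ :=
  S.wordMap w 1 - S.wordMap w 0

theorem wordMap_cons (S : LinearIFS m) (i : Fin m) (w : List (Fin m)) (x : ℝ) :
    S.wordMap (i :: w) x = S.ratio i * S.wordMap w x + S.shift i := rfl

theorem wordMap_append (S : LinearIFS m) (u w : List (Fin m)) (x : ℝ) :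
    S.wordMap (u ++ w) x = S.wordMap u (S.wordMap w x) := by
  induction u with
  | nil => rfl
  | cons i u ih => rw [List.cons_append, wordMap_cons, ih, wordMap_cons]

theorem wordRatio_nil (S : LinearIFS m) : S.wordRatio [] = 1 := by
  simp [wordRatio, wordMap]

theorem wordRatio_cons (S : LinearIFS m) (i : Fin m) (w : List (Fin m)) :
    S.wordRatio (i :: w) = S.ratio i * S.wordRatio w := by
  simp only [wordRatio, wordMap_cons]; ring

theorem wordMap_eq (S : LinearIFS m) (w : List (Fin m)) (x : ℝ) :
    S.wordMap w x = S.wordRatio w * x + S.wordMap w 0 := by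
  induction w with
  | nil => simp [wordRatio, wordMap]
  | cons i w ih =>
    rw [wordRatio_cons, wordMap_cons, wordMap_cons, ih]; ring

theorem wordRatio_pos (S : LinearIFS m) (w : List (Fin m)) : 0 < S.wordRatio w := by
  induction w with
  | nil => rw [wordRatio_nil]; exact one_pos
  | cons i w ih => rw [wordRatio_cons]; exact mul_pos (S.ratio_pos i) ih

theorem wordRatio_replicate (S : LinearIFS m) (n : ℕ) (j : Fin m) :
    S.wordRatio (List.replicate n j) = S.ratio j ^ n := by
  induction n with
  | zero => simp [wordRatio_nil]
  | succ n ih => rw [List.replicate_succ, wordRatio_cons, ih, pow_succ']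

theorem wordMap_replicate (S : LinearIFS m) (n : ℕ) (j : Fin m) :
    S.wordMap (List.replicate n j) = (S.map j)^[n] := by
  induction n with
  | zero => rfl
  | succ n ih => rw [List.replicate_succ, Function.iterate_succ', wordMap, ih]

theorem wordRatio_le_pow (S : LinearIFS m) {q : ℝ} (hq : ∀ j, S.ratio j ≤ q)
    (w : List (Fin m)) : S.wordRatio w ≤ q ^ w.length := by
  induction w with
  | nil => simp [wordRatio_nil]
  | cons i w ih =>
    rw [wordRatio_cons, List.length_cons, pow_succ']
    exact mul_le_mul (hq i) ih (S.wordRatio_pos w).le ((S.ratio_pos i).le.trans (hq i))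

theorem exists_ratio_le (S : LinearIFS m) : ∃ q : ℝ, 0 < q ∧ q < 1 ∧ ∀ j, S.ratio j ≤ q := by
  rcases isEmpty_or_nonempty (Fin m) with h | h
  · exact ⟨1 / 2, by norm_num, by norm_num, fun j => (IsEmpty.false j).elim⟩
  · obtain ⟨j, hj⟩ := Finite.exists_max S.ratio
    exact ⟨S.ratio j, S.ratio_pos j, S.ratio_lt_one j, hj⟩

theorem exists_le_ratio (S : LinearIFS m) : ∃ q : ℝ, 0 < q ∧ q < 1 ∧ ∀ j, q ≤ S.ratio j := by
  rcases isEmpty_or_nonempty (Fin m) with h | h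
  · exact ⟨1 / 2, by norm_num, by norm_num, fun j => (IsEmpty.false j).elim⟩
  · obtain ⟨j, hj⟩ := Finite.exists_min S.ratio
    exact ⟨S.ratio j, S.ratio_pos j, S.ratio_lt_one j, hj⟩

theorem wordRatio_le_one (S : LinearIFS m) (w : List (Fin m)) : S.wordRatio w ≤ 1 := by
  simpa using S.wordRatio_le_pow (fun j => (S.ratio_lt_one j).le) w

theorem wordMap_strictMono (S : LinearIFS m) (w : List (Fin m)) : StrictMono (S.wordMap w) := by
  intro x y h
  rw [S.wordMap_eq w x, S.wordMap_eq w y]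
  have := mul_lt_mul_of_pos_left h (S.wordRatio_pos w)
  linarith

theorem continuous_wordMap (S : LinearIFS m) (w : List (Fin m)) : Continuous (S.wordMap w) := by
  have : S.wordMap w = fun x => S.wordRatio w * x + S.wordMap w 0 := funext (S.wordMap_eq w)
  rw [this]; fun_prop

theorem wordMap_image_Icc (S : LinearIFS m) (w : List (Fin m)) (x y : ℝ) :
    S.wordMap w '' Icc x y = Icc (S.wordMap w x) (S.wordMap w y) := by
  have : S.wordMap w = fun x => S.wordRatio w * x + S.wordMap w 0 := funext (S.wordMap_eq w)
  rw [this]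
  exact image_affine_Icc' (S.wordRatio_pos w) _ _ _

theorem wordMap_image_Ioo (S : LinearIFS m) (w : List (Fin m)) (x y : ℝ) :
    S.wordMap w '' Ioo x y = Ioo (S.wordMap w x) (S.wordMap w y) := by
  have : S.wordMap w = fun x => S.wordRatio w * x + S.wordMap w 0 := funext (S.wordMap_eq w)
  rw [this]
  exact image_affine_Ioo (S.wordRatio_pos w) _ _ _

theorem wordMap_zero_lt_one (S : LinearIFS m) (w : List (Fin m)) :
    S.wordMap w 0 < S.wordMap w 1 := S.wordMap_strictMono w one_pos

/-! ### Systems on the unit interval -/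

/-- An iterated function system on `[0, 1]` with attractor `K`, whose first map fixes `0` and whose
last map fixes `1`. -/
structure IsUnitSystem (S : LinearIFS (m + 1)) (K : Set ℝ) : Prop where
  one_le : 1 ≤ m
  attractor : S.IsAttractor K
  map_zero : S.map 0 0 = 0
  map_one : S.map (Fin.last m) 1 = 1
  invariant : S.UnitInvariant

namespace IsUnitSystem

variable {S : LinearIFS (m + 1)} {K : Set ℝ}

theorem map_mem_Icc (h : S.IsUnitSystem K) (j : Fin (m + 1)) {x : ℝ} (hx : x ∈ Icc (0 : ℝ) 1) :
    S.map j x ∈ Icc (0 : ℝ) 1 := by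
  have hcont : Continuous (S.map j) := by unfold LinearIFS.map; fun_prop
  have h1 : MapsTo (S.map j) (Ioo 0 1) (Ioo 0 1) := fun y hy =>
    h.invariant (mem_iUnion.2 ⟨j, mem_image_of_mem _ hy⟩)
  have h2 := h1.closure hcont
  rw [closure_Ioo (by norm_num)] at h2
  exact h2 hx

theorem wordMap_mem_Icc (h : S.IsUnitSystem K) (w : List (Fin (m + 1))) {x : ℝ}
    (hx : x ∈ Icc (0 : ℝ) 1) : S.wordMap w x ∈ Icc (0 : ℝ) 1 := by
  induction w with
  | nil => exact hx
  | cons i w ih => exact h.map_mem_Icc i ih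

theorem wordMap_mem_Ioo (h : S.IsUnitSystem K) (w : List (Fin (m + 1))) {x : ℝ}
    (hx : x ∈ Ioo (0 : ℝ) 1) : S.wordMap w x ∈ Ioo (0 : ℝ) 1 := by
  induction w with
  | nil => exact hx
  | cons i w ih => exact h.invariant (mem_iUnion.2 ⟨i, mem_image_of_mem _ ih⟩)

theorem map_mem (h : S.IsUnitSystem K) (j : Fin (m + 1)) {x : ℝ} (hx : x ∈ K) : S.map j x ∈ K := by
  rw [h.attractor.2.2]; exact mem_iUnion.2 ⟨j, mem_image_of_mem _ hx⟩

theorem wordMap_mem (h : S.IsUnitSystem K) (w : List (Fin (m + 1))) {x : ℝ} (hx : x ∈ K) :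
    S.wordMap w x ∈ K := by
  induction w with
  | nil => exact hx
  | cons i w ih => exact h.map_mem i ih

theorem exists_map (h : S.IsUnitSystem K) {x : ℝ} (hx : x ∈ K) : ∃ j, ∃ y ∈ K, S.map j y = x := by
  rw [h.attractor.2.2] at hx
  obtain ⟨j, hj⟩ := mem_iUnion.1 hx
  exact ⟨j, hj⟩

theorem exists_wordMap (h : S.IsUnitSystem K) (n : ℕ) {x : ℝ} (hx : x ∈ K) :
    ∃ w : List (Fin (m + 1)), w.length = n ∧ ∃ y ∈ K, S.wordMap w y = x := by
  induction n generalizing x with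
  | zero => exact ⟨[], rfl, x, hx, rfl⟩
  | succ n ih =>
    obtain ⟨j, y, hy, rfl⟩ := h.exists_map hx
    obtain ⟨w, hw, z, hz, rfl⟩ := ih hy
    exact ⟨j :: w, by simp [hw], z, hz, rfl⟩

theorem isCompact (h : S.IsUnitSystem K) : IsCompact K := h.attractor.1

theorem nonempty (h : S.IsUnitSystem K) : K.Nonempty := h.attractor.2.1

/-- The largest point b of K is some S_j(y) with y ≤ b, and S_j(1) ≤ 1, so b ≤ ρ_j b + 1 - ρ_j and b
≤ 1. The least point is treated alike. -/
theorem subset_Icc (h : S.IsUnitSystem K) : K ⊆ Icc 0 1 := by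
  obtain ⟨b, hbK, hb⟩ := h.isCompact.exists_isGreatest h.nonempty
  obtain ⟨a, haK, ha⟩ := h.isCompact.exists_isLeast h.nonempty
  have h1 : b ≤ 1 := by
    obtain ⟨j, y, hy, hj⟩ := h.exists_map hbK
    have h2 := (h.map_mem_Icc j (right_mem_Icc.2 zero_le_one)).2
    have h3 := mul_le_mul_of_nonneg_left (hb hy) (S.ratio_pos j).le
    have h4 := S.ratio_lt_one j
    simp only [LinearIFS.map] at hj h2
    nlinarith
  have h1' : 0 ≤ a := by
    obtain ⟨j, y, hy, hj⟩ := h.exists_map haK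
    have h2 := (h.map_mem_Icc j (left_mem_Icc.2 zero_le_one)).1
    have h3 := mul_le_mul_of_nonneg_left (ha hy) (S.ratio_pos j).le
    have h4 := S.ratio_lt_one j
    simp only [LinearIFS.map] at hj h2
    nlinarith
  exact fun x hx => ⟨h1'.trans (ha hx), (hb hx).trans h1⟩

/-- S_1 is multiplication by ρ_1 < 1 and maps K into itself, so a positive least element of K would
be moved below itself. -/
theorem zero_mem (h : S.IsUnitSystem K) : (0 : ℝ) ∈ K := by
  obtain ⟨a, haK, ha⟩ := h.isCompact.exists_isLeast h.nonempty
  have h1 := (h.subset_Icc haK).1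
  have h2 := ha (h.map_mem 0 haK)
  have h3 := h.map_zero
  have h4 := S.ratio_lt_one 0
  simp only [LinearIFS.map] at h2 h3
  have : a = 0 := by nlinarith
  exact this ▸ haK

theorem one_mem (h : S.IsUnitSystem K) : (1 : ℝ) ∈ K := by
  obtain ⟨a, haK, ha⟩ := h.isCompact.exists_isGreatest h.nonempty
  have h1 := (h.subset_Icc haK).2
  have h2 := ha (h.map_mem (Fin.last m) haK)
  have h3 := h.map_one
  have h4 := S.ratio_lt_one (Fin.last m)
  simp only [LinearIFS.map] at h2 h3
  have : a = 1 := by nlinarith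
  exact this ▸ haK

theorem iterate_map_zero (h : S.IsUnitSystem K) (n : ℕ) (x : ℝ) :
    (S.map 0)^[n] x = S.ratio 0 ^ n * x := by
  induction n generalizing x with
  | zero => simp
  | succ n ih =>
    have h3 := h.map_zero
    simp only [LinearIFS.map] at h3
    rw [Function.iterate_succ_apply, ih, LinearIFS.map]
    have : S.shift 0 = 0 := by linarith
    rw [this]; ring

theorem iterate_map_last (h : S.IsUnitSystem K) (n : ℕ) (x : ℝ) :
    (S.map (Fin.last m))^[n] x = 1 - S.ratio (Fin.last m) ^ n * (1 - x) := by
  induction n generalizing x with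
  | zero => simp
  | succ n ih =>
    have h3 := h.map_one
    simp only [LinearIFS.map] at h3
    rw [Function.iterate_succ_apply, ih, LinearIFS.map]
    have : S.shift (Fin.last m) = 1 - S.ratio (Fin.last m) := by linarith
    rw [this]; ring

/-! ### Positive dimension and finite Hausdorff measure -/

/-- High iterates of the first and the last map have ratios below 1/2 and so give two disjoint
copies of K. The s-th powers of these ratios sum to 2 at s = 0, hence to more than 1 for some s > 0,
and H^s(K) > 0. -/
theorem dimension_pos (h : S.IsUnitSystem K) : 0 < dimension K := by
  obtain ⟨q, hq0, hq1, hq⟩ := S.exists_ratio_le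
  obtain ⟨n, hn⟩ := exists_pow_lt_of_lt_one (by norm_num : (0 : ℝ) < 1 / 2) hq1
  set a := S.ratio 0 ^ n with ha
  set b := S.ratio (Fin.last m) ^ n with hb
  have ha0 : 0 < a := pow_pos (S.ratio_pos 0) n
  have hb0 : 0 < b := pow_pos (S.ratio_pos _) n
  have ha1 : a < 1 / 2 := (pow_le_pow_left₀ (S.ratio_pos 0).le (hq 0) n).trans_lt hn
  have hb1 : b < 1 / 2 := (pow_le_pow_left₀ (S.ratio_pos _).le (hq _) n).trans_lt hn
  have hcont : ContinuousAt (fun s : ℝ => a ^ s + b ^ s) 0 :=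
    (Real.continuousAt_const_rpow ha0.ne').add (Real.continuousAt_const_rpow hb0.ne')
  have hev : ∀ᶠ s in 𝓝 (0 : ℝ), 1 < a ^ s + b ^ s :=
    hcont.eventually (lt_mem_nhds (by simp))
  obtain ⟨s, ⟨hs, hs1⟩, hs0⟩ := (((hev.filter_mono nhdsWithin_le_nhds).and
    (Filter.Eventually.filter_mono nhdsWithin_le_nhds (eventually_le_nhds one_pos))).and
    (self_mem_nhdsWithin (s := Ioi (0 : ℝ)) (a := 0))).exists
  have hne : Measure.hausdorffMeasure s K ≠ 0 := by
    refine hausdorffMeasure_ne_zero_of_disjoint_copies h.isCompact h.nonempty (ι := Bool)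
      (fun i => if i then a else b) (fun i => if i then 0 else 1 - b) ?_ ?_ hs0 hs1 ?_ ?_
    · intro i; cases i <;> simp [ha0, hb0]
    · intro i x hx
      cases i
      · have := h.wordMap_mem (List.replicate n (Fin.last m)) hx
        rw [wordMap_replicate, h.iterate_map_last] at this
        simp only [Bool.false_eq_true, if_false]
        convert this using 1; ring
      · have := h.wordMap_mem (List.replicate n 0) hx
        rw [wordMap_replicate, h.iterate_map_zero] at this
        simpa using this
    · have key : Disjoint ((fun x => a * x + 0) '' K) ((fun x => b * x + (1 - b)) '' K) := by
        rw [Set.disjoint_left]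
        rintro _ ⟨x, hx, rfl⟩ ⟨y, hy, hxy⟩
        have hx1 := (h.subset_Icc hx).2
        have hy1 := (h.subset_Icc hy).1
        simp only at hxy
        nlinarith
      intro i j hij
      cases i <;> cases j
      · exact (hij rfl).elim
      · simpa using key.symm
      · simpa using key
      · exact (hij rfl).elim
    · simpa using hs.le
  by_contra hcon
  exact hne (hausdorffMeasure_eq_zero_of_dimension_lt ((not_lt.1 hcon).trans_lt hs0))

/-- Disjoint copies of `K` inside `K` satisfy a packing bound. -/
theorem sum_wordRatio_rpow_le_one (h : S.IsUnitSystem K) (hdim : dimension K < 1)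
    (W : Finset (List (Fin (m + 1))))
    (hW : ∀ u ∈ W, ∀ v ∈ W, u ≠ v → Disjoint (S.wordMap u '' K) (S.wordMap v '' K)) :
    ∑ w ∈ W, S.wordRatio w ^ dimension K ≤ 1 := by
  -- A sum exceeding 1 at the exponent α still does at some s with α < s ≤ 1, which gives H^s(K) ≠ 0
  -- beyond the dimension.
  by_contra! hcon
  have hcont : ContinuousAt (fun s : ℝ => ∑ w ∈ W, S.wordRatio w ^ s) (dimension K) :=
    tendsto_finsetSum _ fun w _ => Real.continuousAt_const_rpow (S.wordRatio_pos w).ne'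
  have hev := hcont.eventually (lt_mem_nhds hcon)
  obtain ⟨s, ⟨hs, hs1⟩, hs0⟩ := (((hev.filter_mono nhdsWithin_le_nhds).and
    (Filter.Eventually.filter_mono nhdsWithin_le_nhds (eventually_le_nhds hdim))).and
    (self_mem_nhdsWithin (s := Ioi (dimension K)) (a := dimension K))).exists
  have hs0' : 0 < s := h.dimension_pos.trans hs0
  have hnt : Nontrivial W := by
    by_contra hnt
    rw [not_nontrivial_iff_subsingleton] at hnt
    have hcard : W.card ≤ 1 := by
      rw [← Fintype.card_coe]; exact Fintype.card_le_one_iff_subsingleton.2 hnt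
    have : ∑ w ∈ W, S.wordRatio w ^ dimension K ≤ ∑ w ∈ W, 1 :=
      Finset.sum_le_sum fun w _ => Real.rpow_le_one (S.wordRatio_pos w).le (S.wordRatio_le_one w)
        h.dimension_pos.le
    have h2 : ((W.card : ℕ) : ℝ) ≤ 1 := by exact_mod_cast hcard
    simp at this
    linarith
  have himg : ∀ w, (fun x => S.wordRatio w * x + S.wordMap w 0) = S.wordMap w :=
    fun w => (funext (S.wordMap_eq w)).symm
  refine hausdorffMeasure_ne_zero_of_disjoint_copies h.isCompact h.nonempty (ι := W)
    (fun w => S.wordRatio w) (fun w => S.wordMap w 0) (fun w => S.wordRatio_pos w) ?_ hs0' hs1 ?_ ?_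
    (hausdorffMeasure_eq_zero_of_dimension_lt hs0)
  · intro w x hx
    rw [← S.wordMap_eq]; exact h.wordMap_mem w hx
  · intro u v huv
    rw [himg, himg]
    exact hW u u.2 v v.2 fun e => huv (Subtype.ext e)
  · rw [Finset.sum_coe_sort W (fun w => S.wordRatio w ^ s)]; exact hs.le

/-- Follow an address of x and stop as soon as the ratio is at most r; the last letter costs at most
a factor c. -/
theorem exists_word_of_scale (h : S.IsUnitSystem K) {c : ℝ} (hc : ∀ j, c ≤ S.ratio j)
    {r : ℝ} (hr : 0 < r) (hr1 : r < 1) {x : ℝ} (hx : x ∈ K) :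
    ∃ w : List (Fin (m + 1)), c * r ≤ S.wordRatio w ∧ S.wordRatio w ≤ r ∧
      x ∈ S.wordMap w '' K := by
  obtain ⟨q, hq0, hq1, hq⟩ := S.exists_ratio_le
  have aux : ∀ n : ℕ, ∀ r : ℝ, 0 < r → r < 1 → q ^ n ≤ r → ∀ x ∈ K,
      ∃ w : List (Fin (m + 1)), c * r ≤ S.wordRatio w ∧ S.wordRatio w ≤ r ∧
      x ∈ S.wordMap w '' K := by
    intro n
    induction n with
    | zero => intro r _ hr1 hr; simp at hr; linarith
    | succ n ih =>
      intro r hr hr1 hqr x hx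
      obtain ⟨j, y, hy, rfl⟩ := h.exists_map hx
      have hj := S.ratio_pos j
      by_cases hrj : S.ratio j ≤ r
      · refine ⟨[j], ?_, ?_, y, hy, rfl⟩
        · rw [wordRatio_cons, wordRatio_nil, mul_one]
          have := hc j; nlinarith
        · rw [wordRatio_cons, wordRatio_nil, mul_one]; exact hrj
      · push Not at hrj
        obtain ⟨w, h1, h2, z, hz, rfl⟩ := ih (r / S.ratio j) (div_pos hr hj)
          ((div_lt_one hj).2 hrj) (by
            rw [le_div_iff₀ hj]
            have := mul_le_mul_of_nonneg_left (hq j) (pow_pos hq0 n).le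
            rw [pow_succ] at hqr; linarith) y hy
        refine ⟨j :: w, ?_, ?_, z, hz, rfl⟩
        · rw [wordRatio_cons]
          rw [← mul_div_assoc, div_le_iff₀ hj] at h1; linarith
        · rw [wordRatio_cons]
          rw [le_div_iff₀ hj] at h2; linarith
  obtain ⟨n, hn⟩ := exists_pow_lt_of_lt_one hr hq1
  exact aux n r hr hr1 hn.le x hx

/-- Take a family of disjoint copies at scale r of maximal cardinality; the packing bound limits its
size. By maximality every point of K lies in a copy at that scale meeting a member of the family,
hence within 2r of the left end of that member. -/
theorem exists_cover_of_scale (h : S.IsUnitSystem K) (hdim : dimension K < 1) {c : ℝ} (hc0 : 0 < c)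
    (hc : ∀ j, c ≤ S.ratio j) {r : ℝ} (hr : 0 < r) (hr1 : r < 1) :
    ∃ T : Finset ℝ, (T.card : ℝ) * (c * r) ^ dimension K ≤ 1 ∧
      K ⊆ ⋃ x ∈ T, Icc (x - 2 * r) (x + 2 * r) := by
  classical
  set α := dimension K with hα
  let P : Finset (List (Fin (m + 1))) → Prop := fun W =>
    (∀ w ∈ W, c * r ≤ S.wordRatio w ∧ S.wordRatio w ≤ r) ∧
    (∀ u ∈ W, ∀ v ∈ W, u ≠ v → Disjoint (S.wordMap u '' K) (S.wordMap v '' K))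
  have hcr : 0 < c * r := mul_pos hc0 hr
  have hbound : ∀ W, P W → (W.card : ℝ) * (c * r) ^ α ≤ 1 := by
    intro W hW
    calc (W.card : ℝ) * (c * r) ^ α = ∑ w ∈ W, (c * r) ^ α := by simp
      _ ≤ ∑ w ∈ W, S.wordRatio w ^ α := Finset.sum_le_sum fun w hw =>
          Real.rpow_le_rpow hcr.le (hW.1 w hw).1 h.dimension_pos.le
      _ ≤ 1 := h.sum_wordRatio_rpow_le_one hdim W hW.2
  obtain ⟨N, hN⟩ := exists_nat_ge (1 / (c * r) ^ α)
  have hcard : ∀ W, P W → W.card ≤ N := by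
    intro W hW
    have h1 := hbound W hW
    rw [← le_div_iff₀ (Real.rpow_pos_of_pos hcr α)] at h1
    exact_mod_cast h1.trans hN
  obtain ⟨W, hW, hmax⟩ : ∃ W, P W ∧ ∀ W', P W' → W'.card ≤ W.card := by
    let Q : ℕ → Prop := fun n => ∃ W, P W ∧ W.card = n
    have hQ0 : Q 0 := ⟨∅, ⟨by simp, by simp⟩, rfl⟩
    obtain ⟨W, hW, hWc⟩ : Q (Nat.findGreatest Q N) := Nat.findGreatest_spec (Nat.zero_le N) hQ0
    refine ⟨W, hW, fun W' hW' => ?_⟩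
    rw [hWc]
    exact Nat.le_findGreatest (hcard W' hW') ⟨W', hW', rfl⟩
  have hdiam : ∀ w, S.wordRatio w ≤ r → ∀ x ∈ S.wordMap w '' K, |x - S.wordMap w 0| ≤ r := by
    rintro w hw _ ⟨y, hy, rfl⟩
    have h1 := h.subset_Icc hy
    rw [S.wordMap_eq w y, add_sub_cancel_right, abs_of_nonneg (mul_nonneg (S.wordRatio_pos w).le h1.1)]
    have := S.wordRatio_pos w
    nlinarith [h1.1, h1.2]
  refine ⟨W.image fun w => S.wordMap w 0, ?_, ?_⟩
  · refine le_trans ?_ (hbound W hW)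
    gcongr
    exact Finset.card_image_le
  · intro x hx
    obtain ⟨w, hw1, hw2, hxw⟩ := h.exists_word_of_scale hc hr hr1 hx
    have hmeet : ∃ v ∈ W, ¬ Disjoint (S.wordMap v '' K) (S.wordMap w '' K) := by
      by_contra! hcon
      have hwW : w ∉ W := fun hw => by
        have := hcon w hw
        rw [disjoint_self] at this
        exact (h.nonempty.image (S.wordMap w)).ne_empty this
      have := hmax (insert w W) ⟨?_, ?_⟩
      · rw [Finset.card_insert_of_notMem hwW] at this; omega
      · intro v hv
        rcases Finset.mem_insert.1 hv with rfl | hv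
        · exact ⟨hw1, hw2⟩
        · exact hW.1 v hv
      · intro u hu v hv huv
        rcases Finset.mem_insert.1 hu with rfl | hu' <;> rcases Finset.mem_insert.1 hv with rfl | hv'
        · exact (huv rfl).elim
        · exact (hcon v hv').symm
        · exact hcon u hu'
        · exact hW.2 u hu' v hv' huv
    obtain ⟨v, hv, hvw⟩ := hmeet
    obtain ⟨z, hz1, hz2⟩ := Set.not_disjoint_iff.1 hvw
    have e1 := abs_le.1 (hdiam v (hW.1 v hv).2 z hz1)
    have e2 : |x - z| ≤ r := by
      obtain ⟨y, hy, rfl⟩ := hxw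
      obtain ⟨y', hy', rfl⟩ := hz2
      have b1 := h.subset_Icc hy
      have b2 := h.subset_Icc hy'
      have hp := S.wordRatio_pos w
      rw [S.wordMap_eq w y, S.wordMap_eq w y', abs_le]
      constructor <;> nlinarith [b1.1, b1.2, b2.1, b2.2]
    rw [abs_le] at e2
    refine mem_iUnion₂.2 ⟨S.wordMap v 0, Finset.mem_image_of_mem _ hv, ?_, ?_⟩ <;> linarith

theorem hausdorffMeasure_lt_top (h : S.IsUnitSystem K) (hdim : dimension K < 1) :
    Measure.hausdorffMeasure (dimension K) K < ∞ := by
  obtain ⟨c, hc0, hc1, hc⟩ := S.exists_le_ratio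
  set α := dimension K with hα
  have hα0 : 0 < α := h.dimension_pos
  have hr : ∀ n : ℕ, 0 < (1 / 2 : ℝ) ^ (n + 1) := fun n => by positivity
  have hr1 : ∀ n : ℕ, (1 / 2 : ℝ) ^ (n + 1) < 1 := fun n =>
    pow_lt_one₀ (by norm_num) (by norm_num) (by omega)
  choose T hT1 hT2 using fun n => h.exists_cover_of_scale hdim hc0 hc (hr n) (hr1 n)
  have hlim : Tendsto (fun n : ℕ => ENNReal.ofReal (4 * (1 / 2 : ℝ) ^ (n + 1))) atTop (𝓝 0) := by
    rw [← ENNReal.ofReal_zero]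
    apply ENNReal.tendsto_ofReal
    have := ((tendsto_pow_atTop_nhds_zero_of_lt_one (by norm_num : (0 : ℝ) ≤ 1 / 2)
      (by norm_num)).comp (tendsto_add_atTop_nat 1)).const_mul 4
    simpa using this
  have hd : ∀ (n : ℕ) (x : ℝ), Metric.ediam (Icc (x - 2 * (1 / 2 : ℝ) ^ (n + 1))
      (x + 2 * (1 / 2 : ℝ) ^ (n + 1))) = ENNReal.ofReal (4 * (1 / 2 : ℝ) ^ (n + 1)) := by
    intro n x
    rw [Real.ediam_Icc]; congr 1; ring
  refine (Measure.hausdorffMeasure_le_liminf_sum α K _ hlim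
    (fun (n : ℕ) (x : T n) => Icc ((x : ℝ) - 2 * (1 / 2 : ℝ) ^ (n + 1))
      ((x : ℝ) + 2 * (1 / 2 : ℝ) ^ (n + 1)))
    (Eventually.of_forall fun n x => (hd n x).le)
    (Eventually.of_forall fun n x hx => ?_)).trans_lt ?_
  · obtain ⟨y, hy, hxy⟩ := mem_iUnion₂.1 (hT2 n hx)
    exact mem_iUnion.2 ⟨⟨y, hy⟩, hxy⟩
  · have hb : ∀ n, ∑ x : T n, Metric.ediam (Icc ((x : ℝ) - 2 * (1 / 2 : ℝ) ^ (n + 1))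
      ((x : ℝ) + 2 * (1 / 2 : ℝ) ^ (n + 1))) ^ α ≤ ENNReal.ofReal ((4 / c) ^ α) := by
      intro n
      simp_rw [hd]
      rw [Finset.sum_const, Finset.card_univ, Fintype.card_coe, nsmul_eq_mul,
        ENNReal.ofReal_rpow_of_pos (by positivity), ← ENNReal.ofReal_natCast,
        ← ENNReal.ofReal_mul (by positivity)]
      apply ENNReal.ofReal_le_ofReal
      have e : 4 * (1 / 2 : ℝ) ^ (n + 1) = (4 / c) * (c * (1 / 2 : ℝ) ^ (n + 1)) := by
        field_simp
      rw [e, Real.mul_rpow (by positivity) (by positivity)]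
      have := mul_le_mul_of_nonneg_left (hT1 n) (Real.rpow_nonneg (by positivity : 0 ≤ 4 / c) α)
      linarith
    refine lt_of_le_of_lt (liminf_le_liminf (Eventually.of_forall hb)) ?_
    rw [liminf_const]
    exact ENNReal.ofReal_lt_top

end IsUnitSystem

end LinearIFS

/-! ### Islands as intervals and their relation to K -/

/-- An end of the component lying in U could be adjoined without losing connectedness, and an end
lying in the component contradicts openness. -/
theorem exists_connectedComponentIn_eq_Ioo {U : Set ℝ} (hU : IsOpen U) {a b : ℝ}
    (hUb : U ⊆ Ioo a b) {x : ℝ} (hx : x ∈ U) :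
    ∃ c d, x ∈ Ioo c d ∧ connectedComponentIn U x = Ioo c d ∧ c ∉ U ∧ d ∉ U := by
  set C := connectedComponentIn U x with hC
  have hCo : IsOpen C := hU.connectedComponentIn
  have hCp : IsPreconnected C := isPreconnected_connectedComponentIn
  have hxC : x ∈ C := mem_connectedComponentIn hx
  have hCU : C ⊆ U := connectedComponentIn_subset U x
  have hbb : BddBelow C := (bddBelow_Ioo.mono hUb).mono hCU
  have hba : BddAbove C := (bddAbove_Ioo.mono hUb).mono hCU
  have hne : C.Nonempty := ⟨x, hxC⟩
  have hend : ∀ y ∈ closure C, y ∈ U → y ∈ C := by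
    intro y hy hyU
    have h1 : IsPreconnected (insert y C) :=
      hCp.subset_closure (subset_insert _ _) (insert_subset hy subset_closure)
    exact h1.subset_connectedComponentIn (mem_insert_of_mem _ hxC)
      (insert_subset hyU hCU) (mem_insert _ _)
  have hcC : sInf C ∉ C := by
    intro hmem
    obtain ⟨ε, hε, hball⟩ := Metric.isOpen_iff.1 hCo _ hmem
    have h2 : sInf C - ε / 2 ∈ C := hball (by
      rw [Metric.mem_ball, Real.dist_eq, sub_sub_cancel_left, abs_neg, abs_of_pos] <;> linarith)
    linarith [csInf_le hbb h2]
  have hdC : sSup C ∉ C := by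
    intro hmem
    obtain ⟨ε, hε, hball⟩ := Metric.isOpen_iff.1 hCo _ hmem
    have h2 : sSup C + ε / 2 ∈ C := hball (by
      rw [Metric.mem_ball, Real.dist_eq, add_sub_cancel_left, abs_of_pos] <;> linarith)
    linarith [le_csSup hba h2]
  have hEq : C = Ioo (sInf C) (sSup C) := by
    apply Subset.antisymm
    · intro y hy
      refine ⟨lt_of_le_of_ne (csInf_le hbb hy) fun h => hcC (h ▸ hy),
        lt_of_le_of_ne (le_csSup hba hy) fun h => hdC (h ▸ hy)⟩
    · exact IsConnected.Ioo_csInf_csSup_subset ⟨hne, hCp⟩ hbb hba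
  refine ⟨sInf C, sSup C, hEq ▸ hxC, hEq, fun h => hcC (hend _ (csInf_mem_closure hne hbb) h),
    fun h => hdC (hend _ (csSup_mem_closure hne hba) h)⟩

namespace LinearIFS

variable {m : ℕ}

/-- `[c, d]` is an island of generation `k`. -/
structure IsIsland (S : LinearIFS m) (M : ℕ → Finset (List (Fin m))) (k : ℕ) (c d : ℝ) :
    Prop where
  lt : c < d
  subset : Ioo c d ⊆ S.openUnion M k
  left_notMem : c ∉ S.openUnion M k
  right_notMem : d ∉ S.openUnion M k

theorem mem_openUnion {S : LinearIFS m} {M : ℕ → Finset (List (Fin m))} {k : ℕ} {x : ℝ} :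
    x ∈ S.openUnion M k ↔ ∃ w ∈ M k, x ∈ Ioo (S.wordMap w 0) (S.wordMap w 1) := by
  simp only [openUnion, mem_iUnion₂, wordMap_image_Ioo, exists_prop]

theorem isOpen_openUnion (S : LinearIFS m) (M : ℕ → Finset (List (Fin m))) (k : ℕ) :
    IsOpen (S.openUnion M k) := by
  unfold openUnion
  refine isOpen_biUnion fun w _ => ?_
  rw [wordMap_image_Ioo]; exact isOpen_Ioo

theorem Ioo_subset_openUnion {S : LinearIFS m} {M : ℕ → Finset (List (Fin m))} {k : ℕ}
    {w : List (Fin m)} (hw : w ∈ M k) :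
    Ioo (S.wordMap w 0) (S.wordMap w 1) ⊆ S.openUnion M k :=
  fun _ hx => mem_openUnion.2 ⟨w, hw, hx⟩

theorem IsNestedIndexSets.antitone {S : LinearIFS m} {M : ℕ → Finset (List (Fin m))}
    (hM : S.IsNestedIndexSets M) : Antitone (S.openUnion M) :=
  antitone_nat_of_succ_le hM.nested

namespace IsIsland

variable {S : LinearIFS m} {M : ℕ → Finset (List (Fin m))} {k : ℕ} {c d : ℝ}

/-- An interval inside U_k that meets an island and sticks out of it would contain an island end,
which is not in U_k. -/
theorem le_and_le_of_subset (hI : S.IsIsland M k c d) {a b : ℝ} (hab : Ioo a b ⊆ S.openUnion M k)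
    (hne : (Ioo a b ∩ Ioo c d).Nonempty) : c ≤ a ∧ b ≤ d := by
  obtain ⟨z, hz1, hz2⟩ := hne
  constructor
  · by_contra! hlt
    exact hI.left_notMem (hab ⟨hlt, hz2.1.trans hz1.2⟩)
  · by_contra! hlt
    exact hI.right_notMem (hab ⟨hz1.1.trans hz2.2, hlt⟩)

theorem eq_of_nonempty {c' d' : ℝ} (hI : S.IsIsland M k c d) (hI' : S.IsIsland M k c' d')
    (hne : (Ioo c' d' ∩ Ioo c d).Nonempty) : c' = c ∧ d' = d := by
  have h1 := hI.le_and_le_of_subset hI'.subset hne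
  have h2 := hI'.le_and_le_of_subset hI.subset (by rwa [inter_comm])
  exact ⟨le_antisymm h2.1 h1.1, le_antisymm h1.2 h2.2⟩

theorem Ioo_inter_nonempty {a b c d : ℝ} (h1 : a < d) (h2 : c < b) (h3 : a < b) (h4 : c < d) :
    (Ioo a b ∩ Ioo c d).Nonempty := by
  rw [Ioo_inter_Ioo, nonempty_Ioo]
  exact max_lt (lt_min h3 h1) (lt_min h2 h4)

theorem eq_or_le {c' d' : ℝ} (hI : S.IsIsland M k c d) (hI' : S.IsIsland M k c' d') :
    (c' = c ∧ d' = d) ∨ d' ≤ c ∨ d ≤ c' := by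
  by_cases h1 : d' ≤ c
  · exact Or.inr (Or.inl h1)
  by_cases h2 : d ≤ c'
  · exact Or.inr (Or.inr h2)
  push Not at h1 h2
  exact Or.inl (hI.eq_of_nonempty hI' (Ioo_inter_nonempty h2 h1 hI'.lt hI.lt))

/-- Finitely many closed intervals of words cover (c, d), hence also its closure; so c lies in one
of them and can only be its left end. -/
theorem exists_word_left (hI : S.IsIsland M k c d) :
    ∃ w ∈ M k, S.wordMap w 0 = c ∧ S.wordMap w 1 ≤ d := by
  classical
  let A := (M k).filter fun w => (Ioo (S.wordMap w 0) (S.wordMap w 1) ∩ Ioo c d).Nonempty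
  have hsub : Ioo c d ⊆ ⋃ w ∈ A, Icc (S.wordMap w 0) (S.wordMap w 1) := by
    intro x hx
    obtain ⟨w, hw, hxw⟩ := mem_openUnion.1 (hI.subset hx)
    exact mem_iUnion₂.2 ⟨w, Finset.mem_filter.2 ⟨hw, x, hxw, hx⟩, Ioo_subset_Icc_self hxw⟩
  have hcl : IsClosed (⋃ w ∈ A, Icc (S.wordMap w 0) (S.wordMap w 1)) :=
    A.finite_toSet.isClosed_biUnion fun w _ => isClosed_Icc
  have h2 := closure_minimal hsub hcl
  rw [closure_Ioo hI.lt.ne] at h2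
  obtain ⟨w, hw, hcw⟩ := mem_iUnion₂.1 (h2 (left_mem_Icc.2 hI.lt.le))
  obtain ⟨hw1, hw2⟩ := Finset.mem_filter.1 hw
  have h3 := hI.le_and_le_of_subset (Ioo_subset_openUnion hw1) hw2
  exact ⟨w, hw1, le_antisymm hcw.1 h3.1, h3.2⟩

theorem exists_word_right (hI : S.IsIsland M k c d) :
    ∃ w ∈ M k, c ≤ S.wordMap w 0 ∧ S.wordMap w 1 = d := by
  classical
  let A := (M k).filter fun w => (Ioo (S.wordMap w 0) (S.wordMap w 1) ∩ Ioo c d).Nonempty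
  have hsub : Ioo c d ⊆ ⋃ w ∈ A, Icc (S.wordMap w 0) (S.wordMap w 1) := by
    intro x hx
    obtain ⟨w, hw, hxw⟩ := mem_openUnion.1 (hI.subset hx)
    exact mem_iUnion₂.2 ⟨w, Finset.mem_filter.2 ⟨hw, x, hxw, hx⟩, Ioo_subset_Icc_self hxw⟩
  have hcl : IsClosed (⋃ w ∈ A, Icc (S.wordMap w 0) (S.wordMap w 1)) :=
    A.finite_toSet.isClosed_biUnion fun w _ => isClosed_Icc
  have h2 := closure_minimal hsub hcl
  rw [closure_Ioo hI.lt.ne] at h2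
  obtain ⟨w, hw, hcw⟩ := mem_iUnion₂.1 (h2 (right_mem_Icc.2 hI.lt.le))
  obtain ⟨hw1, hw2⟩ := Finset.mem_filter.1 hw
  have h3 := hI.le_and_le_of_subset (Ioo_subset_openUnion hw1) hw2
  exact ⟨w, hw1, h3.1, le_antisymm h3.2 hcw.2⟩

theorem finite (S : LinearIFS m) (M : ℕ → Finset (List (Fin m))) (k : ℕ) :
    {p : ℝ × ℝ | S.IsIsland M k p.1 p.2}.Finite := by
  refine (((M k ×ˢ M k).finite_toSet).image
    fun q => (S.wordMap q.1 0, S.wordMap q.2 1)).subset ?_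
  rintro ⟨c, d⟩ hI
  obtain ⟨u, hu, hu1, -⟩ := exists_word_left hI
  obtain ⟨v, hv, -, hv1⟩ := exists_word_right hI
  exact ⟨(u, v), by simp [hu, hv], by simp [hu1, hv1]⟩

end IsIsland

namespace IsUnitSystem

variable {S : LinearIFS (m + 1)} {K : Set ℝ} {M : ℕ → Finset (List (Fin (m + 1)))}

theorem openUnion_subset (h : S.IsUnitSystem K) (k : ℕ) : S.openUnion M k ⊆ Ioo 0 1 := by
  unfold openUnion
  refine iUnion₂_subset fun w _ => ?_
  rintro _ ⟨x, hx, rfl⟩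
  exact h.wordMap_mem_Ioo w hx

theorem exists_island (h : S.IsUnitSystem K) {k : ℕ} {x : ℝ} (hx : x ∈ S.openUnion M k) :
    ∃ c d, S.IsIsland M k c d ∧ x ∈ Ioo c d := by
  obtain ⟨c, d, h1, h2, h3, h4⟩ :=
    exists_connectedComponentIn_eq_Ioo (S.isOpen_openUnion M k) (h.openUnion_subset k) hx
  exact ⟨c, d, ⟨h1.1.trans h1.2, h2 ▸ connectedComponentIn_subset _ _, h3, h4⟩, h1⟩

theorem mem_islands (h : S.IsUnitSystem K) {k : ℕ} {I : Set ℝ} :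
    I ∈ S.islands M k ↔ ∃ c d, S.IsIsland M k c d ∧ I = Icc c d := by
  constructor
  · rintro ⟨x, hx, rfl⟩
    obtain ⟨c, d, h1, h2, h3, h4⟩ :=
      exists_connectedComponentIn_eq_Ioo (S.isOpen_openUnion M k) (h.openUnion_subset k) hx
    refine ⟨c, d, ⟨h1.1.trans h1.2, h2 ▸ connectedComponentIn_subset _ _, h3, h4⟩, ?_⟩
    rw [h2, closure_Ioo (h1.1.trans h1.2).ne]
  · rintro ⟨c, d, hI, rfl⟩
    have hmid : (c + d) / 2 ∈ Ioo c d := by constructor <;> linarith [hI.lt]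
    refine ⟨(c + d) / 2, hI.subset hmid, ?_⟩
    obtain ⟨c', d', h1, h2, h3, h4⟩ :=
      exists_connectedComponentIn_eq_Ioo (S.isOpen_openUnion M k) (h.openUnion_subset k)
        (hI.subset hmid)
    obtain ⟨rfl, rfl⟩ := hI.eq_of_nonempty
      ⟨h1.1.trans h1.2, h2 ▸ connectedComponentIn_subset _ _, h3, h4⟩ ⟨_, h1, hmid⟩
    rw [h2, closure_Ioo hI.lt.ne]

theorem Icc_mem_islands (h : S.IsUnitSystem K) {k : ℕ} {c d : ℝ} (hcd : c ≤ d) :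
    Icc c d ∈ S.islands M k ↔ S.IsIsland M k c d := by
  rw [h.mem_islands]
  constructor
  · rintro ⟨c', d', hI, he⟩
    have h1 : c = c' := by rw [← csInf_Icc hcd, he, csInf_Icc hI.lt.le]
    have h2 : d = d' := by rw [← csSup_Icc hcd, he, csSup_Icc hI.lt.le]
    rwa [h1, h2]
  · exact fun hI => ⟨c, d, hI, rfl⟩

theorem island_bounds (h : S.IsUnitSystem K) {k : ℕ} {c d : ℝ} (hI : S.IsIsland M k c d) :
    0 ≤ c ∧ d ≤ 1 := by
  obtain ⟨u, hu, hu1, -⟩ := hI.exists_word_left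
  obtain ⟨v, hv, -, hv1⟩ := hI.exists_word_right
  exact ⟨hu1 ▸ (h.wordMap_mem_Icc u (left_mem_Icc.2 zero_le_one)).1,
    hv1 ▸ (h.wordMap_mem_Icc v (right_mem_Icc.2 zero_le_one)).2⟩

theorem _root_.LinearIFS.IsNestedIndexSets.isIsland_zero (hM : S.IsNestedIndexSets M) :
    S.IsIsland M 0 0 1 := by
  have : S.openUnion M 0 = Ioo 0 1 := by
    ext x; rw [mem_openUnion, hM.zero]; simp [wordMap]
  exact ⟨one_pos, this.ge, by simp [this], by simp [this]⟩

theorem exists_island_of_word (h : S.IsUnitSystem K) {k : ℕ} {w : List (Fin (m + 1))}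
    (hw : w ∈ M k) : ∃ c d, S.IsIsland M k c d ∧ c ≤ S.wordMap w 0 ∧ S.wordMap w 1 ≤ d := by
  have hlt := S.wordMap_zero_lt_one w
  have hmid : (S.wordMap w 0 + S.wordMap w 1) / 2 ∈ Ioo (S.wordMap w 0) (S.wordMap w 1) := by
    constructor <;> linarith
  obtain ⟨c, d, hI, hx⟩ := h.exists_island (Ioo_subset_openUnion hw hmid)
  have := hI.le_and_le_of_subset (Ioo_subset_openUnion hw) ⟨_, hmid, hx⟩
  exact ⟨c, d, hI, this.1, this.2⟩

theorem exists_ancestor (h : S.IsUnitSystem K) (hM : S.IsNestedIndexSets M) {j k : ℕ} (hjk : j ≤ k)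
    {c d : ℝ} (hI : S.IsIsland M k c d) :
    ∃ c' d', S.IsIsland M j c' d' ∧ c' ≤ c ∧ d ≤ d' := by
  have hmid : (c + d) / 2 ∈ Ioo c d := by constructor <;> linarith [hI.lt]
  have hsub := hI.subset.trans (hM.antitone hjk)
  obtain ⟨c', d', hI', hx⟩ := h.exists_island (hsub hmid)
  have := hI'.le_and_le_of_subset hsub ⟨_, hmid, hx⟩
  exact ⟨c', d', hI', this.1, this.2⟩

/-- Refining the address of x until it is longer than all words of `M k` forces a prefix in `M k`.
That prefix may be shorter than w. -/
theorem exists_extension_prefix (hM : S.IsNestedIndexSets M) (w : List (Fin (m + 1)))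
    (h : S.IsUnitSystem K) (k : ℕ) {x : ℝ} (hx : x ∈ S.wordMap w '' K) :
    ∃ u, x ∈ S.wordMap (w ++ u) '' K ∧ ∃ i ∈ M k, i <+: w ++ u := by
  obtain ⟨y, hy, rfl⟩ := hx
  obtain ⟨u, hu, z, hz, rfl⟩ := h.exists_wordMap (maxLen (M k) + 1) hy
  refine ⟨u, ⟨z, hz, S.wordMap_append w u z⟩, hM.exists_prefix k _ ?_⟩
  rw [List.length_append, hu]; omega

theorem prefix_bounds (h : S.IsUnitSystem K) {i w : List (Fin (m + 1))} (hiw : i <+: w) :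
    S.wordMap i 0 ≤ S.wordMap w 0 ∧ S.wordMap w 1 ≤ S.wordMap i 1 := by
  obtain ⟨u, rfl⟩ := hiw
  rw [S.wordMap_append, S.wordMap_append]
  exact ⟨(S.wordMap_strictMono i).monotone (h.wordMap_mem_Icc u (left_mem_Icc.2 zero_le_one)).1,
    (S.wordMap_strictMono i).monotone (h.wordMap_mem_Icc u (right_mem_Icc.2 zero_le_one)).2⟩

theorem image_subset_Icc (h : S.IsUnitSystem K) (w : List (Fin (m + 1))) :
    S.wordMap w '' K ⊆ Icc (S.wordMap w 0) (S.wordMap w 1) := by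
  rw [← S.wordMap_image_Icc]; exact image_mono h.subset_Icc

theorem exists_index_word (h : S.IsUnitSystem K) (hM : S.IsNestedIndexSets M) (k : ℕ) {x : ℝ}
    (hx : x ∈ K) : ∃ w ∈ M k, x ∈ S.wordMap w '' K := by
  obtain ⟨u, hxu, i, hi, v, hv⟩ := exists_extension_prefix hM [] h k (x := x) ⟨x, hx, rfl⟩
  refine ⟨i, hi, ?_⟩
  rw [List.nil_append] at hv hxu
  subst hv
  obtain ⟨z, hz, rfl⟩ := hxu
  exact ⟨S.wordMap v z, h.wordMap_mem v hz, (S.wordMap_append i v z).symm⟩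

/-- The interval of the refined word lies both in [c, d] and in the later island around its
index-set prefix. So these two overlap, and nestedness puts the later island inside [c, d]. -/
theorem exists_descendant (h : S.IsUnitSystem K) (hM : S.IsNestedIndexSets M) {j k : ℕ}
    (hkj : k ≤ j) {c d : ℝ} (hI : S.IsIsland M k c d) {w : List (Fin (m + 1))}
    (hc : c ≤ S.wordMap w 0) (hd : S.wordMap w 1 ≤ d) {x : ℝ} (hx : x ∈ S.wordMap w '' K) :
    ∃ c' d', S.IsIsland M j c' d' ∧ c ≤ c' ∧ d' ≤ d ∧ x ∈ Icc c' d' := by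
  obtain ⟨u, hxu, i, hi, hiu⟩ := exists_extension_prefix hM w h j hx
  obtain ⟨c', d', hI', hc', hd'⟩ := h.exists_island_of_word hi
  have h1 := h.prefix_bounds hiu
  have h2 := h.prefix_bounds (List.prefix_append w u)
  have h3 := h.image_subset_Icc _ hxu
  have h4 := S.wordMap_zero_lt_one (w ++ u)
  have hmid : (S.wordMap (w ++ u) 0 + S.wordMap (w ++ u) 1) / 2 ∈ Ioo c' d' ∩ Ioo c d := by
    refine ⟨⟨?_, ?_⟩, ?_, ?_⟩ <;> linarith
  have h5 := hI.le_and_le_of_subset (hI'.subset.trans (hM.antitone hkj)) ⟨_, hmid⟩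
  exact ⟨c', d', hI', h5.1, h5.2, by constructor <;> linarith [h3.1, h3.2]⟩

/-- Islands may touch, so at an end of [c, d] an address of x may belong to the neighbour. There the
extreme constitutive interval is used, with 0 and 1 in K; in the interior any address works. -/
theorem exists_vertex_word (h : S.IsUnitSystem K) (hM : S.IsNestedIndexSets M) {k : ℕ} {c d : ℝ}
    (hI : S.IsIsland M k c d) {x : ℝ} (hx : x ∈ K) (hxI : x ∈ Icc c d) :
    ∃ w ∈ M k, c ≤ S.wordMap w 0 ∧ S.wordMap w 1 ≤ d ∧ x ∈ S.wordMap w '' K := by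
  rcases eq_or_lt_of_le hxI.1 with rfl | hcx
  · obtain ⟨w, hw, hw0, hw1⟩ := hI.exists_word_left
    exact ⟨w, hw, hw0.ge, hw1, 0, h.zero_mem, hw0⟩
  rcases eq_or_lt_of_le hxI.2 with rfl | hxd
  · obtain ⟨w, hw, hw0, hw1⟩ := hI.exists_word_right
    exact ⟨w, hw, hw0, hw1.le, 1, h.one_mem, hw1⟩
  obtain ⟨w, hw, hxw⟩ := h.exists_index_word hM k hx
  have h1 := h.image_subset_Icc w hxw
  have h2 := hI.le_and_le_of_subset (Ioo_subset_openUnion hw)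
    (IsIsland.Ioo_inter_nonempty (h1.1.trans_lt hxd) (hcx.trans_le h1.2) (S.wordMap_zero_lt_one w)
      hI.lt)
  exact ⟨w, hw, h2.1, h2.2, hxw⟩

theorem exists_island_mem (h : S.IsUnitSystem K) (hM : S.IsNestedIndexSets M) {j k : ℕ}
    (hkj : k ≤ j) {c d : ℝ} (hI : S.IsIsland M k c d) {x : ℝ} (hx : x ∈ K) (hxI : x ∈ Icc c d) :
    ∃ c' d', S.IsIsland M j c' d' ∧ c ≤ c' ∧ d' ≤ d ∧ x ∈ Icc c' d' := by
  obtain ⟨w, -, h1, h2, h3⟩ := h.exists_vertex_word hM hI hx hxI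
  exact h.exists_descendant hM hkj hI h1 h2 h3

theorem exists_child (h : S.IsUnitSystem K) (hM : S.IsNestedIndexSets M) {j k : ℕ}
    (hkj : k ≤ j) {c d : ℝ} (hI : S.IsIsland M k c d) :
    ∃ c' d', S.IsIsland M j c' d' ∧ c ≤ c' ∧ d' ≤ d := by
  obtain ⟨w, -, h1, h2⟩ := hI.exists_word_left
  obtain ⟨c', d', h3, h4, h5, -⟩ := h.exists_descendant hM hkj hI h1.ge h2 ⟨0, h.zero_mem, rfl⟩
  exact ⟨c', d', h3, h4, h5⟩

theorem _root_.LinearIFS.IsNestedIndexSets.exists_wordRatio_lt (hM : S.IsNestedIndexSets M) {ε : ℝ}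
    (hε : 0 < ε) : ∃ N, ∀ k ≥ N, ∀ w ∈ M k, S.wordRatio w < ε := by
  obtain ⟨q, hq0, hq1, hq⟩ := S.exists_ratio_le
  obtain ⟨n, hn⟩ := exists_pow_lt_of_lt_one hε hq1
  obtain ⟨N, hN⟩ := eventually_atTop.1 (hM.min_tendsto.eventually_ge_atTop n)
  refine ⟨N, fun k hk w hw => ?_⟩
  have h1 : n ≤ w.length := (hN k hk).trans (Nat.sInf_le ⟨w, hw, rfl⟩)
  exact (S.wordRatio_le_pow hq w).trans_lt
    ((pow_le_pow_of_le_one hq0.le hq1.le h1).trans_lt hn)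

/-- A point of the closure of U_k is within the ratio of some w ∈ `M k` of S_w(0) ∈ K, and these
ratios tend to 0 uniformly. -/
theorem mem_of_forall_mem_closure (h : S.IsUnitSystem K) (hM : S.IsNestedIndexSets M) {x : ℝ}
    {j : ℕ} (hx : ∀ k ≥ j, x ∈ closure (S.openUnion M k)) : x ∈ K := by
  rw [← h.isCompact.isClosed.closure_eq, Metric.mem_closure_iff]
  intro ε hε
  obtain ⟨N, hN⟩ := hM.exists_wordRatio_lt hε
  have h1 := hx (max j N) (le_max_left _ _)
  have h2 : S.openUnion M (max j N) ⊆
      ⋃ w ∈ M (max j N), Icc (S.wordMap w 0) (S.wordMap w 1) := by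
    intro y hy
    obtain ⟨w, hw, hyw⟩ := mem_openUnion.1 hy
    exact mem_iUnion₂.2 ⟨w, hw, Ioo_subset_Icc_self hyw⟩
  obtain ⟨w, hw, hxw⟩ := mem_iUnion₂.1 (closure_minimal h2
    ((M (max j N)).finite_toSet.isClosed_biUnion fun w _ => isClosed_Icc) h1)
  refine ⟨S.wordMap w 0, h.wordMap_mem w h.zero_mem, ?_⟩
  have h3 := hN _ (le_max_right _ _) w hw
  rw [wordRatio] at h3
  rw [Real.dist_eq, abs_of_nonneg (by linarith [hxw.1])]
  linarith [hxw.2]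

theorem subset_closure_openUnion (h : S.IsUnitSystem K) (hM : S.IsNestedIndexSets M) (k : ℕ) :
    K ⊆ closure (S.openUnion M k) := by
  intro x hx
  obtain ⟨c, d, hI, -, -, hxI⟩ := h.exists_island_mem hM (Nat.zero_le k) (hM.isIsland_zero) hx
    (h.subset_Icc hx)
  rw [← closure_Ioo hI.lt.ne] at hxI
  exact closure_mono hI.subset hxI

theorem mem_of_forall_exists_island (h : S.IsUnitSystem K) (hM : S.IsNestedIndexSets M) {x : ℝ}
    {j : ℕ} (hx : ∀ k ≥ j, ∃ c d, S.IsIsland M k c d ∧ x ∈ Icc c d) : x ∈ K := by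
  refine h.mem_of_forall_mem_closure hM (j := j) fun k hk => ?_
  obtain ⟨c, d, hI, hxI⟩ := hx k hk
  rw [← closure_Ioo hI.lt.ne] at hxI
  exact closure_mono hI.subset hxI

/-- Small contraction ratios do not suffice, as an island may be a long chain of overlapping
intervals. But α < 1 makes K Lebesgue null, and K is the decreasing intersection of the closures of
the U_k, so their Lebesgue measure, which bounds every island length, tends to 0. -/
theorem exists_island_length_lt (h : S.IsUnitSystem K) (hM : S.IsNestedIndexSets M)
    (hdim : dimension K < 1) {ε : ℝ} (hε : 0 < ε) :
    ∃ N, ∀ k ≥ N, ∀ c d, S.IsIsland M k c d → d - c < ε := by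
  have hvol : volume K = 0 := by
    rw [← hausdorffMeasure_real]; exact hausdorffMeasure_eq_zero_of_dimension_lt hdim
  have hK : ⋂ k, closure (S.openUnion M k) = K := by
    apply Subset.antisymm
    · intro x hx
      exact h.mem_of_forall_mem_closure hM (j := 0) fun k _ => mem_iInter.1 hx k
    · exact subset_iInter fun k => h.subset_closure_openUnion hM k
  have hanti : Antitone fun k => closure (S.openUnion M k) :=
    fun i j hij => closure_mono (hM.antitone hij)
  have hlim := tendsto_measure_iInter_atTop (μ := volume)
    (fun k => (isClosed_closure (s := S.openUnion M k)).measurableSet.nullMeasurableSet) hanti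
    ⟨0, by
      have : closure (S.openUnion M 0) ⊆ Icc 0 1 :=
        closure_minimal ((h.openUnion_subset 0).trans Ioo_subset_Icc_self) isClosed_Icc
      exact ((measure_mono this).trans_lt (by simp)).ne⟩
  rw [hK, hvol] at hlim
  obtain ⟨N, hN⟩ := eventually_atTop.1 (hlim.eventually_lt_const
    (by simpa using hε : (0 : ℝ≥0∞) < ENNReal.ofReal ε))
  refine ⟨N, fun k hk c d hI => ?_⟩
  have h1 : volume (Ioo c d) < ENNReal.ofReal ε :=
    (measure_mono (hI.subset.trans subset_closure)).trans_lt (hN k hk)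
  rw [Real.volume_Ioo, ENNReal.ofReal_lt_ofReal_iff hε] at h1
  exact h1

theorem exists_isIsland (h : S.IsUnitSystem K) (hM : S.IsNestedIndexSets M) (k : ℕ) :
    ∃ c d, S.IsIsland M k c d := by
  obtain ⟨c, d, hI, -⟩ := h.exists_child hM (Nat.zero_le k) (hM.isIsland_zero)
  exact ⟨c, d, hI⟩

theorem diam_image_islands (h : S.IsUnitSystem K) (k : ℕ) :
    Metric.diam '' S.islands M k =
      (fun p : ℝ × ℝ => p.2 - p.1) '' {p : ℝ × ℝ | S.IsIsland M k p.1 p.2} := by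
  ext r
  constructor
  · rintro ⟨I, hI, rfl⟩
    obtain ⟨c, d, hI', rfl⟩ := h.mem_islands.1 hI
    exact ⟨(c, d), hI', (Real.diam_Icc hI'.lt.le).symm⟩
  · rintro ⟨⟨c, d⟩, hI, rfl⟩
    exact ⟨Icc c d, h.mem_islands.2 ⟨c, d, hI, rfl⟩, Real.diam_Icc hI.lt.le⟩

theorem finite_diam (h : S.IsUnitSystem K) (M : ℕ → Finset (List (Fin (m + 1)))) (k : ℕ) :
    (Metric.diam '' S.islands M k).Finite := by
  rw [h.diam_image_islands]; exact (IsIsland.finite S M k).image _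

theorem diam_nonempty (h : S.IsUnitSystem K) (hM : S.IsNestedIndexSets M) (k : ℕ) :
    (Metric.diam '' S.islands M k).Nonempty := by
  obtain ⟨c, d, hI⟩ := h.exists_isIsland hM k
  exact ⟨_, Icc c d, h.mem_islands.2 ⟨c, d, hI, rfl⟩, rfl⟩

theorem length_le_betaMax (h : S.IsUnitSystem K) {k : ℕ} {c d : ℝ} (hI : S.IsIsland M k c d) :
    d - c ≤ S.betaMax M k := by
  refine le_csSup (h.finite_diam M k).bddAbove ?_
  rw [h.diam_image_islands]; exact ⟨(c, d), hI, rfl⟩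

theorem betaMin_le_length (h : S.IsUnitSystem K) {k : ℕ} {c d : ℝ} (hI : S.IsIsland M k c d) :
    S.betaMin M k ≤ d - c := by
  refine csInf_le (h.finite_diam M k).bddBelow ?_
  rw [h.diam_image_islands]; exact ⟨(c, d), hI, rfl⟩

theorem exists_betaMax_eq (h : S.IsUnitSystem K) (hM : S.IsNestedIndexSets M) (k : ℕ) :
    ∃ c d, S.IsIsland M k c d ∧ S.betaMax M k = d - c := by
  have := (h.diam_nonempty hM k).csSup_mem (h.finite_diam M k)
  rw [h.diam_image_islands] at this
  obtain ⟨⟨c, d⟩, hI, he⟩ := this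
  refine ⟨c, d, hI, ?_⟩
  rw [betaMax, h.diam_image_islands]; exact he.symm

theorem exists_betaMin_eq (h : S.IsUnitSystem K) (hM : S.IsNestedIndexSets M) (k : ℕ) :
    ∃ c d, S.IsIsland M k c d ∧ S.betaMin M k = d - c := by
  have := (h.diam_nonempty hM k).csInf_mem (h.finite_diam M k)
  rw [h.diam_image_islands] at this
  obtain ⟨⟨c, d⟩, hI, he⟩ := this
  refine ⟨c, d, hI, ?_⟩
  rw [betaMin, h.diam_image_islands]; exact he.symm

theorem betaMin_pos (h : S.IsUnitSystem K) (hM : S.IsNestedIndexSets M) (k : ℕ) :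
    0 < S.betaMin M k := by
  obtain ⟨c, d, hI, he⟩ := h.exists_betaMin_eq hM k
  rw [he]; linarith [hI.lt]

theorem betaMin_antitone (h : S.IsUnitSystem K) (hM : S.IsNestedIndexSets M) :
    Antitone (S.betaMin M) := by
  intro j k hjk
  obtain ⟨c, d, hI, he⟩ := h.exists_betaMin_eq hM j
  obtain ⟨c', d', hI', h1, h2⟩ := h.exists_child hM hjk hI
  rw [he]
  linarith [h.betaMin_le_length hI']

theorem betaMin_le_one (h : S.IsUnitSystem K) (hM : S.IsNestedIndexSets M) (k : ℕ) :
    S.betaMin M k ≤ 1 := by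
  have := (h.betaMin_antitone hM (Nat.zero_le k)).trans (h.betaMin_le_length (hM.isIsland_zero))
  linarith

end IsUnitSystem

/-! ### Affine maps between islands -/

/-- An orientation preserving affine map carries the island `[c, d]` of generation `k` and its
descendants to the island `[c', d']` of generation `k'` and its descendants. -/
def IsIslandMap (S : LinearIFS m) (M : ℕ → Finset (List (Fin m))) (k : ℕ) (c d : ℝ)
    (k' : ℕ) (c' d' : ℝ) (a b : ℝ) : Prop :=
  0 < a ∧ a * c + b = c' ∧ a * d + b = d' ∧ ∀ l, 1 ≤ l → ∀ x y,
    (S.IsIsland M (k + l) x y ∧ c ≤ x ∧ y ≤ d ↔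
      S.IsIsland M (k' + l) (a * x + b) (a * y + b) ∧ c' ≤ a * x + b ∧ a * y + b ≤ d')

namespace IsIslandMap

variable {S : LinearIFS m} {M : ℕ → Finset (List (Fin m))} {k k' k'' : ℕ}
  {c d c' d' c'' d'' a b a' b' : ℝ}

theorem refl (S : LinearIFS m) (M : ℕ → Finset (List (Fin m))) (k : ℕ) (c d : ℝ) :
    S.IsIslandMap M k c d k c d 1 0 := by
  refine ⟨one_pos, by ring, by ring, fun l _ x y => ?_⟩
  simp

theorem trans (h1 : S.IsIslandMap M k c d k' c' d' a b)
    (h2 : S.IsIslandMap M k' c' d' k'' c'' d'' a' b') :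
    S.IsIslandMap M k c d k'' c'' d'' (a' * a) (a' * b + b') := by
  have e : ∀ x, a' * a * x + (a' * b + b') = a' * (a * x + b) + b' := fun x => by ring
  refine ⟨mul_pos h2.1 h1.1, ?_, ?_, fun l hl x y => ?_⟩
  · rw [e, h1.2.1, h2.2.1]
  · rw [e, h1.2.2.1, h2.2.2.1]
  · rw [h1.2.2.2 l hl, h2.2.2.2 l hl, e, e]

theorem child (h1 : S.IsIslandMap M k c d k' c' d' a b) {x y : ℝ}
    (hI : S.IsIsland M (k + 1) x y) (hx : c ≤ x) (hy : y ≤ d) :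
    S.IsIsland M (k' + 1) (a * x + b) (a * y + b) ∧ c' ≤ a * x + b ∧ a * y + b ≤ d' ∧
      S.IsIslandMap M (k + 1) x y (k' + 1) (a * x + b) (a * y + b) a b := by
  obtain ⟨h2, h3, h4⟩ := (h1.2.2.2 1 le_rfl x y).1 ⟨hI, hx, hy⟩
  refine ⟨h2, h3, h4, h1.1, rfl, rfl, fun l hl u v => ?_⟩
  have ha := h1.1
  have h5 := h1.2.2.2 (1 + l) (by omega) u v
  rw [← add_assoc, ← add_assoc] at h5
  have e1 : a * x + b ≤ a * u + b ↔ x ≤ u := by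
    rw [add_le_add_iff_right, mul_le_mul_iff_right₀ ha]
  have e2 : a * v + b ≤ a * y + b ↔ v ≤ y := by
    rw [add_le_add_iff_right, mul_le_mul_iff_right₀ ha]
  rw [e1, e2]
  constructor
  · rintro ⟨g1, g2, g3⟩
    exact ⟨(h5.1 ⟨g1, hx.trans g2, g3.trans hy⟩).1, g2, g3⟩
  · rintro ⟨g1, g2, g3⟩
    exact ⟨(h5.2 ⟨g1, h3.trans (e1.2 g2), (e2.2 g3).trans h4⟩).1, g2, g3⟩

theorem length_eq (h1 : S.IsIslandMap M k c d k' c' d' a b) : d' - c' = a * (d - c) := by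
  rw [← h1.2.1, ← h1.2.2.1]; ring

end IsIslandMap

/-- A point of an island lies in K exactly when it lies in descendants of all later generations, and
the map matches the descendants. -/
theorem IsUnitSystem.mem_iff_of_isIslandMap {S : LinearIFS (m + 1)} {K : Set ℝ}
    {M : ℕ → Finset (List (Fin (m + 1)))} (h : S.IsUnitSystem K) (hM : S.IsNestedIndexSets M)
    {k k' : ℕ} {c d c' d' a b : ℝ} (hI : S.IsIsland M k c d) (hI' : S.IsIsland M k' c' d')
    (hτ : S.IsIslandMap M k c d k' c' d' a b) {x : ℝ} (hx : x ∈ Icc c d) :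
    x ∈ K ↔ a * x + b ∈ K := by
  have ha := hτ.1
  constructor
  · intro hxK
    refine h.mem_of_forall_exists_island hM (j := k' + 1) fun j hj => ?_
    obtain ⟨l, rfl⟩ := Nat.exists_eq_add_of_le hj
    obtain ⟨u, v, h1, h2, h3, h4⟩ := h.exists_island_mem hM (by omega : k ≤ k + (1 + l)) hI hxK hx
    have := ((hτ.2.2.2 (1 + l) (by omega) u v).1 ⟨h1, h2, h3⟩).1
    rw [← add_assoc] at this
    refine ⟨_, _, this, ?_, ?_⟩
    · nlinarith [h4.1]
    · nlinarith [h4.2]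
  · intro hxK
    have hx' : a * x + b ∈ Icc c' d' := by
      rw [← hτ.2.1, ← hτ.2.2.1]
      constructor <;> nlinarith [hx.1, hx.2]
    refine h.mem_of_forall_exists_island hM (j := k + 1) fun j hj => ?_
    obtain ⟨l, rfl⟩ := Nat.exists_eq_add_of_le hj
    obtain ⟨u, v, h1, h2, h3, h4⟩ :=
      h.exists_island_mem hM (by omega : k' ≤ k' + (1 + l)) hI' hxK hx'
    have eu : u = a * ((u - b) / a) + b := by field_simp; ring
    have ev : v = a * ((v - b) / a) + b := by field_simp; ring
    have := ((hτ.2.2.2 (1 + l) (by omega) ((u - b) / a) ((v - b) / a)).2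
      (by rw [← eu, ← ev]; exact ⟨h1, h2, h3⟩)).1
    rw [← add_assoc] at this
    refine ⟨_, _, this, ?_, ?_⟩
    · rw [div_le_iff₀ ha]; linarith [h4.1]
    · rw [le_div_iff₀ ha]; linarith [h4.2]

theorem wordMap_mem_vertices {S : LinearIFS m} {M : ℕ → Finset (List (Fin m))} {k : ℕ} {c d : ℝ}
    {v : ℝ → ℝ} : v ∈ S.vertices M k (Icc c d) ↔
      ∃ w ∈ M k, v = S.wordMap w ∧ c ≤ S.wordMap w 0 ∧ S.wordMap w 1 ≤ d := by
  constructor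
  · rintro ⟨⟨w, hw, rfl⟩, h2⟩
    rw [wordMap_image_Icc, Icc_subset_Icc_iff (S.wordMap_zero_lt_one w).le] at h2
    exact ⟨w, hw, rfl, h2⟩
  · rintro ⟨w, hw, rfl, h2⟩
    refine ⟨⟨w, hw, rfl⟩, ?_⟩
    rw [wordMap_image_Icc, Icc_subset_Icc_iff (S.wordMap_zero_lt_one w).le]
    exact h2

theorem IsUnitSystem.exists_affine_of_islandRel {S : LinearIFS (m + 1)} {K : Set ℝ}
    {M : ℕ → Finset (List (Fin (m + 1)))} (h : S.IsUnitSystem K) {I I' : Island S M}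
    {c d c' d' : ℝ} (hI : S.IsIsland M I.gen c d) (hI' : S.IsIsland M I'.gen c' d')
    (hc : I.carrier = Icc c d) (hc' : I'.carrier = Icc c' d') (hrel : S.islandRel M I I') :
    ∃ a b, S.IsIslandMap M I.gen c d I'.gen c' d' a b ∧
      S.vertices M I'.gen I'.carrier =
        (fun v x => a * v x + b) '' S.vertices M I.gen I.carrier := by
  obtain ⟨τ, h1, h2, h3⟩ := hrel
  obtain ⟨a, b, hτ⟩ : ∃ a b, ∀ x, τ x = a * x + b := by
    refine ⟨τ 1 - τ 0, τ 0, fun x => ?_⟩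
    have := τ.toAffineMap.apply_lineMap 0 1 x
    simp only [AffineMap.lineMap_apply, AffineEquiv.coe_toAffineMap] at this
    simp at this
    rw [this]; ring
  have hcomp : (fun v : ℝ → ℝ => τ ∘ v) = fun v x => a * v x + b := by
    ext v x; simp [hτ]
  have hfun : (fun x => τ x) = fun x => a * x + b := funext hτ
  -- Composing a vertex with τ gives a vertex again, and both are increasing, so τ cannot reverse
  -- orientation.
  have ha : 0 < a := by
    obtain ⟨w, hw, hw0, hw1⟩ := hI.exists_word_left
    have hv : S.wordMap w ∈ S.vertices M I.gen I.carrier := by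
      rw [hc]; exact wordMap_mem_vertices.2 ⟨w, hw, rfl, hw0.ge, hw1⟩
    have hv' : τ ∘ S.wordMap w ∈ S.vertices M I'.gen I'.carrier := by
      rw [h2]; exact mem_image_of_mem _ hv
    rw [hc'] at hv'
    obtain ⟨u, hu, he, -⟩ := wordMap_mem_vertices.1 hv'
    have e0 := congrFun he 0
    have e1 := congrFun he 1
    simp only [Function.comp, hτ] at e0 e1
    have l1 := S.wordMap_zero_lt_one w
    have l2 := S.wordMap_zero_lt_one u
    by_contra! hneg
    nlinarith
  have himg : ∀ x y, τ '' Icc x y = Icc (a * x + b) (a * y + b) := by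
    intro x y
    have : (τ : ℝ → ℝ) = fun x => a * x + b := hfun
    rw [this]; exact image_affine_Icc' ha _ _ _
  have hend : a * c + b = c' ∧ a * d + b = d' := by
    have := h1
    rw [hc, hc', himg] at this
    have hlt : a * c + b ≤ a * d + b := by nlinarith [hI.lt]
    constructor
    · rw [← csInf_Icc hlt, this, csInf_Icc hI'.lt.le]
    · rw [← csSup_Icc hlt, this, csSup_Icc hI'.lt.le]
  refine ⟨a, b, ⟨ha, hend.1, hend.2, fun l hl x y => ?_⟩, by rw [h2, hcomp]⟩
  have h4 := h3 l hl (Icc x y)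
  rw [himg, hc, hc'] at h4
  constructor
  · rintro ⟨g1, g2, g3⟩
    have hlt : a * x + b ≤ a * y + b := by nlinarith [g1.lt]
    have := h4.1 ⟨(h.Icc_mem_islands g1.lt.le).2 g1, Icc_subset_Icc g2 g3⟩
    exact ⟨(h.Icc_mem_islands hlt).1 this.1, (Icc_subset_Icc_iff hlt).1 this.2⟩
  · rintro ⟨g1, g2, g3⟩
    have hlt : x ≤ y := by
      by_contra! hcon
      nlinarith [g1.lt]
    have := h4.2 ⟨(h.Icc_mem_islands g1.lt.le).2 g1, Icc_subset_Icc g2 g3⟩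
    exact ⟨(h.Icc_mem_islands hlt).1 this.1, (Icc_subset_Icc_iff hlt).1 this.2⟩

/-- The set defining `k₀` is not empty: as there are finitely many types, any bound for the
generations of chosen representatives belongs to it. -/
theorem k₀_spec {S : LinearIFS m} {M : ℕ → Finset (List (Fin m))} (hfin : Finite (S.OverlapType M))
    (I : Island S M) (hI : I.gen = S.k₀ M + 1) :
    ∃ I' : Island S M, I'.gen ≤ S.k₀ M ∧ S.islandRel M I I' := by
  have hne : {k | ∀ I : Island S M, I.gen = k + 1 →
      ∃ I' : Island S M, I'.gen ≤ k ∧ S.islandRel M I I'}.Nonempty := by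
    obtain ⟨N, hN⟩ := (Set.finite_range fun q : S.OverlapType M => q.out.gen).bddAbove
    refine ⟨N, fun I _ => ⟨(Quotient.mk (S.islandSetoid M) I).out, hN ⟨_, rfl⟩, ?_⟩⟩
    exact (S.islandRel_equivalence M).symm (Quotient.mk_out (s := S.islandSetoid M) I)
  exact Nat.sInf_mem hne I hI

/-- `k₀` only speaks of generation k₀ + 1. Later generations follow by induction: map the parent to
generation at most k₀, and if the child lands in generation k₀ + 1, map once more. -/
theorem IsUnitSystem.exists_isIslandMap {S : LinearIFS (m + 1)} {K : Set ℝ}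
    {M : ℕ → Finset (List (Fin (m + 1)))} (h : S.IsUnitSystem K) (hM : S.IsNestedIndexSets M)
    (hfin : Finite (S.OverlapType M)) (k : ℕ) {c d : ℝ} (hI : S.IsIsland M k c d) :
    ∃ k' ≤ S.k₀ M, ∃ c' d' a b, S.IsIsland M k' c' d' ∧ S.IsIslandMap M k c d k' c' d' a b := by
  have base : ∀ c d, S.IsIsland M (S.k₀ M + 1) c d →
      ∃ k' ≤ S.k₀ M, ∃ c' d' a b, S.IsIsland M k' c' d' ∧
        S.IsIslandMap M (S.k₀ M + 1) c d k' c' d' a b := by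
    intro c d hI
    obtain ⟨I', hg, hrel⟩ := k₀_spec hfin
      ⟨S.k₀ M + 1, Icc c d, h.mem_islands.2 ⟨c, d, hI, rfl⟩⟩ rfl
    obtain ⟨c', d', hI', hc'⟩ := h.mem_islands.1 I'.mem
    obtain ⟨a, b, hτ, -⟩ := h.exists_affine_of_islandRel hI hI' rfl hc' hrel
    exact ⟨_, hg, c', d', a, b, hI', hτ⟩
  induction k generalizing c d with
  | zero => exact ⟨0, Nat.zero_le _, c, d, 1, 0, hI, IsIslandMap.refl ..⟩
  | succ k ih =>
    obtain ⟨cp, dp, hp, h1, h2⟩ := h.exists_ancestor hM (Nat.le_succ k) hI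
    obtain ⟨k', hk', c', d', a, b, hI', hτ⟩ := ih hp
    obtain ⟨g1, -, -, g4⟩ := hτ.child hI h1 h2
    rcases Nat.lt_or_ge k' (S.k₀ M) with hlt | hge
    · exact ⟨k' + 1, hlt, _, _, a, b, g1, g4⟩
    · obtain rfl : k' = S.k₀ M := le_antisymm hk' hge
      obtain ⟨j, hj, u, v, a', b', f1, f2⟩ := base _ _ g1
      exact ⟨j, hj, u, v, _, _, f1, g4.trans f2⟩

/-- Carry the parent to a generation at most k₀ and the child along with it. There the parent has
length at most 1, and the child at least β_min^(k₀+1) since `betaMin` is antitone. -/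
theorem IsUnitSystem.betaMin_mul_length_le {S : LinearIFS (m + 1)} {K : Set ℝ}
    {M : ℕ → Finset (List (Fin (m + 1)))} (h : S.IsUnitSystem K) (hM : S.IsNestedIndexSets M)
    (hfin : Finite (S.OverlapType M)) {k : ℕ} {c d c' d' : ℝ} (hI : S.IsIsland M k c d)
    (hI' : S.IsIsland M (k + 1) c' d') (hc : c ≤ c') (hd : d' ≤ d) :
    S.betaMin M (S.k₀ M + 1) * (d - c) ≤ d' - c' := by
  obtain ⟨j, hj, u, v, a, b, f1, f2⟩ := h.exists_isIslandMap hM hfin k hI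
  obtain ⟨g1, -, -, -⟩ := f2.child hI' hc hd
  have h1 := h.betaMin_le_length g1
  have h2 := h.betaMin_antitone hM (by omega : j + 1 ≤ S.k₀ M + 1)
  have h3 := f2.length_eq
  have h4 := h.island_bounds f1
  have ha := f2.1
  have h6 : a * (d - c) ≤ 1 := by linarith
  have h7 : S.betaMin M (S.k₀ M + 1) ≤ a * (d' - c') := by linarith
  have h8 : 0 < d' - c' := by linarith [hI'.lt]
  have h9 : 0 < d - c := by linarith [hI.lt]
  nlinarith [mul_le_mul_of_nonneg_left h6 h8.le, mul_le_mul_of_nonneg_right h7 h9.le]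

end LinearIFS

/-! ### Positivity of the Hausdorff measure -/

namespace LinearIFS.IsUnitSystem

variable {m : ℕ} {S : LinearIFS (m + 1)} {K : Set ℝ} {M : ℕ → Finset (List (Fin (m + 1)))}

/-- Take the first generation in which some island through x has length at most L. Its parent is
longer than L, but by a factor of at most 1/β_min^(k₀+1). -/
theorem exists_island_of_scale (h : S.IsUnitSystem K) (hM : S.IsNestedIndexSets M)
    (hfin : Finite (S.OverlapType M)) (hdim : dimension K < 1) {L : ℝ} (hL : 0 < L) (hL1 : L < 1)
    {x : ℝ} (hx : x ∈ K) : ∃ k c d, S.IsIsland M k c d ∧ x ∈ Icc c d ∧ L < d - c ∧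
      S.betaMin M (S.k₀ M + 1) * (d - c) ≤ L := by
  classical
  have hex : ∃ n, ∃ c d, S.IsIsland M n c d ∧ x ∈ Icc c d ∧ d - c ≤ L := by
    obtain ⟨N, hN⟩ := h.exists_island_length_lt hM hdim hL
    obtain ⟨c, d, h1, -, -, h2⟩ :=
      h.exists_island_mem hM (Nat.zero_le N) hM.isIsland_zero hx (h.subset_Icc hx)
    exact ⟨N, c, d, h1, h2, (hN N le_rfl c d h1).le⟩
  obtain ⟨c, d, h1, h2, h3⟩ := Nat.find_spec hex
  have hmin := fun n => Nat.find_min hex (m := n)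
  revert h1 hmin
  rcases Nat.find hex with _ | n
  · intro h1
    have := h.island_bounds h1
    have hz := hM.isIsland_zero
    rcases hz.eq_or_le h1 with h4 | h4 | h4 <;> linarith [h1.lt]
  · intro h1 hmin
    obtain ⟨cp, dp, hp, h4, h5⟩ := h.exists_ancestor hM (Nat.le_succ n) h1
    have hxp : x ∈ Icc cp dp := ⟨h4.trans h2.1, h2.2.trans h5⟩
    have hlt : L < dp - cp := by
      by_contra! hcon
      exact hmin n (Nat.lt_succ_self n) ⟨cp, dp, hp, hxp, hcon⟩
    exact ⟨n, cp, dp, hp, hxp, hlt, (h.betaMin_mul_length_le hM hfin hp h1 h4 h5).trans h3⟩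

/-- An island longer than q - p that meets [p, q] contains p or q. Among those through p the one
reaching furthest right suffices, among those through q the one reaching furthest left. -/
theorem exists_two_islands_cover (h : S.IsUnitSystem K) (hM : S.IsNestedIndexSets M)
    (hfin : Finite (S.OverlapType M)) (hdim : dimension K < 1) {p q : ℝ} (hpq : p < q) :
    ∃ k c d k' c' d', (S.IsIsland M k c d ∧ S.betaMin M (S.k₀ M + 1) * (d - c) ≤ q - p) ∧
      (S.IsIsland M k' c' d' ∧ S.betaMin M (S.k₀ M + 1) * (d' - c') ≤ q - p) ∧
      K ∩ Icc p q ⊆ Icc c d ∪ Icc c' d' := by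
  set β := S.betaMin M (S.k₀ M + 1) with hβ
  rcases le_or_gt 1 (q - p) with hL1 | hL1
  · have h0 := hM.isIsland_zero
    have h1 : β * (1 - 0) ≤ q - p := by linarith [h.betaMin_le_one hM (S.k₀ M + 1)]
    exact ⟨0, 0, 1, 0, 0, 1, ⟨h0, h1⟩, ⟨h0, h1⟩, fun x hx => Or.inl (h.subset_Icc hx.1)⟩
  have hL : 0 < q - p := sub_pos.2 hpq
  let F : ℝ → Set (ℝ × ℝ) := fun e =>
    {z | (∃ k, S.IsIsland M k z.1 z.2) ∧ q - p < z.2 - z.1 ∧ β * (z.2 - z.1) ≤ q - p ∧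
      e ∈ Icc z.1 z.2}
  have hF : ∀ e, (F e).Finite := by
    intro e
    obtain ⟨N, hN⟩ := h.exists_island_length_lt hM hdim hL
    refine ((Set.finite_Iio N).biUnion fun k _ => IsIsland.finite S M k).subset ?_
    rintro z ⟨⟨k, hk⟩, h1, -⟩
    refine mem_iUnion₂.2 ⟨k, ?_, hk⟩
    by_contra hcon
    exact (hN k (not_lt.1 hcon) _ _ hk).not_ge h1.le
  -- A default island of admissible scale, in case none of them contains p, or none contains q.
  obtain ⟨k₁, c₁, d₁, hI₁, -, -, hβ₁⟩ := h.exists_island_of_scale hM hfin hdim hL hL1 h.zero_mem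
  have hleft : ∃ k c d, (S.IsIsland M k c d ∧ β * (d - c) ≤ q - p) ∧
      ∀ z ∈ F p, Icc p z.2 ⊆ Icc c d := by
    rcases (F p).eq_empty_or_nonempty with he | hne
    · exact ⟨k₁, c₁, d₁, ⟨hI₁, hβ₁⟩, by simp [he]⟩
    · obtain ⟨z, ⟨⟨k, hk⟩, -, hz2, hz3⟩, hz⟩ := Set.exists_max_image _ (fun z => z.2) (hF p) hne
      exact ⟨k, z.1, z.2, ⟨hk, hz2⟩, fun y hy => Icc_subset_Icc hz3.1 (hz y hy)⟩
  have hright : ∃ k c d, (S.IsIsland M k c d ∧ β * (d - c) ≤ q - p) ∧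
      ∀ z ∈ F q, Icc z.1 q ⊆ Icc c d := by
    rcases (F q).eq_empty_or_nonempty with he | hne
    · exact ⟨k₁, c₁, d₁, ⟨hI₁, hβ₁⟩, by simp [he]⟩
    · obtain ⟨z, ⟨⟨k, hk⟩, -, hz2, hz3⟩, hz⟩ := Set.exists_min_image _ (fun z => z.1) (hF q) hne
      exact ⟨k, z.1, z.2, ⟨hk, hz2⟩, fun y hy => Icc_subset_Icc (hz y hy) hz3.2⟩
  obtain ⟨k, c, d, h1, h2⟩ := hleft
  obtain ⟨k', c', d', h1', h2'⟩ := hright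
  refine ⟨k, c, d, k', c', d', h1, h1', ?_⟩
  rintro x ⟨hxK, hxp, hxq⟩
  obtain ⟨j, u, v, hJ, hx, hlt, hle⟩ := h.exists_island_of_scale hM hfin hdim hL hL1 hxK
  rcases le_or_gt u p with hup | hup
  · exact Or.inl (h2 (u, v) ⟨⟨j, hJ⟩, hlt, hle, hup, hxp.trans hx.2⟩ ⟨hxp, hx.2⟩)
  · exact Or.inr (h2' (u, v) ⟨⟨j, hJ⟩, hlt, hle, hx.1.trans hxq, by simp only; linarith⟩
      ⟨hx.1, hxq⟩)

/-- The inverse of the map to a generation at most k₀ has ratio 1/a. With β = β_min^(k₀+1), a(d - c)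
≥ β and β(d - c) ≤ L give 1/a ≤ L/β². -/
theorem exists_lipschitz_cover_island (h : S.IsUnitSystem K) (hM : S.IsNestedIndexSets M)
    (hfin : Finite (S.OverlapType M)) {k : ℕ} {c d L : ℝ} (hI : S.IsIsland M k c d)
    (hL : S.betaMin M (S.k₀ M + 1) * (d - c) ≤ L) :
    ∃ g : ℝ → ℝ, LipschitzWith (Real.toNNReal (L / S.betaMin M (S.k₀ M + 1) ^ 2)) g ∧
      K ∩ Icc c d ⊆ g '' K := by
  obtain ⟨k', hk', c', d', a, b, hI', hτ⟩ := h.exists_isIslandMap hM hfin k hI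
  have ha := hτ.1
  have hβ := h.betaMin_pos hM (S.k₀ M + 1)
  refine ⟨fun y => (y - b) / a, ?_, ?_⟩
  · refine LipschitzWith.of_dist_le_mul fun x y => ?_
    have h1 := h.betaMin_antitone hM (by omega : k' ≤ S.k₀ M + 1)
    have h2 := h.betaMin_le_length hI'
    have h3 := hτ.length_eq
    have hL0 : 0 ≤ L := le_trans (by have := hI.lt; positivity [sub_pos.2 this]) hL
    rw [Real.coe_toNNReal _ (by positivity), Real.dist_eq, Real.dist_eq, ← sub_div,
      sub_sub_sub_cancel_right, abs_div, abs_of_pos ha, div_eq_inv_mul]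
    gcongr
    rw [inv_eq_one_div, div_le_div_iff₀ ha (by positivity), one_mul]
    have h4 : S.betaMin M (S.k₀ M + 1) ≤ a * (d - c) := by linarith
    nlinarith
  · rintro x ⟨hx, hxI⟩
    refine ⟨a * x + b, (h.mem_iff_of_isIslandMap hM hI hI' hτ hxI).1 hx, ?_⟩
    simp only
    field_simp
    ring

/-- Measure 0 would give a finite cover of K by intervals of radii r_n with Σ r_n^α as small as
desired. The part of K in each interval lies in two images of K under maps of ratio 2r_n/β², so K is
covered by images of itself with Σ ratio^α < 1. This persists for some exponent t < α, so H^t(K) <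
∞, which is impossible below the dimension. -/
theorem hausdorffMeasure_ne_zero (h : S.IsUnitSystem K) (hM : S.IsNestedIndexSets M)
    (hfin : Finite (S.OverlapType M)) (hdim : dimension K < 1) :
    Measure.hausdorffMeasure (dimension K) K ≠ 0 := by
  intro h0
  have hα := h.dimension_pos
  set α := dimension K with hαdef
  set β := S.betaMin M (S.k₀ M + 1) with hβdef
  have hβ : 0 < β := h.betaMin_pos hM (S.k₀ M + 1)
  -- Two maps of ratio 2r_n/β² per interval: the self-covering costs this constant times Σ r_n^α.
  have hC : 0 < 2 * (2 / β ^ 2) ^ α := by positivity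
  obtain ⟨T, x, r, hr, hT, hsum⟩ :=
    exists_finite_cover_of_hausdorffMeasure_eq_zero hα hdim.le h.isCompact h0 (one_div_pos.2 hC)
  have hpair : ∀ n : T, ∃ g : Bool → ℝ → ℝ,
      (∀ i, LipschitzWith (Real.toNNReal (2 * r n / β ^ 2)) (g i)) ∧
      K ∩ Icc (x n - r n) (x n + r n) ⊆ ⋃ i, g i '' K := by
    intro n
    have hrn := hr n n.2
    obtain ⟨k, c, d, k', c', d', ⟨h1, h2⟩, ⟨h3, h4⟩, h5⟩ :=
      h.exists_two_islands_cover hM hfin hdim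
        (by linarith : x n - r n < x n + r n)
    have e : x n + r n - (x n - r n) = 2 * r n := by ring
    rw [e] at h2 h4
    obtain ⟨g, hg, hgK⟩ := h.exists_lipschitz_cover_island hM hfin h1 h2
    obtain ⟨g', hg', hgK'⟩ := h.exists_lipschitz_cover_island hM hfin h3 h4
    refine ⟨fun i => if i then g else g', fun i => by cases i <;> simpa, fun y hy => ?_⟩
    rcases h5 hy with h6 | h6
    · exact mem_iUnion.2 ⟨true, by simpa using hgK ⟨hy.1, h6⟩⟩
    · exact mem_iUnion.2 ⟨false, by simpa using hgK' ⟨hy.1, h6⟩⟩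
  choose g hg hgK using hpair
  let e := (Fintype.equivFin (T × Bool)).symm
  let ρ : T → ℝ≥0 := fun n => Real.toNNReal (2 * r n / β ^ 2)
  have hρ : ∀ n : T, (ρ n : ℝ) = 2 * r n / β ^ 2 := fun n =>
    Real.coe_toNNReal _ (by have := hr n n.2; positivity)
  have hρ0 : ∀ n : T, 0 < (ρ n : ℝ) := fun n => by rw [hρ]; have := hr n n.2; positivity
  have hsumρ : ∑ p : T × Bool, (ρ p.1 : ℝ) ^ α < 1 := by
    rw [Fintype.sum_prod_type]
    simp only [Finset.sum_const, Finset.card_univ, Fintype.card_bool, nsmul_eq_mul]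
    have e1 : ∀ n : T, (ρ n : ℝ) ^ α = (2 / β ^ 2) ^ α * r n ^ α := fun n => by
      rw [hρ, ← Real.mul_rpow (by positivity) (hr n n.2).le]; congr 1; ring
    simp_rw [e1]
    rw [← Finset.mul_sum, ← Finset.mul_sum, Finset.sum_coe_sort T (fun n => r n ^ α)]
    rw [lt_div_iff₀ hC] at hsum
    push_cast
    linarith
  have hlt1 : ∀ n : T, ρ n < 1 := by
    intro n
    by_contra! hcon
    have h1 : (1 : ℝ) ≤ (ρ n : ℝ) ^ α := Real.one_le_rpow (by exact_mod_cast hcon) hα.le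
    have h2 := Finset.single_le_sum (f := fun p : T × Bool => (ρ p.1 : ℝ) ^ α)
      (fun p _ => Real.rpow_nonneg (ρ p.1).2 _) (Finset.mem_univ (n, true))
    simp only at h2
    linarith
  have hcont : ContinuousAt (fun s : ℝ => ∑ p : T × Bool, (ρ p.1 : ℝ) ^ s) α :=
    tendsto_finsetSum _ fun p _ => Real.continuousAt_const_rpow (hρ0 p.1).ne'
  obtain ⟨t, ⟨ht1, ht0⟩, htα⟩ :=
    ((((hcont.eventually (gt_mem_nhds hsumρ)).filter_mono nhdsWithin_le_nhds).and
    (Filter.Eventually.filter_mono nhdsWithin_le_nhds (lt_mem_nhds hα))).and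
    (self_mem_nhdsWithin (s := Iio α) (a := α))).exists
  have hfinite := hausdorffMeasure_lt_top_of_subset_iUnion_image h.isCompact.isBounded
    (fun j => g (e j).1 (e j).2) (fun j => ρ (e j).1) (fun j => hg (e j).1 (e j).2)
    (fun j => hlt1 _) (fun y hy => by
      obtain ⟨n, hn, hyn⟩ := mem_iUnion₂.1 (hT hy)
      obtain ⟨i, hi⟩ := mem_iUnion.1 (hgK ⟨n, hn⟩ ⟨hy, hyn⟩)
      refine mem_iUnion.2 ⟨e.symm (⟨n, hn⟩, i), ?_⟩
      simpa using hi) ht0.le (by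
      rw [e.sum_comp (fun p => ρ p.1 ^ t)]
      exact_mod_cast ht1.le)
  exact hfinite.ne (hausdorffMeasure_eq_top_of_lt_dimension ht0.le htα)

end LinearIFS.IsUnitSystem

/-! ### Trimming, and the distribution function of λ -/

/-- Move a to the last point where F is still F(a), and b to the first point where F is already
F(b). -/
theorem Monotone.exists_trim {F : ℝ → ℝ} (hF : Monotone F) (hFc : Continuous F) {a b : ℝ}
    (hlt : F a < F b) : ∃ a' b', a ≤ a' ∧ b' ≤ b ∧ a' < b' ∧ F a' = F a ∧ F b' = F b ∧
      (∀ x, a' < x → F a' < F x) ∧ ∀ x, x < b' → F x < F b' := by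
  have hA : IsClosed {x | F x ≤ F a} := isClosed_le hFc continuous_const
  have hB : IsClosed {x | F b ≤ F x} := isClosed_le continuous_const hFc
  have hAb : BddAbove {x | F x ≤ F a} := ⟨b, fun x hx => by
    by_contra! hcon
    exact (hlt.trans_le (hF hcon.le)).not_ge hx⟩
  have hBb : BddBelow {x | F b ≤ F x} := ⟨a, fun x hx => by
    by_contra! hcon
    exact (lt_of_le_of_lt (hF hcon.le) hlt).not_ge hx⟩
  have ha := hA.csSup_mem ⟨a, le_refl (F a)⟩ hAb
  have hb := hB.csInf_mem ⟨b, le_refl (F b)⟩ hBb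
  set a' := sSup {x | F x ≤ F a}
  set b' := sInf {x | F b ≤ F x}
  have h1 : a ≤ a' := le_csSup hAb (le_refl (F a))
  have h2 : b' ≤ b := csInf_le hBb (le_refl (F b))
  have ha' : F a' = F a := le_antisymm ha (hF h1)
  have hb' : F b' = F b := le_antisymm (hF h2) hb
  refine ⟨a', b', h1, h2, ?_, ha', hb', fun x hx => ?_, fun x hx => ?_⟩
  · by_contra! hcon
    have := hF hcon
    linarith
  · rw [ha']
    by_contra! hcon
    exact hx.not_ge (le_csSup hAb hcon)
  · rw [hb']
    by_contra! hcon
    exact hx.not_ge (csInf_le hBb hcon)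

namespace LinearIFS

/-- The distribution function of the normalized Hausdorff measure. -/
noncomputable def distFun (K : Set ℝ) (x : ℝ) : ℝ := (normalizedMeasure K).real (Iic x)

/-- The Hausdorff measure of `K` in its dimension is positive and finite. -/
structure IsRegular (K : Set ℝ) : Prop where
  isCompact : IsCompact K
  dimension_pos : 0 < dimension K
  ne_zero : Measure.hausdorffMeasure (dimension K) K ≠ 0
  ne_top : Measure.hausdorffMeasure (dimension K) K ≠ ∞

namespace IsRegular

variable {K : Set ℝ}

theorem normalizedMeasure_apply (hK : IsRegular K) (A : Set ℝ) :
    normalizedMeasure K A = (Measure.hausdorffMeasure (dimension K) K)⁻¹ *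
      Measure.hausdorffMeasure (dimension K) (A ∩ K) := by
  rw [normalizedMeasure, Measure.smul_apply, Measure.restrict_apply' hK.isCompact.measurableSet,
    smul_eq_mul]

theorem isProbabilityMeasure (hK : IsRegular K) :
    IsProbabilityMeasure (normalizedMeasure K) := by
  refine ⟨?_⟩
  rw [hK.normalizedMeasure_apply, univ_inter, ENNReal.inv_mul_cancel hK.ne_zero hK.ne_top]

theorem nullSingletonClass (hK : IsRegular K) :
    NullSingletonClass (normalizedMeasure K) := by
  refine ⟨fun x => ?_⟩
  have := Measure.nullSingletonClass_hausdorff ℝ hK.dimension_pos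
  rw [hK.normalizedMeasure_apply, measure_mono_null inter_subset_left (measure_singleton x),
    mul_zero]

theorem distFun_mono (hK : IsRegular K) : Monotone (distFun K) := by
  have := hK.isProbabilityMeasure
  exact fun x y hxy => measureReal_mono (Iic_subset_Iic.2 hxy)

theorem measureReal_Icc (hK : IsRegular K) {a b : ℝ} (hab : a ≤ b) :
    (normalizedMeasure K).real (Icc a b) = distFun K b - distFun K a := by
  have := hK.isProbabilityMeasure
  have := hK.nullSingletonClass
  rw [distFun, distFun, ← measureReal_sdiff (Iic_subset_Iic.2 hab) measurableSet_Iic, Iic_sdiff_Iic]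
  exact measureReal_congr Ioc_ae_eq_Icc.symm

theorem continuous_distFun (hK : IsRegular K) : Continuous (distFun K) := by
  have := hK.isProbabilityMeasure
  have := hK.nullSingletonClass
  have h1 := intervalIntegral.continuous_primitive (μ := normalizedMeasure K)
    (f := fun _ => (1 : ℝ)) (fun a b => intervalIntegrable_const) 0
  have h2 : distFun K = fun b => (∫ _ in (0 : ℝ)..b, (1 : ℝ) ∂(normalizedMeasure K)) + distFun K 0 := by
    ext b
    rcases le_total 0 b with hb | hb
    · rw [intervalIntegral.integral_of_le hb]
      simp only [integral_const, smul_eq_mul, mul_one, measureReal_restrict_apply_univ]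
      rw [measureReal_congr Ioc_ae_eq_Icc, hK.measureReal_Icc hb]; ring
    · rw [intervalIntegral.integral_of_ge hb]
      simp only [integral_const, smul_eq_mul, mul_one, measureReal_restrict_apply_univ]
      rw [measureReal_congr Ioc_ae_eq_Icc, hK.measureReal_Icc hb]; ring
  rw [h2]
  exact h1.add continuous_const

theorem exists_mem_of_distFun_lt (hK : IsRegular K) {x y : ℝ} (h : distFun K x < distFun K y) :
    ∃ z ∈ K, x < z ∧ z < y := by
  have := hK.nullSingletonClass
  by_contra! hcon
  have hxy : x ≤ y := by
    by_contra! h1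
    exact h.not_ge (hK.distFun_mono h1.le)
  have h1 : (normalizedMeasure K).real (Icc x y) = 0 := by
    rw [← measureReal_congr Ioo_ae_eq_Icc, Measure.real, hK.normalizedMeasure_apply]
    have : Ioo x y ∩ K = ∅ := by
      ext z
      simp only [mem_inter_iff, mem_Ioo, mem_empty_iff_false, iff_false]
      rintro ⟨⟨h1, h2⟩, h3⟩
      exact (hcon z h3 h1).not_gt h2
    rw [this]; simp
  rw [hK.measureReal_Icc hxy] at h1
  linarith

/-- Only an inequality: the image of K ∩ [a, b] lies in K, but K may have further points in the
image interval. -/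
theorem distFun_image_ge (hK : IsRegular K) {s t a b : ℝ} (hs : 0 < s) (hab : a ≤ b)
    (h : ∀ x ∈ Icc a b, x ∈ K → s * x + t ∈ K) :
    s ^ dimension K * (distFun K b - distFun K a) ≤ distFun K (s * b + t) - distFun K (s * a + t) := by
  have := hK.isProbabilityMeasure
  rw [← hK.measureReal_Icc hab, ← hK.measureReal_Icc (by nlinarith : s * a + t ≤ s * b + t)]
  have h1 : (fun x => s * x + t) '' (Icc a b ∩ K) ⊆ Icc (s * a + t) (s * b + t) ∩ K := by
    rintro _ ⟨x, ⟨hx, hxK⟩, rfl⟩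
    refine ⟨⟨?_, ?_⟩, h x hx hxK⟩ <;> nlinarith [hx.1, hx.2]
  have h2 := measure_mono (μ := Measure.hausdorffMeasure (dimension K)) h1
  rw [hausdorffMeasure_image_affine t hK.dimension_pos.le hs] at h2
  rw [Measure.real, Measure.real, ← ENNReal.toReal_ofReal (Real.rpow_nonneg hs.le (dimension K)),
    ← ENNReal.toReal_mul]
  refine ENNReal.toReal_mono (measure_ne_top _ _) ?_
  rw [hK.normalizedMeasure_apply, hK.normalizedMeasure_apply, mul_left_comm]
  exact mul_le_mul_right h2 _

/-- The other inequality is `distFun_image_ge` for the inverse map. -/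
theorem distFun_image_eq (hK : IsRegular K) {s t a b : ℝ} (hs : 0 < s) (hab : a ≤ b)
    (h : ∀ x ∈ Icc a b, x ∈ K ↔ s * x + t ∈ K) :
    distFun K (s * b + t) - distFun K (s * a + t) =
      s ^ dimension K * (distFun K b - distFun K a) := by
  refine le_antisymm ?_ (hK.distFun_image_ge hs hab fun x hx => (h x hx).1)
  have e : ∀ x, s⁻¹ * (s * x + t) + -(s⁻¹ * t) = x := fun x => by field_simp; ring
  have e' : ∀ x, s * (s⁻¹ * x + -(s⁻¹ * t)) + t = x := fun x => by field_simp; ring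
  have h1 := hK.distFun_image_ge (s := s⁻¹) (t := -(s⁻¹ * t)) (inv_pos.2 hs)
    (by nlinarith : s * a + t ≤ s * b + t) (fun x hx hxK => by
      refine (h _ ⟨?_, ?_⟩).2 (by rwa [e'])
      · rw [← e a]; have := mul_le_mul_of_nonneg_left hx.1 (inv_pos.2 hs).le; linarith
      · rw [← e b]; have := mul_le_mul_of_nonneg_left hx.2 (inv_pos.2 hs).le; linarith)
  rw [e, e, Real.inv_rpow hs.le] at h1
  rwa [inv_mul_le_iff₀ (Real.rpow_pos_of_pos hs _)] at h1

theorem density_Icc (hK : IsRegular K) {a b : ℝ} (hab : a ≤ b) :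
    density K (Icc a b) = (distFun K b - distFun K a) / (b - a) ^ dimension K := by
  rw [density, hK.measureReal_Icc hab, Real.diam_Icc hab]

end IsRegular

variable {m : ℕ} {S : LinearIFS (m + 1)} {K : Set ℝ} {M : ℕ → Finset (List (Fin (m + 1)))}

namespace IsUnitSystem

theorem isRegular (h : S.IsUnitSystem K) (hM : S.IsNestedIndexSets M)
    (hfin : Finite (S.OverlapType M)) (hdim : dimension K < 1) : IsRegular K :=
  ⟨h.isCompact, h.dimension_pos, h.hausdorffMeasure_ne_zero hM hfin hdim,
    (h.hausdorffMeasure_lt_top hdim).ne⟩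

theorem distFun_one_sub_zero (h : S.IsUnitSystem K) (hK : IsRegular K) :
    distFun K 1 - distFun K 0 = 1 := by
  rw [← hK.measureReal_Icc zero_le_one, Measure.real, hK.normalizedMeasure_apply,
    inter_eq_self_of_subset_right h.subset_Icc, ENNReal.inv_mul_cancel hK.ne_zero hK.ne_top,
    ENNReal.toReal_one]

theorem distFun_wordMap_ge (h : S.IsUnitSystem K) (hK : IsRegular K) (w : List (Fin (m + 1)))
    {a b : ℝ} (hab : a ≤ b) : S.wordRatio w ^ dimension K * (distFun K b - distFun K a) ≤
      distFun K (S.wordMap w b) - distFun K (S.wordMap w a) := by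
  rw [S.wordMap_eq w b, S.wordMap_eq w a]
  refine hK.distFun_image_ge (S.wordRatio_pos w) hab fun x _ hx => ?_
  rw [← S.wordMap_eq]; exact h.wordMap_mem w hx

/-! ### Locating an interval among the islands, and enlarging it -/

/-- A trimmed interval lies in an island and contains, or straddles two, of its children. -/
theorem exists_island_contains_or_straddles (h : S.IsUnitSystem K) (hM : S.IsNestedIndexSets M)
    (hdim : dimension K < 1) (hK : IsRegular K) {a b : ℝ} (ha : 0 ≤ a) (hab : a < b) (hb : b ≤ 1)
    (htl : ∀ x, a < x → distFun K a < distFun K x)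
    (htr : ∀ x, x < b → distFun K x < distFun K b) :
    ∃ g c d, S.IsIsland M g c d ∧ c ≤ a ∧ b ≤ d ∧
      ((∃ c' d', S.IsIsland M (g + 1) c' d' ∧ c ≤ c' ∧ d' ≤ d ∧ a ≤ c' ∧ d' ≤ b) ∨
      ∃ c₁ d₁ c₂ d₂, S.IsIsland M (g + 1) c₁ d₁ ∧ S.IsIsland M (g + 1) c₂ d₂ ∧
        c ≤ c₁ ∧ d₂ ≤ d ∧ c₁ ≤ a ∧ a < d₁ ∧ d₁ ≤ c₂ ∧ c₂ < b ∧ b ≤ d₂ ∧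
        distFun K d₁ = distFun K c₂) := by
  classical
  -- The least such n is not 0, and g is its predecessor: the last generation with an island
  -- containing [a, b].
  have hex : ∃ n, ¬ ∃ c d, S.IsIsland M n c d ∧ c ≤ a ∧ b ≤ d := by
    obtain ⟨N, hN⟩ := h.exists_island_length_lt hM hdim (sub_pos.2 hab)
    refine ⟨N, ?_⟩
    rintro ⟨c, d, h1, h2, h3⟩
    linarith [hN N le_rfl c d h1]
  have hspec := Nat.find_spec hex
  have hmin := fun n => Nat.find_min hex (m := n)
  revert hspec hmin
  rcases Nat.find hex with _ | g
  · intro h0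
    exact (h0 ⟨0, 1, hM.isIsland_zero, ha, hb⟩).elim
  intro hno hmin
  obtain ⟨c, d, hI, hca, hbd⟩ := not_not.1 (hmin g (Nat.lt_succ_self g))
  refine ⟨g, c, d, hI, hca, hbd, ?_⟩
  by_cases hcase : ∃ c' d', S.IsIsland M (g + 1) c' d' ∧ c ≤ c' ∧ d' ≤ d ∧ a ≤ c' ∧ d' ≤ b
  · exact Or.inl hcase
  refine Or.inr ?_
  -- A child through a point of (a, b) neither contains [a, b] nor lies in it, so it sticks out on
  -- exactly one side.
  have child : ∀ x ∈ K, a < x → x < b → ∃ c' d', S.IsIsland M (g + 1) c' d' ∧ c ≤ c' ∧ d' ≤ d ∧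
      x ∈ Icc c' d' ∧ ((c' < a ∧ d' < b) ∨ (a < c' ∧ b < d')) := by
    intro x hx hax hxb
    obtain ⟨c', d', h1, h2, h3, h4⟩ := h.exists_island_mem hM (Nat.le_succ g) hI hx
      ⟨hca.trans hax.le, hxb.le.trans hbd⟩
    refine ⟨c', d', h1, h2, h3, h4, ?_⟩
    by_cases h5 : c' < a
    · refine Or.inl ⟨h5, ?_⟩
      by_contra! h6
      exact hno ⟨c', d', h1, h5.le, h6⟩
    · push Not at h5
      have h6 : b < d' := by
        by_contra! h6
        exact hcase ⟨c', d', h1, h2, h3, h5, h6⟩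
      refine Or.inr ⟨lt_of_le_of_ne h5 fun h7 => hno ⟨c', d', h1, h7.ge, h6.le⟩, h6⟩
  -- As the interval is trimmed, there is mass beyond the child found first. The child through a
  -- point there must stick out on the other side, because different islands do not overlap.
  have main : ∃ c₁ d₁ c₂ d₂, S.IsIsland M (g + 1) c₁ d₁ ∧ S.IsIsland M (g + 1) c₂ d₂ ∧
        c ≤ c₁ ∧ d₂ ≤ d ∧ c₁ ≤ a ∧ a < d₁ ∧ d₁ ≤ c₂ ∧ c₂ < b ∧ b ≤ d₂ := by
    obtain ⟨x, hx, hax, hxb⟩ := hK.exists_mem_of_distFun_lt (htl b hab)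
    obtain ⟨u, v, h1, h2, h3, h4, h5 | h5⟩ := child x hx hax hxb
    · obtain ⟨y, hy, hvy, hyb⟩ := hK.exists_mem_of_distFun_lt (htr v h5.2)
      obtain ⟨u', v', g1, g2, g3, g4, g5 | g5⟩ := child y hy (by linarith [h4.2]) hyb
      · rcases h1.eq_or_le g1 with g6 | g6 | g6 <;> linarith [h4.1, h4.2, g4.1, g4.2]
      · refine ⟨u, v, u', v', h1, g1, h2, g3, h5.1.le, by linarith [h4.2], ?_,
          by linarith [g4.1], g5.2.le⟩
        rcases h1.eq_or_le g1 with g6 | g6 | g6 <;> linarith [h4.1, h4.2, g4.1, g4.2]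
    · obtain ⟨y, hy, hvy, hyb⟩ := hK.exists_mem_of_distFun_lt (htl u h5.1)
      obtain ⟨u', v', g1, g2, g3, g4, g5 | g5⟩ := child y hy hvy (by linarith [h4.1])
      · refine ⟨u', v', u, v, g1, h1, g2, h3, g5.1.le, by linarith [g4.2], ?_,
          by linarith [h4.1], h5.2.le⟩
        rcases h1.eq_or_le g1 with g6 | g6 | g6 <;> linarith [h4.1, h4.2, g4.1, g4.2]
      · rcases h1.eq_or_le g1 with g6 | g6 | g6 <;> linarith [h4.1, h4.2, g4.1, g4.2]
  obtain ⟨c₁, d₁, c₂, d₂, h1, h2, h3, h4, h5, h6, h7, h8, h9⟩ := main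
  refine ⟨c₁, d₁, c₂, d₂, h1, h2, h3, h4, h5, h6, h7, h8, h9, ?_⟩
  refine le_antisymm (hK.distFun_mono h7) ?_
  -- A point of K strictly between d₁ and c₂ would lie in a third child, and this would have to pass
  -- through one of the other two to reach beyond a or b.
  by_contra! hlt
  obtain ⟨x, hx, hx1, hx2⟩ := hK.exists_mem_of_distFun_lt hlt
  obtain ⟨u, v, g1, g2, g3, g4, g5⟩ := child x hx (h6.trans hx1) (hx2.trans h8)
  rcases h1.eq_or_le g1 with g6 | g6 | g6 <;> rcases h2.eq_or_le g1 with g7 | g7 | g7 <;>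
    rcases g5 with g5 | g5 <;> linarith [g4.1, g4.2]

end IsUnitSystem

/-- Two one-sided self-similarities with the same ratio `r`, at the right end `d` of one piece and
at the left end `c` of the next one, allow to enlarge short intervals around `d` and `c`. -/
theorem exists_enlarged_interval {F : ℝ → ℝ} {α r s₁ s₂ a b c d : ℝ} (hF : Monotone F)
    (hα : 0 < α) (hr0 : 0 < r) (hr1 : r < 1) (hs₁ : 0 < s₁) (hs₂ : 0 < s₂)
    (ha : a < d) (hdc : d ≤ c) (hb : c < b) (hgap : F d = F c)
    (h₁ : ∀ n : ℕ, ∀ x, 0 ≤ x → x ≤ s₁ → F d - F (d - r ^ n * x) = (r ^ n) ^ α * (F d - F (d - x)))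
    (h₂ : ∀ n : ℕ, ∀ x, 0 ≤ x → x ≤ s₂ → F (c + r ^ n * x) - F c = (r ^ n) ^ α * (F (c + x) - F c)) :
    ∃ a' b', min a (d - s₁) ≤ a' ∧ b' ≤ max b (c + s₂) ∧ min s₁ s₂ * r ≤ b' - a' ∧
      (F b - F a) / (b - a) ^ α ≤ (F b' - F a') / (b' - a') ^ α := by
  classical
  have hmin : 0 < min s₁ s₂ := lt_min hs₁ hs₂
  have hX : 0 < d - a := sub_pos.2 ha
  have hY : 0 < b - c := sub_pos.2 hb
  by_cases h0 : d - a ≤ s₁ ∧ b - c ≤ s₂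
  -- With n + 1 the first failing exponent, magnification by r^(-n) keeps the overhangs within s₁
  -- and s₂, but makes at least one of them exceed r s₁ or r s₂ respectively.
  · have hex : ∃ n : ℕ, ¬ (d - a ≤ r ^ n * s₁ ∧ b - c ≤ r ^ n * s₂) := by
      obtain ⟨n, hn⟩ := exists_pow_lt_of_lt_one (div_pos hX hs₁) hr1
      refine ⟨n, fun hcon => ?_⟩
      rw [lt_div_iff₀ hs₁] at hn
      linarith [hcon.1]
    have hspec := Nat.find_spec hex
    have hmn := fun n => Nat.find_min hex (m := n)
    revert hspec hmn
    rcases Nat.find hex with _ | n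
    · intro hcon
      exact (hcon (by simpa using h0)).elim
    intro hno hmn
    obtain ⟨hx, hy⟩ := not_not.1 (hmn n (Nat.lt_succ_self n))
    have hrn : 0 < r ^ n := pow_pos hr0 n
    have hrn1 : r ^ n ≤ 1 := pow_le_one₀ hr0.le hr1.le
    have hx' : (d - a) / r ^ n ≤ s₁ := by rw [div_le_iff₀ hrn]; linarith
    have hy' : (b - c) / r ^ n ≤ s₂ := by rw [div_le_iff₀ hrn]; linarith
    have e1 := h₁ n _ (div_nonneg hX.le hrn.le) hx'
    have e2 := h₂ n _ (div_nonneg hY.le hrn.le) hy'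
    rw [mul_div_cancel₀ _ hrn.ne', sub_sub_cancel] at e1
    rw [mul_div_cancel₀ _ hrn.ne', add_sub_cancel] at e2
    set X := (d - a) / r ^ n with hXdef
    set Y := (b - c) / r ^ n with hYdef
    have hX0 : 0 < X := div_pos hX hrn
    have hY0 : 0 < Y := div_pos hY hrn
    refine ⟨d - X, c + Y, ?_, ?_, ?_, ?_⟩
    · exact (min_le_right _ _).trans (by linarith)
    · exact le_trans (by linarith) (le_max_right _ _)
    · have hpow : r ^ (n + 1) = r ^ n * r := pow_succ r n
      by_contra! hcon
      apply hno
      rw [hpow]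
      have m1 : min s₁ s₂ * r ≤ s₁ * r := mul_le_mul_of_nonneg_right (min_le_left _ _) hr0.le
      have m2 : min s₁ s₂ * r ≤ s₂ * r := mul_le_mul_of_nonneg_right (min_le_right _ _) hr0.le
      have k1 : X ≤ s₁ * r := by linarith
      have k2 : Y ≤ s₂ * r := by linarith
      rw [hXdef, div_le_iff₀ hrn] at k1
      rw [hYdef, div_le_iff₀ hrn] at k2
      constructor <;> linarith
    · have hlen : 0 < c + Y - (d - X) := by linarith
      -- The gap c - d is not magnified, so the length grows by at most r^(-n), while the mass grows
      -- by exactly r^(-nα).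
      have hle : r ^ n * (c + Y - (d - X)) ≤ b - a := by
        have k1 : r ^ n * X = d - a := mul_div_cancel₀ _ hrn.ne'
        have k2 : r ^ n * Y = b - c := mul_div_cancel₀ _ hrn.ne'
        nlinarith
      have hmass : F b - F a = (r ^ n) ^ α * (F (c + Y) - F (d - X)) := by
        have : F b - F a = (F b - F c) + (F d - F a) := by rw [hgap]; ring
        rw [this, e1, e2, hgap]; ring
      have hpos : 0 ≤ F (c + Y) - F (d - X) := sub_nonneg.2 (hF (by linarith))
      rw [hmass, div_le_div_iff₀ (Real.rpow_pos_of_pos (by linarith) _)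
        (Real.rpow_pos_of_pos hlen _)]
      calc (r ^ n) ^ α * (F (c + Y) - F (d - X)) * (c + Y - (d - X)) ^ α
          = (F (c + Y) - F (d - X)) * (r ^ n * (c + Y - (d - X))) ^ α := by
            rw [Real.mul_rpow hrn.le hlen.le]; ring
        _ ≤ _ := by gcongr
  -- One overhang already exceeds s₁ or s₂; the interval is long as it stands.
  · refine ⟨a, b, min_le_left _ _, le_max_left _ _, ?_, le_rfl⟩
    have hle : min s₁ s₂ * r ≤ min s₁ s₂ := mul_le_of_le_one_right hmin.le hr1.le
    by_contra! hcon
    apply h0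
    constructor
    · linarith [min_le_left s₁ s₂]
    · linarith [min_le_right s₁ s₂]

end LinearIFS

/-! ### Self-similarity at the ends of islands, and positivity of η -/

namespace LinearIFS

variable {m : ℕ} {S : LinearIFS (m + 1)} {K : Set ℝ} {M : ℕ → Finset (List (Fin (m + 1)))}

/-- One representative for each of the finitely many types is enough, so thresholds depending on the
island become uniform. -/
theorem eventually_forall_island {S : LinearIFS m} {M : ℕ → Finset (List (Fin m))}
    (hfin : Finite (S.OverlapType M)) {Q : Island S M → ℕ → Prop}
    (htrans : ∀ I I', S.islandRel M I I' → ∀ n, Q I n → Q I' n)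
    (hQ : ∀ I, ∀ᶠ n in atTop, Q I n) : ∀ᶠ n in atTop, ∀ I, Q I n := by
  have h1 : ∀ᶠ n in atTop, ∀ q : S.OverlapType M, Q q.out n := eventually_all.2 fun q => hQ q.out
  filter_upwards [h1] with n hn I
  exact htrans _ _ (Quotient.mk_out (s := S.islandSetoid M) I) n
    (hn (Quotient.mk (S.islandSetoid M) I))

theorem vertices_finite (S : LinearIFS m) (M : ℕ → Finset (List (Fin m))) (k : ℕ) (I : Set ℝ) :
    (S.vertices M k I).Finite := by
  refine ((M k).finite_toSet.image S.wordMap).subset ?_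
  rintro v ⟨⟨w, hw, rfl⟩, -⟩
  exact ⟨w, hw, rfl⟩

theorem exists_wordMap_of_mem_vertices {S : LinearIFS m} {M : ℕ → Finset (List (Fin m))} {k : ℕ}
    {I : Set ℝ} {v : ℝ → ℝ} (hv : v ∈ S.vertices M k I) : ∃ w ∈ M k, v = S.wordMap w := hv.1

/-- Two intervals with a common left end are nested, which (A) forbids. -/
theorem AssumptionA.left_lt {S : LinearIFS m} {M : ℕ → Finset (List (Fin m))}
    (hA : S.AssumptionA M) (I : Island S M) {c d : ℝ} (hI : I.carrier = Icc c d) {u v : ℝ → ℝ}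
    (hu : u ∈ S.vertices M I.gen I.carrier) (hv : v ∈ S.vertices M I.gen I.carrier)
    (huv : u ≠ v) (hvc : v 0 = c) : v 0 < u 0 := by
  have h1 := hA I u hu v hv huv
  have h2 := hA I v hv u hu huv.symm
  rw [hI] at hu hv
  obtain ⟨w, -, rfl, hw1, -⟩ := wordMap_mem_vertices.1 hu
  obtain ⟨w', -, rfl, -, -⟩ := wordMap_mem_vertices.1 hv
  rw [wordMap_image_Icc, wordMap_image_Icc, Icc_subset_Icc_iff (S.wordMap_zero_lt_one _).le] at h1 h2
  by_contra! hcon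
  have he : S.wordMap w 0 = S.wordMap w' 0 := le_antisymm hcon (hvc ▸ hw1)
  rcases le_total (S.wordMap w 1) (S.wordMap w' 1) with h | h
  · exact h1 ⟨he.ge, h⟩
  · exact h2 ⟨he.le, h⟩

theorem AssumptionA.lt_right {S : LinearIFS m} {M : ℕ → Finset (List (Fin m))}
    (hA : S.AssumptionA M) (I : Island S M) {c d : ℝ} (hI : I.carrier = Icc c d) {u v : ℝ → ℝ}
    (hu : u ∈ S.vertices M I.gen I.carrier) (hv : v ∈ S.vertices M I.gen I.carrier)
    (huv : u ≠ v) (hvd : v 1 = d) : u 1 < v 1 := by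
  have h1 := hA I u hu v hv huv
  have h2 := hA I v hv u hu huv.symm
  rw [hI] at hu hv
  obtain ⟨w, -, rfl, -, hw1⟩ := wordMap_mem_vertices.1 hu
  obtain ⟨w', -, rfl, -, -⟩ := wordMap_mem_vertices.1 hv
  rw [wordMap_image_Icc, wordMap_image_Icc, Icc_subset_Icc_iff (S.wordMap_zero_lt_one _).le] at h1 h2
  by_contra! hcon
  have he : S.wordMap w 1 = S.wordMap w' 1 := le_antisymm (hvd ▸ hw1) hcon
  rcases le_total (S.wordMap w 0) (S.wordMap w' 0) with h | h
  · exact h2 ⟨h, he.ge⟩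
  · exact h1 ⟨h, he.le⟩

theorem tendsto_wordMap_pow (S : LinearIFS m) (w : List (Fin m)) (j : Fin m) :
    Tendsto (fun n => S.wordMap w (S.ratio j ^ n)) atTop (𝓝 (S.wordMap w 0)) :=
  ((S.continuous_wordMap w).tendsto 0).comp
    (tendsto_pow_atTop_nhds_zero_of_lt_one (S.ratio_pos j).le (S.ratio_lt_one j))

theorem tendsto_wordMap_one_sub_pow (S : LinearIFS m) (w : List (Fin m)) (j : Fin m) :
    Tendsto (fun n => S.wordMap w (1 - S.ratio j ^ n)) atTop (𝓝 (S.wordMap w 1)) := by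
  have h1 : Tendsto (fun n => 1 - S.ratio j ^ n) atTop (𝓝 (1 - 0)) :=
    tendsto_const_nhds.sub
      (tendsto_pow_atTop_nhds_zero_of_lt_one (S.ratio_pos j).le (S.ratio_lt_one j))
  rw [sub_zero] at h1
  exact ((S.continuous_wordMap w).tendsto 1).comp h1

namespace IsUnitSystem

/-- (B) allows the factors S_1 to be peeled off one at a time. -/
theorem ratio_zero_pow_mul_mem_iff (h : S.IsUnitSystem K) (hB : S.AssumptionB K) (n : ℕ) {y : ℝ}
    (hy : y ∈ Icc (0 : ℝ) 1) : S.ratio 0 ^ n * y ∈ K ↔ y ∈ K := by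
  constructor
  · induction n with
    | zero => simp
    | succ n ih =>
      intro hK
      apply ih
      have hmem : S.ratio 0 ^ n * y ∈ Icc (0 : ℝ) 1 := by
        have := h.wordMap_mem_Icc (List.replicate n 0) hy
        rwa [wordMap_replicate, h.iterate_map_zero] at this
      have h1 := h.iterate_map_zero 1 (S.ratio 0 ^ n * y)
      rw [Function.iterate_one, pow_one, ← mul_assoc, ← pow_succ'] at h1
      rw [← h1] at hK
      have h2 : S.map 0 (S.ratio 0 ^ n * y) ∈ S.map 0 '' K := hB.1 ▸ ⟨mem_image_of_mem _ hmem, hK⟩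
      obtain ⟨z, hz, he⟩ := h2
      have : z = S.ratio 0 ^ n * y := by
        simp only [LinearIFS.map] at he
        have := (S.ratio_pos 0).ne'
        have h3 : S.ratio 0 * z = S.ratio 0 * (S.ratio 0 ^ n * y) := by linarith
        exact mul_left_cancel₀ this h3
      exact this ▸ hz
  · intro hK
    have := h.wordMap_mem (List.replicate n 0) hK
    rwa [wordMap_replicate, h.iterate_map_zero] at this

theorem one_sub_ratio_last_pow_mul_mem_iff (h : S.IsUnitSystem K) (hB : S.AssumptionB K) (n : ℕ)
    {y : ℝ} (hy : y ∈ Icc (0 : ℝ) 1) :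
    1 - S.ratio (Fin.last m) ^ n * (1 - y) ∈ K ↔ y ∈ K := by
  constructor
  · induction n with
    | zero => simp
    | succ n ih =>
      intro hK
      apply ih
      have hmem : 1 - S.ratio (Fin.last m) ^ n * (1 - y) ∈ Icc (0 : ℝ) 1 := by
        have := h.wordMap_mem_Icc (List.replicate n (Fin.last m)) hy
        rwa [wordMap_replicate, h.iterate_map_last] at this
      have h1 := h.iterate_map_last 1 (1 - S.ratio (Fin.last m) ^ n * (1 - y))
      rw [Function.iterate_one, pow_one, sub_sub_cancel, ← mul_assoc, ← pow_succ'] at h1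
      rw [← h1] at hK
      have h2 : S.map (Fin.last m) (1 - S.ratio (Fin.last m) ^ n * (1 - y)) ∈
          S.map (Fin.last m) '' K := hB.2 ▸ ⟨mem_image_of_mem _ hmem, hK⟩
      obtain ⟨z, hz, he⟩ := h2
      have : z = 1 - S.ratio (Fin.last m) ^ n * (1 - y) := by
        simp only [LinearIFS.map] at he
        have := (S.ratio_pos (Fin.last m)).ne'
        have h3 : S.ratio (Fin.last m) * z =
          S.ratio (Fin.last m) * (1 - S.ratio (Fin.last m) ^ n * (1 - y)) := by linarith
        exact mul_left_cancel₀ this h3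
      exact this ▸ hz
  · intro hK
    have := h.wordMap_mem (List.replicate n (Fin.last m)) hK
    rwa [wordMap_replicate, h.iterate_map_last] at this

theorem image_comp_iterate_zero (h : S.IsUnitSystem K) (w : List (Fin (m + 1))) (n : ℕ) :
    (S.wordMap w ∘ (S.map 0)^[n]) '' Icc 0 1 =
      Icc (S.wordMap w 0) (S.wordMap w (S.ratio 0 ^ n)) := by
  rw [image_comp, ← wordMap_replicate, wordMap_image_Icc, wordMap_image_Icc, wordMap_replicate,
    h.iterate_map_zero, h.iterate_map_zero, mul_zero, mul_one]

/-- The infimum is taken over a non-empty finite set, so being below it means being below each left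
end. -/
theorem subset_Ico_iff (h : S.IsUnitSystem K) {I : Island S M} {c : ℝ} {w : List (Fin (m + 1))}
    (hne : (S.vertices M I.gen I.carrier \ {S.wordMap w}).Nonempty)
    (hw : S.wordMap w 0 = c) (n : ℕ) :
    (S.wordMap w ∘ (S.map 0)^[n]) '' Icc 0 1 ⊆
      Ico c (sInf ((fun u => u 0) '' (S.vertices M I.gen I.carrier \ {S.wordMap w}))) ↔
      ∀ u ∈ S.vertices M I.gen I.carrier, u ≠ S.wordMap w → S.wordMap w (S.ratio 0 ^ n) < u 0 := by
  have hfin : ((fun u : ℝ → ℝ => u 0) '' (S.vertices M I.gen I.carrier \ {S.wordMap w})).Finite :=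
    ((S.vertices_finite M _ _).subset sdiff_subset).image _
  have hlt : S.wordMap w 0 ≤ S.wordMap w (S.ratio 0 ^ n) :=
    (S.wordMap_strictMono w).monotone (pow_pos (S.ratio_pos 0) n).le
  rw [h.image_comp_iterate_zero]
  constructor
  · intro hsub u hu huw
    exact (hsub (right_mem_Icc.2 hlt)).2.trans_le (csInf_le hfin.bddBelow ⟨u, ⟨hu, huw⟩, rfl⟩)
  · intro hall x hx
    refine ⟨hw ▸ hx.1, hx.2.trans_lt ?_⟩
    obtain ⟨u, ⟨hu, huw⟩, he⟩ := (hne.image (fun u : ℝ → ℝ => u 0)).csInf_mem hfin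
    rw [← he]
    exact hall u hu huw

theorem leftIndex_le (h : S.IsUnitSystem K) {I : Island S M} {w : List (Fin (m + 1))}
    (hw : S.wordMap w 0 = sInf I.carrier) (hv : S.wordMap w ∈ S.vertices M I.gen I.carrier) {n : ℕ}
    (hn : 1 ≤ n) (hall : ∀ u ∈ S.vertices M I.gen I.carrier, u ≠ S.wordMap w →
      S.wordMap w (S.ratio 0 ^ n) < u 0) : S.leftIndex M I (S.wordMap w) ≤ n := by
  unfold leftIndex
  split_ifs with hs
  · exact Nat.zero_le n
  · have hne : (S.vertices M I.gen I.carrier \ {S.wordMap w}).Nonempty := by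
      by_contra hcon
      rw [not_nonempty_iff_eq_empty, sdiff_eq_empty] at hcon
      exact hs (subset_antisymm hcon (singleton_subset_iff.2 hv))
    exact Nat.sInf_le ⟨hn, (h.subset_Ico_iff hne hw n).2 hall⟩

theorem eventually_left_lt (hA : S.AssumptionA M) (I : Island S M) {c d : ℝ}
    (hI : I.carrier = Icc c d) {v : ℝ → ℝ} (hv : v ∈ S.vertices M I.gen I.carrier)
    (hvc : v 0 = c) : ∀ᶠ n in atTop, ∀ u ∈ S.vertices M I.gen I.carrier, u ≠ v →
      v (S.ratio 0 ^ n) < u 0 := by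
  refine (eventually_all_finite (S.vertices_finite M _ _)).2 fun u hu => ?_
  by_cases huv : u = v
  · simp [huv]
  obtain ⟨w, -, rfl⟩ := exists_wordMap_of_mem_vertices hv
  filter_upwards [(S.tendsto_wordMap_pow w 0).eventually_lt_const
    (hA.left_lt I hI hu hv huv hvc)] with n hn _
  exact hn

theorem eventually_lt_right (hA : S.AssumptionA M) (I : Island S M) {c d : ℝ}
    (hI : I.carrier = Icc c d) {v : ℝ → ℝ} (hv : v ∈ S.vertices M I.gen I.carrier)
    (hvd : v 1 = d) : ∀ᶠ n in atTop, ∀ u ∈ S.vertices M I.gen I.carrier, u ≠ v →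
      u 1 < v (1 - S.ratio (Fin.last m) ^ n) := by
  refine (eventually_all_finite (S.vertices_finite M _ _)).2 fun u hu => ?_
  by_cases huv : u = v
  · simp [huv]
  obtain ⟨w, -, rfl⟩ := exists_wordMap_of_mem_vertices hv
  filter_upwards [(S.tendsto_wordMap_one_sub_pow w (Fin.last m)).eventually_const_lt
    (hA.lt_right I hI hu hv huv hvd)] with n hn _
  exact hn

theorem leftIndex_spec (h : S.IsUnitSystem K) (hA : S.AssumptionA M) (I : Island S M) {c d : ℝ}
    (hcd : c ≤ d) (hI : I.carrier = Icc c d) {w : List (Fin (m + 1))}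
    (hv : S.wordMap w ∈ S.vertices M I.gen I.carrier) (hvc : S.wordMap w 0 = c) :
    ∀ u ∈ S.vertices M I.gen I.carrier, u ≠ S.wordMap w →
      S.wordMap w (S.ratio 0 ^ S.leftIndex M I (S.wordMap w)) < u 0 := by
  have hinf : sInf I.carrier = c := by rw [hI, csInf_Icc hcd]
  intro u hu huw
  have hne : (S.vertices M I.gen I.carrier \ {S.wordMap w}).Nonempty := ⟨u, hu, huw⟩
  have hs : S.vertices M I.gen I.carrier ≠ {S.wordMap w} := fun hs => by
    rw [hs] at hu; exact huw hu
  have hex : {n | 1 ≤ n ∧ (S.wordMap w ∘ (S.map 0)^[n]) '' Icc 0 1 ⊆ Ico (sInf I.carrier)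
      (sInf ((fun u => u 0) '' (S.vertices M I.gen I.carrier \ {S.wordMap w})))}.Nonempty := by
    obtain ⟨n, hn1, hn⟩ := ((eventually_ge_atTop 1).and (eventually_left_lt hA I hI hv hvc)).exists
    exact ⟨n, hn1, (h.subset_Ico_iff hne (hvc.trans hinf.symm) n).2 hn⟩
  have hmem := (Nat.sInf_mem hex).2
  rw [h.subset_Ico_iff hne (hvc.trans hinf.symm)] at hmem
  have := hmem u hu huw
  unfold leftIndex
  rwa [if_neg hs]

/-- If the other constitutive intervals end before the last piece of w begins, a point of K in that
piece comes from w, and (B) pulls it back to K. -/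
theorem mem_rightIndex_set (h : S.IsUnitSystem K) (hM : S.IsNestedIndexSets M)
    (hB : S.AssumptionB K) (I : Island S M) {c d : ℝ}
    (hI' : S.IsIsland M I.gen c d) (hI : I.carrier = Icc c d) {w : List (Fin (m + 1))}
    (hv : S.wordMap w ∈ S.vertices M I.gen I.carrier) (n : ℕ)
    (hall : ∀ u ∈ S.vertices M I.gen I.carrier, u ≠ S.wordMap w →
      u 1 < S.wordMap w (1 - S.ratio (Fin.last m) ^ n)) :
    (S.wordMap w ∘ (S.map (Fin.last m))^[n]) '' Icc 0 1 ∩ K =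
      (S.wordMap w ∘ (S.map (Fin.last m))^[n]) '' K := by
  have hwI := hv
  rw [hI] at hwI
  obtain ⟨w', -, hww', hw1, hw2⟩ := wordMap_mem_vertices.1 hwI
  rw [← hww'] at hw1 hw2
  apply Subset.antisymm
  · rintro _ ⟨⟨y, hy, rfl⟩, hxK⟩
    refine ⟨y, ?_, rfl⟩
    simp only [Function.comp] at hxK
    rw [h.iterate_map_last] at hxK
    have hmem : 1 - S.ratio (Fin.last m) ^ n * (1 - y) ∈ Icc (0 : ℝ) 1 := by
      have := h.wordMap_mem_Icc (List.replicate n (Fin.last m)) hy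
      rwa [wordMap_replicate, h.iterate_map_last] at this
    have hmono := (S.wordMap_strictMono w).monotone
    obtain ⟨i, hi, hi1, hi2, z, hz, he⟩ := h.exists_vertex_word hM hI' hxK
      ⟨hw1.trans (hmono hmem.1), (hmono hmem.2).trans hw2⟩
    have hi3 : S.wordMap i ∈ S.vertices M I.gen I.carrier := by
      rw [hI]; exact wordMap_mem_vertices.2 ⟨i, hi, rfl, hi1, hi2⟩
    by_cases hiw : S.wordMap i = S.wordMap w
    · rw [hiw] at he
      rw [(S.wordMap_strictMono w).injective he] at hz
      exact (h.one_sub_ratio_last_pow_mul_mem_iff hB n hy).1 hz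
    · exfalso
      have h1 := hall _ hi3 hiw
      have h2 : S.wordMap i z ≤ S.wordMap i 1 :=
        (S.wordMap_strictMono i).monotone (h.subset_Icc hz).2
      have h3 : S.wordMap w (1 - S.ratio (Fin.last m) ^ n) ≤
          S.wordMap w (1 - S.ratio (Fin.last m) ^ n * (1 - y)) := by
        apply hmono
        nlinarith [pow_pos (S.ratio_pos (Fin.last m)) n, hy.1]
      linarith
  · rintro _ ⟨y, hy, rfl⟩
    refine ⟨⟨y, h.subset_Icc hy, rfl⟩, ?_⟩
    rw [Function.comp, ← wordMap_replicate]
    exact h.wordMap_mem _ (h.wordMap_mem _ hy)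

theorem rightIndex_spec (h : S.IsUnitSystem K) (hM : S.IsNestedIndexSets M) (hA : S.AssumptionA M)
    (hB : S.AssumptionB K) (I : Island S M) {c d : ℝ}
    (hI' : S.IsIsland M I.gen c d) (hI : I.carrier = Icc c d) {w : List (Fin (m + 1))}
    (hv : S.wordMap w ∈ S.vertices M I.gen I.carrier) (hvd : S.wordMap w 1 = d) :
    (S.wordMap w ∘ (S.map (Fin.last m))^[S.rightIndex K (S.wordMap w)]) '' Icc 0 1 ∩ K =
      (S.wordMap w ∘ (S.map (Fin.last m))^[S.rightIndex K (S.wordMap w)]) '' K := by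
  obtain ⟨n, hn⟩ := (eventually_lt_right hA I hI hv hvd).exists
  exact Nat.sInf_mem (s := {n | (S.wordMap w ∘ (S.map (Fin.last m))^[n]) '' Icc 0 1 ∩ K =
    (S.wordMap w ∘ (S.map (Fin.last m))^[n]) '' K}) ⟨n, h.mem_rightIndex_set hM hB I hI' hI hv n hn⟩

/-- On the initial stretch of length ρ_v ρ_1^p no other constitutive interval interferes, so by (B)
K is there an affine copy of itself. Contraction towards c by ρ_1^n corresponds to S_1^n and
respects membership in K both ways. -/
theorem distFun_left_similar (h : S.IsUnitSystem K) (hM : S.IsNestedIndexSets M)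
    (hK : IsRegular K) (hA : S.AssumptionA M)
    (hB : S.AssumptionB K) (I : Island S M) {c d : ℝ}
    (hI' : S.IsIsland M I.gen c d) (hI : I.carrier = Icc c d) {w : List (Fin (m + 1))}
    (hv : S.wordMap w ∈ S.vertices M I.gen I.carrier) (hvc : S.wordMap w 0 = c) (n : ℕ) {x : ℝ}
    (hx0 : 0 ≤ x) (hx1 : x ≤ S.wordRatio w * S.ratio 0 ^ S.leftIndex M I (S.wordMap w)) :
    distFun K (c + S.ratio 0 ^ n * x) - distFun K c =
      (S.ratio 0 ^ n) ^ dimension K * (distFun K (c + x) - distFun K c) := by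
  set p := S.leftIndex M I (S.wordMap w) with hp
  have hspec := h.leftIndex_spec hA I hI'.lt.le hI hv hvc
  have hwI := hv
  rw [hI] at hwI
  obtain ⟨w', -, hww', -, hw2⟩ := wordMap_mem_vertices.1 hwI
  rw [← hww'] at hw2
  have hr := pow_pos (S.ratio_pos 0) n
  have hs : 0 < S.wordRatio w * S.ratio 0 ^ p := mul_pos (S.wordRatio_pos w) (pow_pos (S.ratio_pos 0) p)
  set s := S.wordRatio w * S.ratio 0 ^ p with hsdef
  have hwm : ∀ y, S.wordMap w (S.ratio 0 ^ p * y) = c + s * y := fun y => by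
    rw [S.wordMap_eq, hvc, hsdef]; ring
  have hmono := (S.wordMap_strictMono w).monotone
  have key : ∀ y ∈ Icc (0 : ℝ) 1, c + s * y ∈ K ↔ y ∈ K := by
    intro y hy
    rw [← hwm]
    constructor
    · intro hxK
      have hmem : S.ratio 0 ^ p * y ∈ Icc (0 : ℝ) 1 := by
        have := h.wordMap_mem_Icc (List.replicate p 0) hy
        rwa [wordMap_replicate, h.iterate_map_zero] at this
      obtain ⟨i, hi, hi1, hi2, z, hz, he⟩ := h.exists_vertex_word hM hI' hxK
        ⟨hvc ▸ hmono hmem.1, (hmono hmem.2).trans hw2⟩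
      have hi3 : S.wordMap i ∈ S.vertices M I.gen I.carrier := by
        rw [hI]; exact wordMap_mem_vertices.2 ⟨i, hi, rfl, hi1, hi2⟩
      by_cases hiw : S.wordMap i = S.wordMap w
      · rw [hiw] at he
        rw [(S.wordMap_strictMono w).injective he] at hz
        exact (h.ratio_zero_pow_mul_mem_iff hB p hy).1 hz
      · exfalso
        have h1 := hspec _ hi3 hiw
        have h2 : S.wordMap i 0 ≤ S.wordMap i z :=
          (S.wordMap_strictMono i).monotone (h.subset_Icc hz).1
        have h3 : S.wordMap w (S.ratio 0 ^ p * y) ≤ S.wordMap w (S.ratio 0 ^ p) := by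
          apply hmono
          nlinarith [pow_pos (S.ratio_pos 0) p, hy.2]
        linarith
    · intro hy'
      exact h.wordMap_mem w ((h.ratio_zero_pow_mul_mem_iff hB p hy).2 hy')
  have := hK.distFun_image_eq (s := S.ratio 0 ^ n) (t := c - S.ratio 0 ^ n * c) (a := c) (b := c + x)
    hr (by linarith) (fun z hz => ?_)
  · have e1 : S.ratio 0 ^ n * (c + x) + (c - S.ratio 0 ^ n * c) = c + S.ratio 0 ^ n * x := by ring
    have e2 : S.ratio 0 ^ n * c + (c - S.ratio 0 ^ n * c) = c := by ring
    rwa [e1, e2] at this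
  · set y := (z - c) / s with hy
    have hzy : z = c + s * y := by rw [hy]; field_simp; ring
    have hy1 : y ∈ Icc (0 : ℝ) 1 := by
      constructor
      · exact div_nonneg (by linarith [hz.1]) hs.le
      · rw [hy, div_le_one hs]; linarith [hz.2]
    have e : S.ratio 0 ^ n * z + (c - S.ratio 0 ^ n * c) = c + s * (S.ratio 0 ^ n * y) := by
      rw [hzy]; ring
    have hy2 : S.ratio 0 ^ n * y ∈ Icc (0 : ℝ) 1 := by
      have := h.wordMap_mem_Icc (List.replicate n 0) hy1
      rwa [wordMap_replicate, h.iterate_map_zero] at this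
    rw [e, key _ hy2, h.ratio_zero_pow_mul_mem_iff hB n hy1, hzy, key y hy1]

/-- Here the defining property of `rightIndex` already says that K is a copy of itself on the final
stretch; (B) then gives the scaling by S_m^n. -/
theorem distFun_right_similar (h : S.IsUnitSystem K) (hM : S.IsNestedIndexSets M)
    (hK : IsRegular K) (hA : S.AssumptionA M)
    (hB : S.AssumptionB K) (I : Island S M) {c d : ℝ}
    (hI' : S.IsIsland M I.gen c d) (hI : I.carrier = Icc c d) {w : List (Fin (m + 1))}
    (hv : S.wordMap w ∈ S.vertices M I.gen I.carrier) (hvd : S.wordMap w 1 = d) (n : ℕ) {x : ℝ}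
    (hx0 : 0 ≤ x)
    (hx1 : x ≤ S.wordRatio w * S.ratio (Fin.last m) ^ S.rightIndex K (S.wordMap w)) :
    distFun K d - distFun K (d - S.ratio (Fin.last m) ^ n * x) =
      (S.ratio (Fin.last m) ^ n) ^ dimension K * (distFun K d - distFun K (d - x)) := by
  set q := S.rightIndex K (S.wordMap w) with hq
  have hspec := h.rightIndex_spec hM hA hB I hI' hI hv hvd
  rw [← hq] at hspec
  set ρ := S.ratio (Fin.last m) with hρ
  have hr : 0 < ρ ^ n := pow_pos (S.ratio_pos _) n
  have hs : 0 < S.wordRatio w * ρ ^ q := mul_pos (S.wordRatio_pos w) (pow_pos (S.ratio_pos _) q)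
  set s := S.wordRatio w * ρ ^ q with hsdef
  have hwm : ∀ y, (S.wordMap w ∘ (S.map (Fin.last m))^[q]) y = d - s * (1 - y) := fun y => by
    rw [Function.comp, h.iterate_map_last, S.wordMap_eq, ← hvd, hsdef, wordRatio]; ring
  have key : ∀ y ∈ Icc (0 : ℝ) 1, d - s * (1 - y) ∈ K ↔ y ∈ K := by
    intro y hy
    constructor
    · intro hxK
      have h1 : d - s * (1 - y) ∈ (S.wordMap w ∘ (S.map (Fin.last m))^[q]) '' K := by
        rw [← hspec]; exact ⟨⟨y, hy, hwm y⟩, hxK⟩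
      obtain ⟨z, hz, he⟩ := h1
      rw [hwm] at he
      have h3 : s * z = s * y := by linarith
      exact mul_left_cancel₀ hs.ne' h3 ▸ hz
    · intro hy'
      have h1 : d - s * (1 - y) ∈ (S.wordMap w ∘ (S.map (Fin.last m))^[q]) '' K := ⟨y, hy', hwm y⟩
      rw [← hspec] at h1
      exact h1.2
  have := hK.distFun_image_eq (s := ρ ^ n) (t := d - ρ ^ n * d) (a := d - x) (b := d)
    hr (by linarith) (fun z hz => ?_)
  · have e1 : ρ ^ n * (d - x) + (d - ρ ^ n * d) = d - ρ ^ n * x := by ring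
    have e2 : ρ ^ n * d + (d - ρ ^ n * d) = d := by ring
    rwa [e1, e2] at this
  · set y := 1 - (d - z) / s with hy
    have hzy : z = d - s * (1 - y) := by rw [hy]; field_simp; ring
    have hy1 : y ∈ Icc (0 : ℝ) 1 := by
      constructor
      · rw [hy, sub_nonneg, div_le_one hs]; linarith [hz.1]
      · have : 0 ≤ (d - z) / s := div_nonneg (by linarith [hz.2]) hs.le
        linarith
    have e : ρ ^ n * z + (d - ρ ^ n * d) = d - s * (1 - (1 - ρ ^ n * (1 - y))) := by
      rw [hzy]; ring
    have hy2 : 1 - ρ ^ n * (1 - y) ∈ Icc (0 : ℝ) 1 := by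
      have := h.wordMap_mem_Icc (List.replicate n (Fin.last m)) hy1
      rwa [wordMap_replicate, h.iterate_map_last] at this
    rw [e, key _ hy2, h.one_sub_ratio_last_pow_mul_mem_iff hB n hy1, hzy, key y hy1]

theorem vertex_length_pos {k : ℕ} {I : Set ℝ} {v : ℝ → ℝ} (hv : v ∈ S.vertices M k I) :
    0 < v 1 - v 0 := by
  obtain ⟨w, -, rfl⟩ := exists_wordMap_of_mem_vertices hv
  exact sub_pos.2 (S.wordMap_zero_lt_one w)

theorem eta₁_le {I : Island S M} {v : ℝ → ℝ} (hv : v ∈ S.vertices M I.gen I.carrier)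
    (hend : v 0 = sInf I.carrier ∨ v 1 = sSup I.carrier) :
    S.eta₁ M ≤ (v 1 - v 0) / Metric.diam I.carrier := by
  refine csInf_le ⟨0, ?_⟩ ⟨I, v, hv, hend, rfl⟩
  rintro r ⟨I, v, hv, -, rfl⟩
  exact div_nonneg (vertex_length_pos hv).le Metric.diam_nonneg

theorem eta₂_bddBelow (S : LinearIFS (m + 1)) (M : ℕ → Finset (List (Fin (m + 1)))) (K : Set ℝ) :
    BddBelow {r | ∃ I : Island S M, ∃ v ∈ S.vertices M I.gen I.carrier,
    (v 0 = sInf I.carrier ∧ r = S.ratio 0 ^ S.leftIndex M I v) ∨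
    (v 1 = sSup I.carrier ∧ r = S.ratio (Fin.last m) ^ S.rightIndex K v)} := by
  refine ⟨0, ?_⟩
  rintro r ⟨I, v, hv, ⟨-, rfl⟩ | ⟨-, rfl⟩⟩
  · exact (pow_pos (S.ratio_pos _) _).le
  · exact (pow_pos (S.ratio_pos _) _).le

theorem eta₂_le_left {I : Island S M} {v : ℝ → ℝ} (hv : v ∈ S.vertices M I.gen I.carrier)
    (hend : v 0 = sInf I.carrier) : S.eta₂ M K ≤ S.ratio 0 ^ S.leftIndex M I v :=
  csInf_le (eta₂_bddBelow S M K) ⟨I, v, hv, Or.inl ⟨hend, rfl⟩⟩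

theorem eta₂_le_right {I : Island S M} {v : ℝ → ℝ} (hv : v ∈ S.vertices M I.gen I.carrier)
    (hend : v 1 = sSup I.carrier) :
    S.eta₂ M K ≤ S.ratio (Fin.last m) ^ S.rightIndex K v :=
  csInf_le (eta₂_bddBelow S M K) ⟨I, v, hv, Or.inr ⟨hend, rfl⟩⟩

/-- The island `[c, d]` of generation `k`. -/
def toIsland (h : S.IsUnitSystem K) {k : ℕ} {c d : ℝ} (hI : S.IsIsland M k c d) : Island S M :=
  ⟨k, Icc c d, h.mem_islands.2 ⟨c, d, hI, rfl⟩⟩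

theorem exists_left_vertex (h : S.IsUnitSystem K) {k : ℕ} {c d : ℝ} (hI : S.IsIsland M k c d) :
    ∃ w, S.wordMap w ∈ S.vertices M (h.toIsland hI).gen (h.toIsland hI).carrier ∧
      S.wordMap w 0 = c := by
  obtain ⟨w, hw, h1, h2⟩ := hI.exists_word_left
  exact ⟨w, wordMap_mem_vertices.2 ⟨w, hw, rfl, h1.ge, h2⟩, h1⟩

theorem exists_right_vertex (h : S.IsUnitSystem K) {k : ℕ} {c d : ℝ} (hI : S.IsIsland M k c d) :
    ∃ w, S.wordMap w ∈ S.vertices M (h.toIsland hI).gen (h.toIsland hI).carrier ∧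
      S.wordMap w 1 = d := by
  obtain ⟨w, hw, h1, h2⟩ := hI.exists_word_right
  exact ⟨w, wordMap_mem_vertices.2 ⟨w, hw, rfl, h1, h2.le⟩, h2⟩

/-- Equivalent islands have the same quotients ρ_v/|I|, and each island has finitely many vertices.
-/
theorem eta₁_pos (h : S.IsUnitSystem K) (hM : S.IsNestedIndexSets M)
    (hfin : Finite (S.OverlapType M)) : 0 < S.eta₁ M := by
  have hev : ∀ᶠ n : ℕ in atTop, ∀ I : Island S M, ∀ v ∈ S.vertices M I.gen I.carrier,
      1 / (n + 1 : ℝ) ≤ (v 1 - v 0) / Metric.diam I.carrier := by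
    refine eventually_forall_island hfin ?_ ?_
    · intro I I' hrel n hn v' hv'
      obtain ⟨c, d, hI, hc⟩ := h.mem_islands.1 I.mem
      obtain ⟨c', d', hI', hc'⟩ := h.mem_islands.1 I'.mem
      obtain ⟨a, b, hτ, hV⟩ := h.exists_affine_of_islandRel hI hI' hc hc' hrel
      rw [hV] at hv'
      obtain ⟨v, hv, rfl⟩ := hv'
      have h1 := hn v hv
      have ha := hτ.1
      have hl : 0 < d - c := sub_pos.2 hI.lt
      rw [hc, Real.diam_Icc hI.lt.le] at h1
      rw [hc', Real.diam_Icc hI'.lt.le, hτ.length_eq]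
      have e : (a * v 1 + b - (a * v 0 + b)) / (a * (d - c)) = (v 1 - v 0) / (d - c) := by
        field_simp; ring
      rwa [e]
    · intro I
      refine (eventually_all_finite (S.vertices_finite M _ _)).2 fun v hv => ?_
      obtain ⟨c, d, hI, hc⟩ := h.mem_islands.1 I.mem
      rw [hc, Real.diam_Icc hI.lt.le]
      exact (tendsto_one_div_add_atTop_nhds_zero_nat.eventually_lt_const
        (div_pos (vertex_length_pos hv) (sub_pos.2 hI.lt))).mono fun n hn => hn.le
  obtain ⟨n, hn⟩ := hev.exists
  refine lt_of_lt_of_le (by positivity : 0 < 1 / (n + 1 : ℝ)) (le_csInf ?_ ?_)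
  · obtain ⟨w, hw, hw0⟩ := h.exists_left_vertex hM.isIsland_zero
    exact ⟨_, _, _, hw, Or.inl (by
      rw [hw0]; exact (csInf_Icc zero_le_one).symm), rfl⟩
  · rintro r ⟨I, v, hv, -, rfl⟩
    exact hn I v hv

/-- Both indices must be bounded uniformly. The condition on K in `rightIndex` is not transported
between islands; instead the separation of the end pieces from the other constitutive intervals is,
being affine invariant and sufficient for both indices. -/
theorem eta₂_pos (h : S.IsUnitSystem K) (hM : S.IsNestedIndexSets M)
    (hfin : Finite (S.OverlapType M)) (hA : S.AssumptionA M) (hB : S.AssumptionB K) :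
    0 < S.eta₂ M K := by
  have hev : ∀ᶠ n in atTop, ∀ I : Island S M, ∀ v ∈ S.vertices M I.gen I.carrier,
      (v 0 = sInf I.carrier → ∀ u ∈ S.vertices M I.gen I.carrier, u ≠ v →
        v (S.ratio 0 ^ n) < u 0) ∧
      (v 1 = sSup I.carrier → ∀ u ∈ S.vertices M I.gen I.carrier, u ≠ v →
        u 1 < v (1 - S.ratio (Fin.last m) ^ n)) := by
    refine eventually_forall_island hfin ?_ ?_
    · intro I I' hrel n hn v' hv'
      obtain ⟨c, d, hI, hc⟩ := h.mem_islands.1 I.mem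
      obtain ⟨c', d', hI', hc'⟩ := h.mem_islands.1 I'.mem
      obtain ⟨a, b, hτ, hV⟩ := h.exists_affine_of_islandRel hI hI' hc hc' hrel
      have ha := hτ.1
      rw [hV] at hv' ⊢
      obtain ⟨v, hv, rfl⟩ := hv'
      have h1 := hn v hv
      rw [hc, csInf_Icc hI.lt.le, csSup_Icc hI.lt.le, ← hc] at h1
      rw [hc', csInf_Icc hI'.lt.le, csSup_Icc hI'.lt.le]
      constructor
      · rintro he _ ⟨u, hu, rfl⟩ hne
        have h2 : v 0 = c := by
          have := hτ.2.1
          have h3 : a * v 0 = a * c := by linarith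
          exact mul_left_cancel₀ ha.ne' h3
        have h4 := h1.1 h2 u hu fun h5 => hne (by rw [h5])
        simp only
        have := mul_lt_mul_of_pos_left h4 ha
        linarith
      · rintro he _ ⟨u, hu, rfl⟩ hne
        have h2 : v 1 = d := by
          have := hτ.2.2.1
          have h3 : a * v 1 = a * d := by linarith
          exact mul_left_cancel₀ ha.ne' h3
        have h4 := h1.2 h2 u hu fun h5 => hne (by rw [h5])
        simp only
        have := mul_lt_mul_of_pos_left h4 ha
        linarith
    · intro I
      refine (eventually_all_finite (S.vertices_finite M _ _)).2 fun v hv => ?_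
      obtain ⟨c, d, hI, hc⟩ := h.mem_islands.1 I.mem
      have e1 : sInf I.carrier = c := by rw [hc, csInf_Icc hI.lt.le]
      have e2 : sSup I.carrier = d := by rw [hc, csSup_Icc hI.lt.le]
      rw [e1, e2]
      refine Eventually.and ?_ ?_
      · by_cases he : v 0 = c
        · filter_upwards [eventually_left_lt hA I hc hv he] with n hn _ using hn
        · exact Eventually.of_forall fun n h => (he h).elim
      · by_cases he : v 1 = d
        · filter_upwards [eventually_lt_right hA I hc hv he] with n hn _ using hn
        · exact Eventually.of_forall fun n h => (he h).elim
  -- n ≥ 1 is needed because `leftIndex` excludes 0 for islands with several vertices.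
  obtain ⟨n, hn1, hn⟩ := ((eventually_ge_atTop 1).and hev).exists
  refine lt_of_lt_of_le (lt_min (pow_pos (S.ratio_pos 0) n) (pow_pos (S.ratio_pos (Fin.last m)) n))
    (le_csInf ?_ ?_)
  · obtain ⟨w, hw, hw0⟩ := h.exists_left_vertex hM.isIsland_zero
    exact ⟨_, _, _, hw, Or.inl ⟨by
      rw [hw0]; exact (csInf_Icc zero_le_one).symm, rfl⟩⟩
  · rintro r ⟨I, v, hv, ⟨he, rfl⟩ | ⟨he, rfl⟩⟩
    · have h1 := (hn I v hv).1 he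
      obtain ⟨w, -, rfl⟩ := exists_wordMap_of_mem_vertices hv
      exact (min_le_left _ _).trans (pow_le_pow_of_le_one (S.ratio_pos _).le (S.ratio_lt_one _).le
        (h.leftIndex_le he hv hn1 h1))
    · have h1 := (hn I v hv).2 he
      obtain ⟨c, d, hI, hc⟩ := h.mem_islands.1 I.mem
      obtain ⟨w, -, rfl⟩ := exists_wordMap_of_mem_vertices hv
      exact (min_le_right _ _).trans (pow_le_pow_of_le_one (S.ratio_pos _).le (S.ratio_lt_one _).le
        (Nat.sInf_le (h.mem_rightIndex_set hM hB I hI hc hv n h1)))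

theorem eta_pos (h : S.IsUnitSystem K) (hM : S.IsNestedIndexSets M)
    (hfin : Finite (S.OverlapType M)) (hA : S.AssumptionA M) (hB : S.AssumptionB K) :
    0 < S.eta M K := mul_pos (h.eta₁_pos hM hfin) (h.eta₂_pos hM hfin hA hB)

theorem eta_le_one (h : S.IsUnitSystem K) (hM : S.IsNestedIndexSets M)
    (hfin : Finite (S.OverlapType M)) (hA : S.AssumptionA M) (hB : S.AssumptionB K) :
    S.eta M K ≤ 1 := by
  obtain ⟨w, hw, hw0⟩ := h.exists_left_vertex hM.isIsland_zero
  have e : S.wordMap w 0 = sInf (h.toIsland hM.isIsland_zero).carrier := by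
    rw [hw0]; exact (csInf_Icc zero_le_one).symm
  have h1 := eta₁_le hw (Or.inl e)
  have h2 := eta₂_le_left (K := K) hw e
  have e3 : Metric.diam (h.toIsland hM.isIsland_zero).carrier = 1 := by
    change Metric.diam (Icc (0 : ℝ) 1) = 1
    rw [Real.diam_Icc zero_le_one, sub_zero]
  rw [e3, div_one] at h1
  exact mul_le_one₀ (h1.trans (S.wordRatio_le_one w)) (h.eta₂_pos hM hfin hA hB).le
    (h2.trans (pow_le_one₀ (S.ratio_pos _).le (S.ratio_lt_one _).le))

theorem distFun_isIslandMap (h : S.IsUnitSystem K) (hM : S.IsNestedIndexSets M)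
    (hK : IsRegular K) {k k' : ℕ} {c d c' d' s t : ℝ} (hI : S.IsIsland M k c d)
    (hI' : S.IsIsland M k' c' d') (hτ : S.IsIslandMap M k c d k' c' d' s t) {a b : ℝ}
    (hca : c ≤ a) (hab : a ≤ b) (hbd : b ≤ d) :
    distFun K (s * b + t) - distFun K (s * a + t) =
      s ^ dimension K * (distFun K b - distFun K a) :=
  hK.distFun_image_eq hτ.1 hab fun _ hx => h.mem_iff_of_isIslandMap hM hI hI' hτ
    ⟨hca.trans hx.1, hx.2.trans hbd⟩

/-! ### Long intervals and a maximal one -/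

/-- Every interval of positive measure is at most as dense as one of length at least
`η β_min^(k₀ + 1) ρ_1 ^ n₁`. -/
theorem exists_long_interval (h : S.IsUnitSystem K) (hM : S.IsNestedIndexSets M)
    (hfin : Finite (S.OverlapType M)) (hdim : dimension K < 1) (hA : S.AssumptionA M)
    (hB : S.AssumptionB K) {n₁ nₘ : ℕ} (hn₁ : 0 < n₁)
    (hρ : S.ratio 0 ^ n₁ = S.ratio (Fin.last m) ^ nₘ) {a b : ℝ} (ha : 0 ≤ a) (hb : b ≤ 1)
    (hlt : distFun K a < distFun K b) :
    ∃ a' b', 0 ≤ a' ∧ b' ≤ 1 ∧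
      S.eta M K * S.betaMin M (S.k₀ M + 1) * S.ratio 0 ^ n₁ ≤ b' - a' ∧
      (distFun K b - distFun K a) / (b - a) ^ dimension K ≤
        (distFun K b' - distFun K a') / (b' - a') ^ dimension K := by
  have hK := h.isRegular hM hfin hdim
  set β := S.betaMin M (S.k₀ M + 1) with hβdef
  have hβ : 0 < β := h.betaMin_pos hM _
  have hη := h.eta_pos hM hfin hA hB
  have hη1 := h.eta_le_one hM hfin hA hB
  set r := S.ratio 0 ^ n₁ with hr
  have hr0 : 0 < r := pow_pos (S.ratio_pos 0) _
  have hr1 : r < 1 := pow_lt_one₀ (S.ratio_pos 0).le (S.ratio_lt_one 0) hn₁.ne'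
  obtain ⟨a₁, b₁, g1, g2, g3, g4, g5, htl, htr⟩ :=
    hK.distFun_mono.exists_trim hK.continuous_distFun hlt
  have hdens : (distFun K b - distFun K a) / (b - a) ^ dimension K ≤
      (distFun K b₁ - distFun K a₁) / (b₁ - a₁) ^ dimension K := by
    rw [g4, g5]
    exact div_le_div_of_nonneg_left (sub_nonneg.2 hlt.le)
      (Real.rpow_pos_of_pos (sub_pos.2 g3) _)
      (Real.rpow_le_rpow (sub_pos.2 g3).le (by linarith) hK.dimension_pos.le)
  obtain ⟨g, c, d, hI, hca, hbd, hcases⟩ := h.exists_island_contains_or_straddles hM hdim hK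
    (ha.trans g1) g3 (g2.trans hb) htl htr
  -- In generation k' ≤ k₀ the children have length at least β, and densities are preserved by the
  -- map.
  obtain ⟨k', hk', c', d', s, t, hI', hτ⟩ := h.exists_isIslandMap hM hfin g hI
  have hs := hτ.1
  have hbounds := h.island_bounds hI'
  have hmap : ∀ {x y}, x ≤ y → s * x + t ≤ s * y + t := fun hxy => by nlinarith
  have hmap' : ∀ {x y}, x < y → s * x + t < s * y + t := fun hxy => by nlinarith
  have hτa : c' ≤ s * a₁ + t := hτ.2.1 ▸ hmap hca
  have hτb : s * b₁ + t ≤ d' := hτ.2.2.1 ▸ hmap hbd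
  have hdens' : (distFun K b₁ - distFun K a₁) / (b₁ - a₁) ^ dimension K =
      (distFun K (s * b₁ + t) - distFun K (s * a₁ + t)) /
        (s * b₁ + t - (s * a₁ + t)) ^ dimension K := by
    have e : s * b₁ + t - (s * a₁ + t) = s * (b₁ - a₁) := by ring
    rw [h.distFun_isIslandMap hM hK hI hI' hτ hca g3.le hbd, e,
      Real.mul_rpow hs.le (sub_pos.2 g3).le,
      mul_div_mul_left _ _ (Real.rpow_pos_of_pos hs _).ne']
  have hβle : ∀ {x y}, S.IsIsland M (k' + 1) x y → β ≤ y - x := fun hJ =>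
    (h.betaMin_antitone hM (by omega : k' + 1 ≤ S.k₀ M + 1)).trans (h.betaMin_le_length hJ)
  rcases hcases with ⟨u, v, h1, h2, h3, h4, h5⟩ | ⟨c₁, d₁, c₂, d₂, h1, h2, h3, h4, h5, h6, h7, h8, h9, h10⟩
  · obtain ⟨hJ, -, -, -⟩ := hτ.child h1 h2 h3
    refine ⟨s * a₁ + t, s * b₁ + t, hbounds.1.trans hτa, hτb.trans hbounds.2, ?_,
      hdens.trans hdens'.le⟩
    have e1 := hβle hJ
    have e2 := hmap h4
    have e3 := hmap h5
    have e4 : S.eta M K * β * r ≤ 1 * β * 1 := by gcongr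
    linarith
  · obtain ⟨hJ₁, hJc₁, -, -⟩ := hτ.child h1 h3 (by linarith)
    obtain ⟨hJ₂, -, hJd₂, -⟩ := hτ.child h2 (by linarith) h4
    obtain ⟨w₁, hw₁, hw₁e⟩ := h.exists_right_vertex hJ₁
    obtain ⟨w₂, hw₂, hw₂e⟩ := h.exists_left_vertex hJ₂
    set I₁ := h.toIsland hJ₁ with hI₁def
    set I₂ := h.toIsland hJ₂ with hI₂def
    set s₁ := S.wordRatio w₁ * S.ratio (Fin.last m) ^ S.rightIndex K (S.wordMap w₁) with hs₁
    set s₂ := S.wordRatio w₂ * S.ratio 0 ^ S.leftIndex M I₂ (S.wordMap w₂) with hs₂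
    have hs₁0 : 0 < s₁ := mul_pos (S.wordRatio_pos _) (pow_pos (S.ratio_pos _) _)
    have hs₂0 : 0 < s₂ := mul_pos (S.wordRatio_pos _) (pow_pos (S.ratio_pos _) _)
    have hη₁ := h.eta₁_pos hM hfin
    have hη₂ := h.eta₂_pos hM hfin hA hB
    have hs₁η : S.eta M K * β ≤ s₁ := by
      have e0 : S.wordMap w₁ 1 = sSup I₁.carrier := by
        rw [hw₁e]; exact (csSup_Icc hJ₁.lt.le).symm
      have e1 := eta₁_le hw₁ (Or.inr e0)
      have e2 := eta₂_le_right (K := K) hw₁ e0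
      have e3 : Metric.diam I₁.carrier = s * d₁ + t - (s * c₁ + t) := Real.diam_Icc hJ₁.lt.le
      rw [e3, le_div_iff₀ (sub_pos.2 hJ₁.lt)] at e1
      have e4 : S.eta₁ M * β ≤ S.wordRatio w₁ :=
        (mul_le_mul_of_nonneg_left (hβle hJ₁) hη₁.le).trans e1
      calc S.eta M K * β = (S.eta₁ M * β) * S.eta₂ M K := by rw [eta]; ring
        _ ≤ s₁ := mul_le_mul e4 e2 hη₂.le (S.wordRatio_pos _).le
    have hs₂η : S.eta M K * β ≤ s₂ := by
      have e0 : S.wordMap w₂ 0 = sInf I₂.carrier := by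
        rw [hw₂e]; exact (csInf_Icc hJ₂.lt.le).symm
      have e1 := eta₁_le hw₂ (Or.inl e0)
      have e2 := eta₂_le_left (K := K) hw₂ e0
      have e3 : Metric.diam I₂.carrier = s * d₂ + t - (s * c₂ + t) := Real.diam_Icc hJ₂.lt.le
      rw [e3, le_div_iff₀ (sub_pos.2 hJ₂.lt)] at e1
      have e4 : S.eta₁ M * β ≤ S.wordRatio w₂ :=
        (mul_le_mul_of_nonneg_left (hβle hJ₂) hη₁.le).trans e1
      calc S.eta M K * β = (S.eta₁ M * β) * S.eta₂ M K := by rw [eta]; ring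
        _ ≤ s₂ := mul_le_mul e4 e2 hη₂.le (S.wordRatio_pos _).le
    have hgap : distFun K (s * d₁ + t) = distFun K (s * c₂ + t) := by
      have := h.distFun_isIslandMap hM hK hI hI' hτ (hca.trans h6.le) h7 (h8.le.trans hbd)
      rw [h10, sub_self, mul_zero] at this
      linarith
    -- The common ratio r is nₘ steps of S_m at the right end of the left child and n₁ steps of S_1
    -- at the left end of the right child.
    obtain ⟨a', b', f1, f2, f3, f4⟩ := exists_enlarged_interval hK.distFun_mono hK.dimension_pos
      hr0 hr1 hs₁0 hs₂0 (hmap' h6) (hmap h7) (hmap' h8) hgap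
      (fun n x hx0 hx1 => by
        rw [hρ, ← pow_mul]
        exact h.distFun_right_similar hM hK hA hB I₁ hJ₁ rfl hw₁ hw₁e (nₘ * n) hx0 hx1)
      (fun n x hx0 hx1 => by
        rw [hr, ← pow_mul]
        exact h.distFun_left_similar hM hK hA hB I₂ hJ₂ rfl hw₂ hw₂e (n₁ * n) hx0 hx1)
    -- Overhangs up to s₁ and s₂ stay inside the extreme constitutive intervals, so the enlarged
    -- interval remains in [0, 1].
    have hs₁le : s₁ ≤ S.wordRatio w₁ := mul_le_of_le_one_right (S.wordRatio_pos _).le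
      (pow_le_one₀ (S.ratio_pos _).le (S.ratio_lt_one _).le)
    have hs₂le : s₂ ≤ S.wordRatio w₂ := mul_le_of_le_one_right (S.wordRatio_pos _).le
      (pow_le_one₀ (S.ratio_pos _).le (S.ratio_lt_one _).le)
    refine ⟨a', b', le_trans (le_min ?_ ?_) f1, f2.trans (max_le ?_ ?_), ?_,
      hdens.trans (hdens'.le.trans f4)⟩
    · exact hbounds.1.trans hτa
    · have e := (h.wordMap_mem_Icc w₁ (left_mem_Icc.2 zero_le_one)).1
      rw [wordRatio, hw₁e] at hs₁le
      linarith
    · exact hτb.trans hbounds.2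
    · have e := (h.wordMap_mem_Icc w₂ (right_mem_Icc.2 zero_le_one)).2
      rw [wordRatio, hw₂e] at hs₂le
      linarith
    · exact (mul_le_mul_of_nonneg_right (le_min hs₁η hs₂η) hr0.le).trans f3

/-- The maximal density is attained for a long interval. -/
theorem exists_maximal_interval (h : S.IsUnitSystem K) (hM : S.IsNestedIndexSets M)
    (hfin : Finite (S.OverlapType M)) (hdim : dimension K < 1) (hA : S.AssumptionA M)
    (hB : S.AssumptionB K) {n₁ nₘ : ℕ} (hn₁ : 0 < n₁)
    (hρ : S.ratio 0 ^ n₁ = S.ratio (Fin.last m) ^ nₘ) :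
    ∃ a b, 0 ≤ a ∧ a < b ∧ b ≤ 1 ∧
      S.eta M K * S.betaMin M (S.k₀ M + 1) * S.ratio 0 ^ n₁ ≤ b - a ∧
      IsGreatest (intervalDensities K) (density K (Icc a b)) := by
  have hK := h.isRegular hM hfin hdim
  have hη := h.eta_pos hM hfin hA hB
  have hη1 := h.eta_le_one hM hfin hA hB
  have hβ := h.betaMin_pos hM (S.k₀ M + 1)
  have hβ1 := h.betaMin_le_one hM (S.k₀ M + 1)
  have hr0 : 0 < S.ratio 0 ^ n₁ := pow_pos (S.ratio_pos 0) _
  have hr1 : S.ratio 0 ^ n₁ ≤ 1 := pow_le_one₀ (S.ratio_pos 0).le (S.ratio_lt_one 0).le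
  set δ := S.eta M K * S.betaMin M (S.k₀ M + 1) * S.ratio 0 ^ n₁ with hδ
  have hδ0 : 0 < δ := by positivity
  have hδ1 : δ ≤ 1 := mul_le_one₀ (mul_le_one₀ hη1 hβ.le hβ1) hr0.le hr1
  -- Keeping the length at least δ makes the set compact and the density continuous on it; every
  -- other interval is dominated by one from this set.
  let D : Set (ℝ × ℝ) := {p | p ∈ Icc (0 : ℝ) 1 ×ˢ Icc (0 : ℝ) 1 ∧ δ ≤ p.2 - p.1}
  have hD : IsCompact D := (isCompact_Icc.prod isCompact_Icc).inter_right
    (isClosed_le continuous_const (continuous_snd.sub continuous_fst))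
  have hDne : D.Nonempty := ⟨(0, 1), by simp [D, hδ1]⟩
  let f : ℝ × ℝ → ℝ := fun p => (distFun K p.2 - distFun K p.1) / (p.2 - p.1) ^ dimension K
  have hf : ContinuousOn f D := by
    have hc := hK.continuous_distFun
    refine ContinuousOn.div (by fun_prop) ?_ ?_
    · exact ContinuousOn.rpow_const (by fun_prop) fun p _ => Or.inr hK.dimension_pos.le
    · exact fun p hp => (Real.rpow_pos_of_pos (hδ0.trans_le hp.2) _).ne'
  obtain ⟨⟨a, b⟩, ⟨⟨⟨ha0, ha1⟩, hb0, hb1⟩, hab⟩, hmax⟩ := hD.exists_isMaxOn hDne hf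
  simp only at ha0 ha1 hb0 hb1 hab
  have hlt : a < b := by linarith
  refine ⟨a, b, ha0, hlt, hb1, hab, ⟨Icc a b, Icc_subset_Icc ha0 hb1, ordConnected_Icc, ?_, rfl⟩, ?_⟩
  · rw [Real.diam_Icc hlt.le]; linarith
  rintro _ ⟨J, hJ, -, hJd, rfl⟩
  have hJb : Bornology.IsBounded J := Metric.isBounded_Icc 0 1 |>.subset hJ
  have hJne : J.Nonempty := by
    by_contra hcon
    rw [not_nonempty_iff_eq_empty] at hcon
    simp [hcon] at hJd
  set u := sInf J with hu
  set v := sSup J with hv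
  have hdiam : Metric.diam J = v - u := Real.diam_eq hJb
  have huv : u < v := by linarith
  have hsub : J ⊆ Icc u v := fun x hx => ⟨csInf_le hJb.bddBelow hx, le_csSup hJb.bddAbove hx⟩
  have hu0 : 0 ≤ u := le_csInf hJne fun x hx => (hJ hx).1
  have hv1 : v ≤ 1 := csSup_le hJne fun x hx => (hJ hx).2
  rw [hK.density_Icc hlt.le]
  have hprob := hK.isProbabilityMeasure
  have h1 : density K J ≤ (distFun K v - distFun K u) / (v - u) ^ dimension K := by
    rw [density, hdiam, ← hK.measureReal_Icc huv.le]
    exact div_le_div_of_nonneg_right (measureReal_mono hsub)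
      (Real.rpow_nonneg (sub_pos.2 huv).le _)
  refine h1.trans ?_
  rcases (hK.distFun_mono huv.le).eq_or_lt with he | hlt'
  · rw [he, sub_self, zero_div]
    exact div_nonneg (sub_nonneg.2 (hK.distFun_mono hlt.le)) (Real.rpow_nonneg (sub_pos.2 hlt).le _)
  · obtain ⟨a', b', f1, f2, f3, f4⟩ :=
      h.exists_long_interval hM hfin hdim hA hB hn₁ hρ hu0 hv1 hlt'
    refine f4.trans ?_
    have : a' < b' := by linarith
    exact hmax (a := (a', b')) ⟨⟨⟨f1, by linarith⟩, by simp only; linarith, f2⟩, f3⟩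

end IsUnitSystem

end LinearIFS

/-! ### Ends of a maximal interval -/

/-- If lengthening an interval of length `L` and mass at most `1` by `x` does not increase its
density, then the mass gained is less than `x / L`. -/
theorem gain_lt_of_density_le {α L x mass gain : ℝ} (hα0 : 0 < α) (hα1 : α < 1) (hL : 0 < L)
    (hx : 0 < x) (hmass0 : 0 < mass) (hmass1 : mass ≤ 1)
    (hle : (mass + gain) / (L + x) ^ α ≤ mass / L ^ α) : gain < x / L := by
  have hxL : 0 < x / L := div_pos hx hL
  have e : L + x = L * (1 + x / L) := by field_simp
  have h1 : (1 + x / L) ^ α < 1 + x / L := by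
    simpa using Real.rpow_lt_rpow_of_exponent_lt (by linarith : 1 < 1 + x / L) hα1
  have hLα := Real.rpow_pos_of_pos hL α
  have hxα := Real.rpow_pos_of_pos (by linarith : 0 < 1 + x / L) α
  rw [e, Real.mul_rpow hL.le (by linarith), div_le_div_iff₀ (by positivity) hLα] at hle
  have h2 : mass + gain ≤ mass * (1 + x / L) ^ α := by
    by_contra! hcon
    nlinarith [mul_lt_mul_of_pos_right hcon hLα]
  nlinarith

/-- D x^α ≤ gain < x/L gives x^(1-α) > D L ≥ D' δ, whereas x ≤ B gives x^(1-α) ≤ δ D'. The factor 2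
in the bound for B is slack. -/
theorem false_of_small_extension {α L x D D' δ B mass gain : ℝ} (hα0 : 0 < α) (hα1 : α < 1)
    (hx : 0 < x) (hmass0 : 0 < mass) (hmass1 : mass ≤ 1)
    (hle : (mass + gain) / (L + x) ^ α ≤ mass / L ^ α) (hgain : D * x ^ α ≤ gain)
    (hδ : 0 < δ) (hδL : δ ≤ L) (hD' : 0 < D') (hDD' : D' ≤ D) (hxB : x ≤ B)
    (hB : 2 * B ≤ (δ * D') ^ (1 / (1 - α))) : False := by
  have hL : 0 < L := hδ.trans_le hδL
  have h1 := hgain.trans_lt (gain_lt_of_density_le hα0 hα1 hL hx hmass0 hmass1 hle)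
  have hxα := Real.rpow_pos_of_pos hx α
  have h2 : x = x ^ α * x ^ (1 - α) := by
    rw [← Real.rpow_add hx, add_sub_cancel, Real.rpow_one]
  have h3 : D * L < x ^ (1 - α) := by
    rw [lt_div_iff₀ hL] at h1
    by_contra! hcon
    have := mul_le_mul_of_nonneg_left hcon hxα.le
    rw [← h2] at this
    nlinarith
  have h4 : x ^ (1 - α) ≤ δ * D' := by
    have h5 : x ≤ (δ * D') ^ (1 / (1 - α)) := by linarith
    have h6 := Real.rpow_le_rpow hx.le h5 (by linarith : 0 ≤ 1 - α)
    rwa [← Real.rpow_mul (by positivity), one_div_mul_cancel (by linarith), Real.rpow_one] at h6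
  nlinarith [mul_le_mul hδL hDD' hD'.le hL.le]

namespace LinearIFS.IsUnitSystem

variable {m : ℕ} {S : LinearIFS (m + 1)} {K : Set ℝ} {M : ℕ → Finset (List (Fin (m + 1)))}

theorem density_nonneg (K J : Set ℝ) : 0 ≤ density K J :=
  div_nonneg measureReal_nonneg (Real.rpow_nonneg Metric.diam_nonneg _)

/-- If ρ_1^(n+1) < x ≤ ρ_1^n, then [0, x] contains S_1^(n+1)(K), of measure at least ρ_1^((n+1)α) ≥
(ρ_1 x)^α; so ρ_1^α is a lower bound. -/
theorem lowerDensityLeft_pos (h : S.IsUnitSystem K) (hK : IsRegular K) :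
    0 < lowerDensityLeft K := by
  have hρ := S.ratio_pos 0
  refine (Real.rpow_pos_of_pos hρ (dimension K)).trans_le
    (le_csInf ((nonempty_Ioc.2 one_pos).image _) ?_)
  rintro _ ⟨x, ⟨hx0, hx1⟩, rfl⟩
  obtain ⟨n, hn1, hn2⟩ := exists_nat_pow_near_of_lt_one hx0 hx1 hρ (S.ratio_lt_one 0)
  have h1 := h.distFun_wordMap_ge hK (List.replicate (n + 1) 0) zero_le_one
  rw [wordMap_replicate, h.iterate_map_zero, h.iterate_map_zero, wordRatio_replicate,
    h.distFun_one_sub_zero hK, mul_one, mul_one, mul_zero] at h1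
  have h2 := hK.distFun_mono hn1.le
  simp only
  rw [hK.density_Icc hx0.le, sub_zero, le_div_iff₀ (Real.rpow_pos_of_pos hx0 _)]
  calc S.ratio 0 ^ dimension K * x ^ dimension K
      ≤ S.ratio 0 ^ dimension K * (S.ratio 0 ^ n) ^ dimension K := by
        gcongr; exact hK.dimension_pos.le
    _ = (S.ratio 0 ^ (n + 1)) ^ dimension K := by
        rw [← Real.mul_rpow hρ.le (pow_pos hρ n).le, ← pow_succ']
    _ ≤ _ := by linarith

theorem lowerDensityRight_pos (h : S.IsUnitSystem K) (hK : IsRegular K) :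
    0 < lowerDensityRight K := by
  have hρ := S.ratio_pos (Fin.last m)
  refine (Real.rpow_pos_of_pos hρ (dimension K)).trans_le
    (le_csInf ((nonempty_Ioc.2 one_pos).image _) ?_)
  rintro _ ⟨x, ⟨hx0, hx1⟩, rfl⟩
  obtain ⟨n, hn1, hn2⟩ := exists_nat_pow_near_of_lt_one hx0 hx1 hρ (S.ratio_lt_one _)
  have h1 := h.distFun_wordMap_ge hK (List.replicate (n + 1) (Fin.last m)) zero_le_one
  rw [wordMap_replicate, h.iterate_map_last, h.iterate_map_last, wordRatio_replicate,
    h.distFun_one_sub_zero hK, mul_one, sub_self, mul_zero, sub_zero, mul_one] at h1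
  have h2 := hK.distFun_mono (by linarith : 1 - x ≤ 1 - S.ratio (Fin.last m) ^ (n + 1))
  simp only
  rw [hK.density_Icc (by linarith), sub_sub_cancel, le_div_iff₀ (Real.rpow_pos_of_pos hx0 _)]
  calc S.ratio (Fin.last m) ^ dimension K * x ^ dimension K
      ≤ S.ratio (Fin.last m) ^ dimension K * (S.ratio (Fin.last m) ^ n) ^ dimension K := by
        gcongr; exact hK.dimension_pos.le
    _ = (S.ratio (Fin.last m) ^ (n + 1)) ^ dimension K := by
        rw [← Real.mul_rpow hρ.le (pow_pos hρ n).le, ← pow_succ']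
    _ ≤ _ := by linarith

theorem lowerDensityLeft_mul_le (hK : IsRegular K) {x : ℝ} (hx0 : 0 < x) (hx1 : x ≤ 1) :
    lowerDensityLeft K * x ^ dimension K ≤ distFun K x - distFun K 0 := by
  have h1 : lowerDensityLeft K ≤ density K (Icc 0 x) :=
    csInf_le ⟨0, by rintro _ ⟨y, -, rfl⟩; exact density_nonneg _ _⟩ ⟨x, ⟨hx0, hx1⟩, rfl⟩
  rwa [hK.density_Icc hx0.le, sub_zero, le_div_iff₀ (Real.rpow_pos_of_pos hx0 _)] at h1

theorem lowerDensityRight_mul_le (hK : IsRegular K) {x : ℝ} (hx0 : 0 < x) (hx1 : x ≤ 1) :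
    lowerDensityRight K * x ^ dimension K ≤ distFun K 1 - distFun K (1 - x) := by
  have h1 : lowerDensityRight K ≤ density K (Icc (1 - x) 1) :=
    csInf_le ⟨0, by rintro _ ⟨y, -, rfl⟩; exact density_nonneg _ _⟩ ⟨x, ⟨hx0, hx1⟩, rfl⟩
  rwa [hK.density_Icc (by linarith), sub_sub_cancel,
    le_div_iff₀ (Real.rpow_pos_of_pos hx0 _)] at h1

/-- S_w(K) is part of K, so the lower bound at 0 carries over to S_w(0) even where other copies
overlap. -/
theorem lowerDensityLeft_mul_le_wordMap (h : S.IsUnitSystem K) (hK : IsRegular K)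
    (w : List (Fin (m + 1))) {a : ℝ} (ha : a ∈ Ioo (S.wordMap w 0) (S.wordMap w 1)) :
    lowerDensityLeft K * (a - S.wordMap w 0) ^ dimension K ≤
      distFun K a - distFun K (S.wordMap w 0) := by
  have hw := S.wordRatio_pos w
  set y := (a - S.wordMap w 0) / S.wordRatio w with hy
  have hay : S.wordRatio w * y = a - S.wordMap w 0 := mul_div_cancel₀ _ hw.ne'
  have hy0 : 0 < y := div_pos (sub_pos.2 ha.1) hw
  have hy1 : y ≤ 1 := by
    rw [hy, div_le_one hw, wordRatio]; linarith [ha.2]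
  have h1 := h.distFun_wordMap_ge hK w hy0.le
  rw [S.wordMap_eq w y, hay, sub_add_cancel] at h1
  rw [← hay, Real.mul_rpow hw.le hy0.le]
  have h2 := mul_le_mul_of_nonneg_left (lowerDensityLeft_mul_le hK hy0 hy1)
    (Real.rpow_nonneg hw.le (dimension K))
  linarith

theorem lowerDensityRight_mul_le_wordMap (h : S.IsUnitSystem K) (hK : IsRegular K)
    (w : List (Fin (m + 1))) {b : ℝ} (hb : b ∈ Ioo (S.wordMap w 0) (S.wordMap w 1)) :
    lowerDensityRight K * (S.wordMap w 1 - b) ^ dimension K ≤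
      distFun K (S.wordMap w 1) - distFun K b := by
  have hw := S.wordRatio_pos w
  set y := (S.wordMap w 1 - b) / S.wordRatio w with hy
  have hay : S.wordRatio w * y = S.wordMap w 1 - b := mul_div_cancel₀ _ hw.ne'
  have hy0 : 0 < y := div_pos (sub_pos.2 hb.2) hw
  have hy1 : y ≤ 1 := by
    rw [hy, div_le_one hw, wordRatio]; linarith [hb.1]
  have h1 := h.distFun_wordMap_ge hK w (by linarith : 1 - y ≤ 1)
  have e : S.wordMap w (1 - y) = b := by
    have : S.wordMap w 1 - S.wordMap w (1 - y) = S.wordRatio w * y := by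
      rw [S.wordMap_eq w 1, S.wordMap_eq w (1 - y)]; ring
    linarith
  rw [e] at h1
  rw [← hay, Real.mul_rpow hw.le hy0.le]
  have h2 := mul_le_mul_of_nonneg_left (lowerDensityRight_mul_le hK hy0 hy1)
    (Real.rpow_nonneg hw.le (dimension K))
  linarith

theorem wordRatio_le_betaMax (h : S.IsUnitSystem K) {k : ℕ} {w : List (Fin (m + 1))}
    (hw : w ∈ M k) : S.wordRatio w ≤ S.betaMax M k := by
  obtain ⟨c, d, hI, h1, h2⟩ := h.exists_island_of_word hw
  have := h.length_le_betaMax hI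
  rw [wordRatio]; linarith

/-- There are points of K arbitrarily close to a on its right; choose one before every island left
end beyond a, of which there are finitely many. Its island starts at a or earlier, and if earlier,
it would have a in its interior and hence in U_k. -/
theorem exists_island_left_eq (h : S.IsUnitSystem K) (hM : S.IsNestedIndexSets M)
    (hK : IsRegular K) {k : ℕ} {a : ℝ} (ha : a ∉ S.openUnion M k)
    (htl : ∀ x, a < x → distFun K a < distFun K x) : ∃ d, S.IsIsland M k a d := by
  by_contra! hcon
  have hev : ∀ᶠ e in 𝓝[>] a, ∀ p ∈ {p : ℝ × ℝ | S.IsIsland M k p.1 p.2}, a < p.1 → e < p.1 := by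
    refine (eventually_all_finite (IsIsland.finite S M k)).2 fun p _ => ?_
    by_cases hp : a < p.1
    · exact ((gt_mem_nhds hp).filter_mono nhdsWithin_le_nhds).mono fun e he _ => he
    · exact Eventually.of_forall fun e he => (hp he).elim
  obtain ⟨e, he, hae⟩ := (hev.and (self_mem_nhdsWithin (s := Ioi a) (a := a))).exists
  obtain ⟨z, hz, hz1, hz2⟩ := hK.exists_mem_of_distFun_lt (htl e hae)
  obtain ⟨c, d, hI, -, -, hzI⟩ :=
    h.exists_island_mem hM (Nat.zero_le k) hM.isIsland_zero hz (h.subset_Icc hz)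
  rcases lt_trichotomy a c with hlt | rfl | hlt
  · exact (he (c, d) hI hlt).not_ge (hzI.1.trans hz2.le)
  · exact hcon d hI
  · exact ha (hI.subset ⟨hlt, hz1.trans_le hzI.2⟩)

theorem exists_island_right_eq (h : S.IsUnitSystem K) (hM : S.IsNestedIndexSets M)
    (hK : IsRegular K) {k : ℕ} {b : ℝ} (hb : b ∉ S.openUnion M k)
    (htr : ∀ x, x < b → distFun K x < distFun K b) : ∃ c, S.IsIsland M k c b := by
  by_contra! hcon
  have hev : ∀ᶠ e in 𝓝[<] b, ∀ p ∈ {p : ℝ × ℝ | S.IsIsland M k p.1 p.2}, p.2 < b → p.2 < e := by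
    refine (eventually_all_finite (IsIsland.finite S M k)).2 fun p _ => ?_
    by_cases hp : p.2 < b
    · exact ((lt_mem_nhds hp).filter_mono nhdsWithin_le_nhds).mono fun e he _ => he
    · exact Eventually.of_forall fun e he => (hp he).elim
  obtain ⟨e, he, hae⟩ := (hev.and (self_mem_nhdsWithin (s := Iio b) (a := b))).exists
  obtain ⟨z, hz, hz1, hz2⟩ := hK.exists_mem_of_distFun_lt (htr e hae)
  obtain ⟨c, d, hI, -, -, hzI⟩ :=
    h.exists_island_mem hM (Nat.zero_le k) hM.isIsland_zero hz (h.subset_Icc hz)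
  rcases lt_trichotomy d b with hlt | rfl | hlt
  · exact (he (c, d) hI hlt).not_ge (hz1.le.trans hzI.2)
  · exact hcon c hI
  · exact hb (hI.subset ⟨hzI.1.trans_lt hz2, hlt⟩)

/-- An interval of maximal density is trimmed. -/
theorem trimmed_of_isGreatest (hK : IsRegular K) {a b : ℝ} (ha : 0 ≤ a)
    (hab : a < b) (hb : b ≤ 1) (hpos : distFun K a < distFun K b)
    (hmax : ∀ x y, 0 ≤ x → x < y → y ≤ 1 →
      (distFun K y - distFun K x) / (y - x) ^ dimension K ≤
        (distFun K b - distFun K a) / (b - a) ^ dimension K) :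
    (∀ x, a < x → distFun K a < distFun K x) ∧ ∀ x, x < b → distFun K x < distFun K b := by
  have hmono := hK.distFun_mono
  obtain ⟨a', b', h1, h2, h3, h4, h5, h6, h7⟩ := hmono.exists_trim hK.continuous_distFun hpos
  have h8 := hmax a' b' (ha.trans h1) h3 (h2.trans hb)
  rw [h4, h5, div_le_div_iff_of_pos_left (sub_pos.2 hpos) (Real.rpow_pos_of_pos (sub_pos.2 h3) _)
    (Real.rpow_pos_of_pos (sub_pos.2 hab) _),
    Real.rpow_le_rpow_iff (sub_pos.2 hab).le (sub_pos.2 h3).le hK.dimension_pos] at h8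
  obtain rfl : a' = a := by linarith
  obtain rfl : b' = b := by linarith
  exact ⟨h6, h7⟩

theorem exists_betaMax_le (h : S.IsUnitSystem K) (hM : S.IsNestedIndexSets M)
    (hdim : dimension K < 1) {R : ℝ} (hR : 0 < R) : ∃ k, 2 * S.betaMax M k ≤ R := by
  obtain ⟨N, hN⟩ := h.exists_island_length_lt hM hdim (half_pos hR)
  obtain ⟨c, d, hI, he⟩ := h.exists_betaMax_eq hM N
  exact ⟨N, by rw [he]; linarith [hN N le_rfl c d hI]⟩

end LinearIFS.IsUnitSystem

/-- The IFS has `m + 1 ≥ 2` maps, numbered from `0` to `m`; so `S_1` is `S.map 0` and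
`S_m` is `S.map (Fin.last m)`. -/
theorem theorem4p9 {m : ℕ} (hm : 1 ≤ m) (S : LinearIFS (m + 1))
    (M : ℕ → Finset (List (Fin (m + 1)))) (K : Set ℝ)
    (hK : S.IsAttractor K)
    (hleft : S.map 0 0 = 0) (hright : S.map (Fin.last m) 1 = 1)
    (hM : S.GFTC M)
    (hdim : LinearIFS.dimension K < 1)
    (hirr : (S.weightedIncidence M (LinearIFS.dimension K)).IsIrreducible)
    (hA : S.AssumptionA M) (hB : S.AssumptionB K)
    (n₁ nₘ : ℕ) (hn₁ : 0 < n₁) (hnₘ : 0 < nₘ)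
    (hρ : S.ratio 0 ^ n₁ = S.ratio (Fin.last m) ^ nₘ) :
    ∃ k : ℕ,
      IsLeast {k : ℕ | 2 * S.betaMax M k ≤
        (S.eta M K * S.betaMin M (S.k₀ M + 1) * S.ratio 0 ^ n₁ *
          min (LinearIFS.lowerDensityLeft K) (LinearIFS.lowerDensityRight K)) ^
            (1 / (1 - LinearIFS.dimension K))} k ∧
      ∃ J : Set ℝ, S.IsFieldInterval M k J ∧
        IsGreatest (LinearIFS.intervalDensities K) (LinearIFS.density K J) := by
  obtain ⟨hinv, hN, hfin⟩ := hM
  have h : S.IsUnitSystem K := ⟨hm, hK, hleft, hright, hinv⟩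
  have hreg := h.isRegular hN hfin hdim
  have hη := h.eta_pos hN hfin hA hB
  have hβ := h.betaMin_pos hN (S.k₀ M + 1)
  have hr0 : 0 < S.ratio 0 ^ n₁ := pow_pos (S.ratio_pos 0) _
  have hD : 0 < min (LinearIFS.lowerDensityLeft K) (LinearIFS.lowerDensityRight K) :=
    lt_min (h.lowerDensityLeft_pos hreg) (h.lowerDensityRight_pos hreg)
  obtain ⟨a, b, ha, hab, hb, hlen, hgreat⟩ :=
    h.exists_maximal_interval hN hfin hdim hA hB hn₁ hρ
  set δ := S.eta M K * S.betaMin M (S.k₀ M + 1) * S.ratio 0 ^ n₁ with hδ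
  set D := min (LinearIFS.lowerDensityLeft K) (LinearIFS.lowerDensityRight K) with hDdef
  have hδ0 : 0 < δ := by positivity
  have hex := h.exists_betaMax_le hN hdim (R := (δ * D) ^ (1 / (1 - LinearIFS.dimension K)))
    (by positivity)
  classical
  refine ⟨Nat.find hex, ⟨Nat.find_spec hex, fun j hj => Nat.find_min' hex hj⟩, Icc a b, ?_, hgreat⟩
  have hk := Nat.find_spec hex
  set k := Nat.find hex
  have hα := hreg.dimension_pos
  have hmono := hreg.distFun_mono
  have hmax : ∀ x y, 0 ≤ x → x < y → y ≤ 1 →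
      (LinearIFS.distFun K y - LinearIFS.distFun K x) / (y - x) ^ LinearIFS.dimension K ≤
        (LinearIFS.distFun K b - LinearIFS.distFun K a) / (b - a) ^ LinearIFS.dimension K := by
    intro x y hx hxy hy
    rw [← hreg.density_Icc hxy.le, ← hreg.density_Icc hab.le]
    refine hgreat.2 ⟨Icc x y, Icc_subset_Icc hx hy, ordConnected_Icc, ?_, rfl⟩
    rw [Real.diam_Icc hxy.le]; linarith
  have htot := h.distFun_one_sub_zero hreg
  have hpos : LinearIFS.distFun K a < LinearIFS.distFun K b := by
    have h1 := hmax 0 1 le_rfl one_pos le_rfl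
    rw [htot, sub_zero, Real.one_rpow, div_one] at h1
    refine lt_of_le_of_ne (hmono hab.le) fun he => ?_
    rw [he, sub_self, zero_div] at h1
    linarith
  have hmass1 : LinearIFS.distFun K b - LinearIFS.distFun K a ≤ 1 := by
    linarith [hmono ha, hmono hb]
  obtain ⟨htl, htr⟩ := LinearIFS.IsUnitSystem.trimmed_of_isGreatest hreg ha hab hb hpos hmax
  -- Otherwise extend [a, b] to the left end of a constitutive interval around a; this adds at most
  -- β_max^(k) to the length.
  have haU : a ∉ S.openUnion M k := by
    intro haU
    obtain ⟨w, hw, haw⟩ := LinearIFS.mem_openUnion.1 haU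
    have hle := hmax (S.wordMap w 0) b (h.wordMap_mem_Icc w (left_mem_Icc.2 zero_le_one)).1
      (haw.1.trans hab) hb
    refine false_of_small_extension (L := b - a) (x := a - S.wordMap w 0)
      (gain := LinearIFS.distFun K a - LinearIFS.distFun K (S.wordMap w 0)) hα hdim
      (sub_pos.2 haw.1) (sub_pos.2 hpos) hmass1 ?_
      (h.lowerDensityLeft_mul_le_wordMap hreg w haw) hδ0 hlen hD (min_le_left _ _) ?_ hk
    · convert hle using 2 <;> ring_nf
    · have := h.wordRatio_le_betaMax hw
      rw [LinearIFS.wordRatio] at this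
      linarith [haw.2]
  have hbU : b ∉ S.openUnion M k := by
    intro hbU
    obtain ⟨w, hw, hbw⟩ := LinearIFS.mem_openUnion.1 hbU
    have hle := hmax a (S.wordMap w 1) ha (hab.trans hbw.2)
      (h.wordMap_mem_Icc w (right_mem_Icc.2 zero_le_one)).2
    refine false_of_small_extension (L := b - a) (x := S.wordMap w 1 - b)
      (gain := LinearIFS.distFun K (S.wordMap w 1) - LinearIFS.distFun K b) hα hdim
      (sub_pos.2 hbw.2) (sub_pos.2 hpos) hmass1 ?_
      (h.lowerDensityRight_mul_le_wordMap hreg w hbw) hδ0 hlen hD (min_le_right _ _) ?_ hk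
    · convert hle using 2 <;> ring_nf
    · have := h.wordRatio_le_betaMax hw
      rw [LinearIFS.wordRatio] at this
      linarith [hbw.1]
  obtain ⟨d, hI⟩ := h.exists_island_left_eq hN hreg haU htl
  obtain ⟨c, hI'⟩ := h.exists_island_right_eq hN hreg hbU htr
  have e1 : sInf (Icc a d) = a := csInf_Icc hI.lt.le
  have e2 : sSup (Icc c b) = b := csSup_Icc hI'.lt.le
  exact ⟨Icc a d, h.mem_islands.2 ⟨a, d, hI, rfl⟩, Icc c b, h.mem_islands.2 ⟨c, b, hI', rfl⟩,
    by rwa [e1, e2], by rw [e1, e2]⟩
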